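/- Let $k$ be a field. A \emph{finite tensor category} over $k$ is a rigid monoidal category $\mathcal C$ that is $k$-linearly equivalent to the category of finitely generated right modules over a finite-dimensional $k$-algebra and whose tensor product is $k$-linear in each variable (the unit object $\mathbb 1$ need not be simple). Let $\mathrm{Rex}(\mathcal C)$ be the category of $k$-linear right exact endofunctors of $\mathcal C$, and let $V\bullet X$ denote the copower of $X\in\mathcal C$ by a finite-dimensional vector space $V$, i.e. $\mathrm{Hom}(V\bullet X,Y)\cong\mathrm{Hom}_k(V,\mathrm{Hom}(X,Y))$. The \emph{modular object} $\alpha_{\mathcal C}$ is $\Upsilon^*(J_{\mathcal C})$, where $\Upsilon^*$ is a left adjoint of $\Upsilon:\mathcal C\to\mathrm{Rex}(\mathcal C)$, $X\mapsto(-)\otimes X$, and $J_{\mathcal C}=\mathrm{Hom}_{\mathcal C}(-,\mathbb 1)^*\bullet\mathbb 1$; it is defined up to isomorphism. Let $\mathcal B$ be a braided finite tensor category over $k$ with braiding $\sigma$, and let $H$ be a Hopf algebra in $\mathcal B$ with multiplication $m$, comultiplication $\Delta$ and counit $\varepsilon$. The category $\mathcal B_H$ of right $H$-modules in $\mathcal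 B$ is monoidal by the diagonal action $(\triangleleft_M\otimes\triangleleft_N)\circ(\mathrm{id}_M\otimes\sigma_{N,H}\otimes\mathrm{id}_H)\circ(\mathrm{id}_M\otimes\mathrm{id}_N\otimes\Delta)$ on $M\otimes N$. A right integral in $H$ is a morphism $t:X\to H$ with $m\circ(t\otimes\mathrm{id}_H)=t\otimes\varepsilon$. Let $\Lambda:\mathrm{Int}(H)\to H$ be a terminal object of the category of right integrals (a full subcategory of the category of objects over $H$), and let the modular function $\alpha_H:H\to\mathbb 1$ be the morphism determined by $\Lambda\circ(\alpha_H\otimes\mathrm{id}_{\mathrm{Int}(H)})=m\circ(\mathrm{id}_H\otimes\Lambda)$. An object of $\mathcal B$ is regarded as a right $H$-module by the counit, and an algebra morphism $\chi:H\to\mathbb 1$ as the right $H$-module $\mathbb 1$ with action $\chi$. For an object $V$, $V^*$ denotes the dual with evaluation $V^*\otimes V\to\mathbb 1$ and coevaluation $\mathbb 1\to V\otimes V^*$. Then $\mathcal C=\mathcal B_H$ is a finite tensor category over $k$; the modular objects $\alpha_{\mathcal B}$, $\alpha_{\mathcal C}$ and the terminal right integral $\Lambda$ exist; the modular function $\alpha_H$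 exists, is unique and is a morphism of algebras; and $$\alpha_{\mathcal C}\;\cong\;\mathrm{Int}(H)^*\otimes\alpha_H\otimes\alpha_{\mathcal B}\qquad\text{in }\mathcal B_H .$$ -/

import Mathlib

open CategoryTheory CategoryTheory.Limits CategoryTheory.MonoidalCategory

universe v u

section RightModules

open scoped MonObj ComonObj

variable {B : Type u} [Category.{v} B] [MonoidalCategory B]

/-- A right module over an algebra (monoid object) `H` in a monoidal category. -/
structure RightMod (H : B) [MonObj H] where
  /-- The underlying object. -/
  X : B
  /-- The action of `H`. -/
  act : X ⊗ H ⟶ X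
  act_one : X ◁ η[H] ≫ act = (ρ_ X).hom
  act_mul : X ◁ μ[H] ≫ act = (α_ X H H).inv ≫ act ▷ H ≫ act

namespace RightMod

section Category

variable {H : B} [MonObj H]

/-- Morphisms of right `H`-modules. -/
@[ext]
structure Hom (M N : RightMod H) where
  /-- The underlying morphism. -/
  hom : M.X ⟶ N.X
  comm : M.act ≫ hom = hom ▷ H ≫ N.act

instance : Category (RightMod H) where
  Hom := Hom
  id M := ⟨𝟙 M.X, by simp⟩
  comp f g := ⟨f.hom ≫ g.hom, by
    rw [← Category.assoc, f.comm, Category.assoc, g.comm, comp_whiskerRight, Category.assoc]⟩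

@[ext]
lemma hom_ext {M N : RightMod H} {f g : M ⟶ N} (h : f.hom = g.hom) : f = g := Hom.ext h

@[simp] lemma id_hom (M : RightMod H) : Hom.hom (𝟙 M) = 𝟙 M.X := rfl

@[simp] lemma comp_hom {M N P : RightMod H} (f : M ⟶ N) (g : N ⟶ P) :
    (f ≫ g).hom = f.hom ≫ g.hom := rfl

lemma hom_injective (M N : RightMod H) :
    Function.Injective (fun f : M ⟶ N => f.hom) := fun _ _ h => hom_ext h

variable (H) in
/-- The functor forgetting the action. -/
@[simps]
def forget : RightMod H ⥤ B where
  obj M := M.X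
  map f := f.hom

instance : (forget H).Faithful where
  map_injective h := hom_ext h

/-- An isomorphism of underlying objects that is `H`-linear is an isomorphism of modules. -/
@[simps]
def isoMk {M N : RightMod H} (e : M.X ≅ N.X) (h : M.act ≫ e.hom = e.hom ▷ H ≫ N.act) :
    M ≅ N where
  hom := ⟨e.hom, h⟩
  inv := ⟨e.inv, by
    rw [← cancel_mono e.hom, Category.assoc, Category.assoc, h, e.inv_hom_id,
      ← comp_whiskerRight_assoc, e.inv_hom_id]
    simp⟩
  hom_inv_id := hom_ext e.hom_inv_id
  inv_hom_id := hom_ext e.inv_hom_id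

end Category

section Linear

variable {H : B} [MonObj H] [Preadditive B] [MonoidalPreadditive B]

instance (M N : RightMod H) : Zero (M ⟶ N) := ⟨⟨0, by simp⟩⟩
instance (M N : RightMod H) : Add (M ⟶ N) :=
  ⟨fun f g => ⟨f.hom + g.hom, by
    simp [f.comm, g.comm, MonoidalPreadditive.add_whiskerRight]⟩⟩
instance (M N : RightMod H) : Neg (M ⟶ N) :=
  ⟨fun f => ⟨-f.hom, by
    have : (-f.hom) ▷ H = -(f.hom ▷ H) := (tensorRight H).map_neg
    simp [f.comm, this]⟩⟩
instance (M N : RightMod H) : Sub (M ⟶ N) :=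
  ⟨fun f g => ⟨f.hom - g.hom, by
    have : (f.hom - g.hom) ▷ H = f.hom ▷ H - g.hom ▷ H := (tensorRight H).map_sub
    simp [f.comm, g.comm, this]⟩⟩
instance (M N : RightMod H) : SMul ℕ (M ⟶ N) :=
  ⟨fun n f => ⟨n • f.hom, by
    have : (n • f.hom) ▷ H = n • (f.hom ▷ H) := (tensorRight H).map_nsmul
    simp [f.comm, this]⟩⟩
instance (M N : RightMod H) : SMul ℤ (M ⟶ N) :=
  ⟨fun n f => ⟨n • f.hom, by
    have : (n • f.hom) ▷ H = n • (f.hom ▷ H) := (tensorRight H).map_zsmul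
    simp [f.comm, this]⟩⟩

instance (M N : RightMod H) : AddCommGroup (M ⟶ N) :=
  (hom_injective M N).addCommGroup _ rfl (fun _ _ => rfl) (fun _ => rfl) (fun _ _ => rfl)
    (fun _ _ => rfl) (fun _ _ => rfl)

@[simp] lemma zero_hom (M N : RightMod H) : (0 : M ⟶ N).hom = 0 := rfl
@[simp] lemma add_hom {M N : RightMod H} (f g : M ⟶ N) : (f + g).hom = f.hom + g.hom := rfl

instance : Preadditive (RightMod H) where
  add_comp _ _ _ _ _ _ := hom_ext (Preadditive.add_comp ..)
  comp_add _ _ _ _ _ _ := hom_ext (Preadditive.comp_add ..)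

variable {k : Type v} [Field k] [Linear k B] [MonoidalLinear k B]

instance (M N : RightMod H) : SMul k (M ⟶ N) :=
  ⟨fun r f => ⟨r • f.hom, by simp [f.comm]⟩⟩

@[simp] lemma smul_hom {M N : RightMod H} (r : k) (f : M ⟶ N) : (r • f).hom = r • f.hom := rfl

/-- The underlying morphism, as an additive map. -/
def homAddHom (M N : RightMod H) : (M ⟶ N) →+ (M.X ⟶ N.X) where
  toFun f := f.hom
  map_zero' := rfl
  map_add' _ _ := rfl

instance (M N : RightMod H) : Module k (M ⟶ N) :=
  (hom_injective M N).module k (homAddHom M N) (fun _ _ => rfl)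

instance : Linear k (RightMod H) where
  smul_comp _ _ _ _ _ _ := hom_ext (Linear.smul_comp ..)
  comp_smul _ _ _ _ _ _ := hom_ext (Linear.comp_smul ..)

end Linear

section Monoidal

/-- The right `H`-module with underlying object `𝟙_` given by an algebra map `χ : H ⟶ 𝟙_`. -/
def ofChar {H : B} [MonObj H] (χ : H ⟶ 𝟙_ B) [IsMonHom χ] : RightMod H where
  X := 𝟙_ B
  act := (λ_ H).hom ≫ χ
  act_one := by
    have h : η[H] ≫ χ = 𝟙 (𝟙_ B) := IsMonHom.one_hom χ
    rw [leftUnitor_naturality_assoc, h, Category.comp_id, unitors_equal]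
  act_mul := by
    have h : μ[H] ≫ χ = (χ ⊗ₘ χ) ≫ (λ_ (𝟙_ B)).hom := IsMonHom.mul_hom χ
    rw [leftUnitor_naturality_assoc, h, MonoidalCategory.tensorHom_def, Category.assoc,
      leftUnitor_naturality, comp_whiskerRight_assoc]
    simp

variable [BraidedCategory B] {H : B} [BimonObj H]

/-- The tensor product of right `H`-modules, with the diagonal action
`(◁_M ⊗ ◁_N) ∘ (M ⊗ σ_{N,H} ⊗ H) ∘ (M ⊗ N ⊗ Δ)`. -/
def tens (M N : RightMod H) : RightMod H where
  X := M.X ⊗ N.X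
  act := (M.X ⊗ N.X) ◁ Δ[H] ≫ tensorμ M.X N.X H H ≫ (M.act ⊗ₘ N.act)
  act_one := by
    have h1 : η[H] ≫ Δ[H] = (λ_ (𝟙_ B)).inv ≫ (η[H] ⊗ₘ η[H]) := BimonObj.one_comul H
    rw [← whiskerLeft_comp_assoc, h1, whiskerLeft_comp_assoc,
      tensorμ_natural_right_assoc, tensorHom_comp_tensorHom, M.act_one, N.act_one,
      ← tensor_right_unitality]
  act_mul := by
    have h1 : μ[H] ≫ Δ[H] = (Δ[H] ⊗ₘ Δ[H]) ≫ tensorμ H H H H ≫ (μ[H] ⊗ₘ μ[H]) :=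
      BimonObj.mul_comul H
    have h2 := tensor_associativity M.X N.X H H H H
    have h3 : (M.X ⊗ N.X) ◁ tensorμ H H H H ≫ tensorμ M.X N.X (H ⊗ H) (H ⊗ H) =
        (α_ _ _ _).inv ≫ tensorμ M.X N.X H H ▷ (H ⊗ H) ≫
          tensorμ (M.X ⊗ H) (N.X ⊗ H) H H ≫ ((α_ _ _ _).hom ⊗ₘ (α_ _ _ _).hom) := by
      rw [h2, Iso.inv_hom_id_assoc]
    rw [← whiskerLeft_comp_assoc, h1]
    simp only [whiskerLeft_comp, Category.assoc]
    rw [tensorμ_natural_right_assoc, tensorHom_comp_tensorHom, M.act_mul, N.act_mul]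
    have h4 : (M.X ⊗ N.X) ◁ (Δ[H] ⊗ₘ Δ[H]) ≫ (α_ (M.X ⊗ N.X) (H ⊗ H) (H ⊗ H)).inv =
        (α_ (M.X ⊗ N.X) H H).inv ≫ ((M.X ⊗ N.X) ◁ Δ[H]) ▷ H ≫
          ((M.X ⊗ N.X) ⊗ (H ⊗ H)) ◁ Δ[H] := by
      rw [MonoidalCategory.tensorHom_def, whiskerLeft_comp, Category.assoc,
        associator_inv_naturality_right, associator_inv_naturality_middle_assoc]
    rw [reassoc_of% h3, tensorHom_comp_tensorHom, Iso.hom_inv_id_assoc, Iso.hom_inv_id_assoc,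
      ← tensorHom_comp_tensorHom, ← tensorμ_natural_left_assoc, reassoc_of% h4]
    simp only [comp_whiskerRight, Category.assoc]
    rw [whisker_exchange_assoc, whisker_exchange_assoc]

/-- The right `H`-module given by an object with the action by the counit. -/
def triv (H : B) [BimonObj H] (V : B) : RightMod H where
  X := V
  act := V ◁ ε[H] ≫ (ρ_ V).hom
  act_one := by
    rw [← whiskerLeft_comp_assoc, BimonObj.one_counit]; simp
  act_mul := by
    have h : μ[H] ≫ ε[H] = (ε[H] ⊗ₘ ε[H]) ≫ (λ_ (𝟙_ B)).hom := BimonObj.mul_counit H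
    rw [← whiskerLeft_comp_assoc, h, MonoidalCategory.tensorHom_def]
    simp

lemma tens_comm {M M' N N' : RightMod H} (f : M ⟶ M') (g : N ⟶ N') :
    (tens M N).act ≫ (f.hom ⊗ₘ g.hom) = (f.hom ⊗ₘ g.hom) ▷ H ≫ (tens M' N').act := by
  simp only [tens, Category.assoc]
  rw [tensorHom_comp_tensorHom, f.comm, g.comm, ← tensorHom_comp_tensorHom,
    ← tensorμ_natural_left_assoc, whisker_exchange_assoc]

lemma assoc_comm (M N P : RightMod H) :
    (tens (tens M N) P).act ≫ (α_ M.X N.X P.X).hom =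
      (α_ M.X N.X P.X).hom ▷ H ≫ (tens M (tens N P)).act := by
  have h := associator_monoidal M.X N.X P.X H H H
  have e1 : ((M.X ⊗ N.X) ◁ Δ[H] ≫ tensorμ M.X N.X H H ≫ (M.act ⊗ₘ N.act)) ⊗ₘ P.act =
      ((M.X ⊗ N.X) ◁ Δ[H] ⊗ₘ P.X ◁ 𝟙 H) ≫ tensorμ M.X N.X H H ▷ (P.X ⊗ H) ≫
        ((M.act ⊗ₘ N.act) ⊗ₘ P.act) := by
    rw [← tensorHom_id, tensorHom_comp_tensorHom, tensorHom_comp_tensorHom]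
    simp
  have e2 : M.act ⊗ₘ ((N.X ⊗ P.X) ◁ Δ[H] ≫ tensorμ N.X P.X H H ≫ (N.act ⊗ₘ P.act)) =
      (M.X ◁ 𝟙 H ⊗ₘ (N.X ⊗ P.X) ◁ Δ[H]) ≫ (M.X ⊗ H) ◁ tensorμ N.X P.X H H ≫
        (M.act ⊗ₘ (N.act ⊗ₘ P.act)) := by
    rw [← id_tensorHom (M.X ⊗ H), tensorHom_comp_tensorHom, tensorHom_comp_tensorHom]
    simp
  simp only [tens, Category.assoc]
  rw [e1, e2]
  simp only [Category.assoc]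
  rw [← tensorμ_natural_right_assoc, ← tensorμ_natural_right_assoc, associator_naturality,
    reassoc_of% h, tensorHom_id, id_tensorHom, ← whiskerLeft_comp_assoc,
    ← whiskerLeft_comp_assoc, ← whisker_exchange_assoc, MonoidalCategory.tensorHom_def'_assoc,
    ← whiskerLeft_comp_assoc, Category.assoc, ComonObj.comul_assoc]

lemma left_comm (M : RightMod H) :
    (tens (triv H (𝟙_ B)) M).act ≫ (λ_ M.X).hom = (λ_ M.X).hom ▷ H ≫ M.act := by
  have e1 : (𝟙_ B ◁ ε[H] ≫ (ρ_ (𝟙_ B)).hom) ⊗ₘ M.act =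
      (𝟙_ B ◁ ε[H] ⊗ₘ M.X ◁ 𝟙 H) ≫ (λ_ (𝟙_ B)).hom ▷ (M.X ⊗ H) ≫ 𝟙_ B ◁ M.act := by
    rw [← MonoidalCategory.tensorHom_def, tensorHom_comp_tensorHom, unitors_equal]
    simp
  simp only [tens, triv, Category.assoc]
  rw [e1]
  simp only [Category.assoc]
  rw [leftUnitor_naturality, ← tensorμ_natural_right_assoc,
    ← reassoc_of% (leftUnitor_monoidal M.X H), ← whiskerLeft_comp_assoc, tensorHom_id,
    ComonObj.counit_comul, MonoidalCategory.tensorHom_def'_assoc,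
    ← whiskerLeft_comp_assoc, Iso.inv_hom_id]
  simp

lemma right_comm (M : RightMod H) :
    (tens M (triv H (𝟙_ B))).act ≫ (ρ_ M.X).hom = (ρ_ M.X).hom ▷ H ≫ M.act := by
  have e1 : M.act ⊗ₘ (𝟙_ B ◁ ε[H] ≫ (ρ_ (𝟙_ B)).hom) =
      (M.X ◁ 𝟙 H ⊗ₘ 𝟙_ B ◁ ε[H]) ≫ (M.X ⊗ H) ◁ (λ_ (𝟙_ B)).hom ≫ M.act ▷ 𝟙_ B := by
    rw [← MonoidalCategory.tensorHom_def', tensorHom_comp_tensorHom, unitors_equal]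
    simp
  simp only [tens, triv, Category.assoc]
  rw [e1]
  simp only [Category.assoc]
  rw [rightUnitor_naturality, ← tensorμ_natural_right_assoc,
    ← reassoc_of% (rightUnitor_monoidal M.X H), ← whiskerLeft_comp_assoc, id_tensorHom,
    ComonObj.comul_counit, MonoidalCategory.tensorHom_def'_assoc,
    ← whiskerLeft_comp_assoc, Iso.inv_hom_id]
  simp

instance : MonoidalCategoryStruct (RightMod H) where
  tensorObj := tens
  whiskerLeft M _ _ f := ⟨M.X ◁ f.hom, by
    have h := tens_comm (𝟙 M) f
    rwa [id_hom, id_tensorHom] at h⟩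
  whiskerRight f N := ⟨f.hom ▷ N.X, by
    have h := tens_comm f (𝟙 N)
    rwa [id_hom, tensorHom_id] at h⟩
  tensorHom f g := ⟨f.hom ⊗ₘ g.hom, tens_comm f g⟩
  tensorUnit := triv H (𝟙_ B)
  associator M N P := isoMk (α_ M.X N.X P.X) (assoc_comm M N P)
  leftUnitor M := isoMk (λ_ M.X) (left_comm M)
  rightUnitor M := isoMk (ρ_ M.X) (right_comm M)

@[simp] lemma tensorObj_X (M N : RightMod H) : (M ⊗ N).X = M.X ⊗ N.X := rfl
@[simp] lemma tensorUnit_X : (𝟙_ (RightMod H)).X = 𝟙_ B := rfl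

instance : MonoidalCategory (RightMod H) where
  tensorHom_def _ _ := hom_ext (MonoidalCategory.tensorHom_def ..)
  id_tensorHom_id _ _ := hom_ext (id_tensorHom_id ..)
  tensorHom_comp_tensorHom _ _ _ _ := hom_ext (tensorHom_comp_tensorHom ..)
  whiskerLeft_id _ _ := hom_ext (whiskerLeft_id ..)
  id_whiskerRight _ _ := hom_ext (id_whiskerRight ..)
  associator_naturality _ _ _ := hom_ext (associator_naturality ..)
  leftUnitor_naturality _ := hom_ext (leftUnitor_naturality ..)
  rightUnitor_naturality _ := hom_ext (rightUnitor_naturality ..)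
  pentagon _ _ _ _ := hom_ext (pentagon ..)
  triangle _ _ := hom_ext (triangle ..)

end Monoidal

section MonoidalLinear

variable [BraidedCategory B] [Preadditive B] [MonoidalPreadditive B] {H : B} [BimonObj H]

instance : MonoidalPreadditive (RightMod H) where
  whiskerLeft_zero := hom_ext (MonoidalPreadditive.whiskerLeft_zero ..)
  zero_whiskerRight := hom_ext (MonoidalPreadditive.zero_whiskerRight ..)
  whiskerLeft_add _ _ := hom_ext (MonoidalPreadditive.whiskerLeft_add ..)
  add_whiskerRight _ _ := hom_ext (MonoidalPreadditive.add_whiskerRight ..)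

variable {k : Type v} [Field k] [Linear k B] [MonoidalLinear k B]

instance : MonoidalLinear k (RightMod H) where
  whiskerLeft_smul _ _ _ _ _ := hom_ext (MonoidalLinear.whiskerLeft_smul ..)
  smul_whiskerRight _ _ _ _ _ := hom_ext (MonoidalLinear.smul_whiskerRight ..)

end MonoidalLinear

end RightMod

end RightModules

section FiniteTensor

variable (k : Type v) [Field k]

/-- A `k`-linear category is finite (abelian) if it is `k`-linearly equivalent to the category of
finitely generated right modules over a finite-dimensional `k`-algebra `A`, a right `A`-module
being a module over the opposite algebra. Such a category is automatically abelian. -/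
class IsFiniteAbelian (C : Type u) [Category.{v} C] [Preadditive C] [Linear k C] : Prop where
  exists_equiv : ∃ (A : Type v) (_ : Ring A) (_ : Algebra k A) (_ : Module.Finite k A)
    (e : C ≌ FGModuleCat.{v} Aᵐᵒᵖ) (_ : e.functor.Additive), e.functor.Linear k

/-- A finite tensor category over `k`: a rigid monoidal category that is a finite abelian category
over `k` and whose tensor product is `k`-linear in each variable. The unit object is not assumed to
be simple. -/
class IsFiniteTensorCategory (C : Type u) [Category.{v} C] [Preadditive C] [Linear k C]
    [MonoidalCategory C] [MonoidalPreadditive C] [MonoidalLinear k C] : Prop extends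
    IsFiniteAbelian k C where
  rigid : Nonempty (RigidCategory C)

namespace IsFiniteAbelian

lemma hasFiniteBiproducts (k : Type v) [Field k] (C : Type u) [Category.{v} C] [Preadditive C]
    [Linear k C] [IsFiniteAbelian k C] : HasFiniteBiproducts C := by
  obtain ⟨A, _, _, _, e, he, -⟩ := IsFiniteAbelian.exists_equiv (k := k) (C := C)
  have : Module.Finite k Aᵐᵒᵖ := Module.Finite.equiv (MulOpposite.opLinearEquiv k)
  have : IsNoetherianRing Aᵐᵒᵖ := isNoetherian_of_tower k inferInstance
  have : HasFiniteLimits C :=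
    ⟨fun _ _ _ => Adjunction.hasLimitsOfShape_of_equivalence e.functor⟩
  exact HasFiniteBiproducts.of_hasFiniteProducts

open scoped ModuleCat in
lemma finite_hom (k : Type v) [Field k] {C : Type u} [Category.{v} C] [Preadditive C]
    [Linear k C] [IsFiniteAbelian k C] (X Y : C) : Module.Finite k (X ⟶ Y) := by
  obtain ⟨A, _, _, _, e, he, hl⟩ := IsFiniteAbelian.exists_equiv (k := k) (C := C)
  have : Module.Finite k Aᵐᵒᵖ := Module.Finite.equiv (MulOpposite.opLinearEquiv k)
  have hM (M : FGModuleCat.{v} Aᵐᵒᵖ) : Module.Finite k M.obj := by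
    have : Module.Finite Aᵐᵒᵖ M.obj := M.property
    exact Module.Finite.trans Aᵐᵒᵖ M.obj
  have := hM (e.functor.obj X)
  have := hM (e.functor.obj Y)
  let φ : (X ⟶ Y) →ₗ[k] ((e.functor.obj X).obj →ₗ[k] (e.functor.obj Y).obj) :=
    { toFun := fun f => (e.functor.map f).hom.hom.restrictScalars k
      map_add' := fun f g => by rw [e.functor.map_add]; rfl
      map_smul' := fun r f => by rw [e.functor.map_smul]; rfl }
  refine Module.Finite.of_injective φ fun f g h => e.functor.map_injective ?_
  apply FGModuleCat.hom_ext
  ext x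
  exact LinearMap.congr_fun h x

end IsFiniteAbelian

end FiniteTensor

section ModularObject

/-- The property of being a `k`-linear right exact endofunctor. -/
def rexProp (k : Type v) [Field k] (C : Type u) [Category.{v} C] [Preadditive C] [Linear k C] :
    ObjectProperty (C ⥤ C) :=
  fun F => (∃ _ : F.Additive, F.Linear k) ∧ PreservesFiniteColimits F

/-- The category of `k`-linear right exact endofunctors of `C` and natural transformations. -/
abbrev Rex (k : Type v) [Field k] (C : Type u) [Category.{v} C] [Preadditive C] [Linear k C] :=
  (rexProp k C).FullSubcategory

/-- The functor `Hom(M, -)` with values in finite-dimensional vector spaces. -/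
def homFunctor (k : Type v) [Field k] {C : Type u} [Category.{v} C] [Preadditive C] [Linear k C]
    [IsFiniteAbelian k C] (M : C) : C ⥤ FGModuleCat.{v} k where
  obj Y := haveI := IsFiniteAbelian.finite_hom k M Y; FGModuleCat.of k (M ⟶ Y)
  map {Y Y'} g :=
    haveI := IsFiniteAbelian.finite_hom k M Y
    haveI := IsFiniteAbelian.finite_hom k M Y'
    FGModuleCat.ofHom (Linear.rightComp k M g)
  map_id Y := by ext f; exact Category.comp_id f
  map_comp g h := by ext f; exact (Category.assoc f g h).symm

/-- The functor `Hom(-, M)^*` with values in finite-dimensional vector spaces. -/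
def dualHomFunctor (k : Type v) [Field k] {C : Type u} [Category.{v} C] [Preadditive C]
    [Linear k C] [IsFiniteAbelian k C] (M : C) : C ⥤ FGModuleCat.{v} k where
  obj X := haveI := IsFiniteAbelian.finite_hom k X M; FGModuleCat.of k (Module.Dual k (X ⟶ M))
  map {X X'} f :=
    haveI := IsFiniteAbelian.finite_hom k X M
    haveI := IsFiniteAbelian.finite_hom k X' M
    FGModuleCat.ofHom (Module.Dual.transpose (Linear.leftComp k M f))
  map_id X := by
    apply FGModuleCat.hom_ext
    ext φ g
    exact congrArg φ (Category.id_comp g)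
  map_comp f f' := by
    apply FGModuleCat.hom_ext
    ext φ g
    exact congrArg φ (Category.assoc f f' g)

variable (k : Type v) [Field k] {C : Type u} [Category.{v} C] [Preadditive C] [Linear k C]
  [IsFiniteAbelian k C]

section Plain

variable (M : C) (V : Type v) [AddCommGroup V] [Module k V]

/-- The underlying object of the copower `V • M`: a direct sum of `dim V` copies of `M`. -/
noncomputable def copowerObj : C :=
  have := IsFiniteAbelian.hasFiniteBiproducts k C
  ⨁ fun _ : Fin (Module.finrank k V) => M

/-- The `i`-th inclusion `M ⟶ V • M` (with respect to a chosen basis of `V`). -/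
noncomputable def copowerι (i : Fin (Module.finrank k V)) : M ⟶ copowerObj k M V :=
  have := IsFiniteAbelian.hasFiniteBiproducts k C
  biproduct.ι (fun _ : Fin (Module.finrank k V) => M) i

/-- The `i`-th projection `V • M ⟶ M` (with respect to a chosen basis of `V`). -/
noncomputable def copowerπ (i : Fin (Module.finrank k V)) : copowerObj k M V ⟶ M :=
  have := IsFiniteAbelian.hasFiniteBiproducts k C
  biproduct.π (fun _ : Fin (Module.finrank k V) => M) i

/-- A morphism out of `V • M` from a family of morphisms. -/
noncomputable def copowerDesc {Y : C} (p : Fin (Module.finrank k V) → (M ⟶ Y)) :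
    copowerObj k M V ⟶ Y :=
  have := IsFiniteAbelian.hasFiniteBiproducts k C
  biproduct.desc p

/-- A morphism into `V • M` from a family of morphisms. -/
noncomputable def copowerLift {X : C} (p : Fin (Module.finrank k V) → (X ⟶ M)) :
    X ⟶ copowerObj k M V :=
  have := IsFiniteAbelian.hasFiniteBiproducts k C
  biproduct.lift p

lemma copowerι_desc {Y : C} (p : Fin (Module.finrank k V) → (M ⟶ Y)) (i) :
    copowerι k M V i ≫ copowerDesc k M V p = p i :=
  have := IsFiniteAbelian.hasFiniteBiproducts k C
  biproduct.ι_desc p i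

lemma copowerLift_π {X : C} (p : Fin (Module.finrank k V) → (X ⟶ M)) (i) :
    copowerLift k M V p ≫ copowerπ k M V i = p i :=
  have := IsFiniteAbelian.hasFiniteBiproducts k C
  biproduct.lift_π p i

variable {k M V} in
lemma copower_hom_ext_from {Y : C} {f g : copowerObj k M V ⟶ Y}
    (h : ∀ i, copowerι k M V i ≫ f = copowerι k M V i ≫ g) : f = g :=
  have := IsFiniteAbelian.hasFiniteBiproducts k C
  biproduct.hom_ext' f g h

variable {k M V} in
lemma copower_hom_ext_to {X : C} {f g : X ⟶ copowerObj k M V}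
    (h : ∀ i, f ≫ copowerπ k M V i = g ≫ copowerπ k M V i) : f = g :=
  have := IsFiniteAbelian.hasFiniteBiproducts k C
  biproduct.hom_ext f g h

variable [Module.Finite k V]

/-- The bijection `Hom(V • M, Y) ≃ Hom_k(V, Hom(M, Y))`, through a basis of `V`. -/
noncomputable def copowerLinEquiv (Y : C) : (copowerObj k M V ⟶ Y) ≃ (V →ₗ[k] (M ⟶ Y)) where
  toFun f := (Module.finBasis k V).constr k fun i => copowerι k M V i ≫ f
  invFun φ := copowerDesc k M V fun i => φ (Module.finBasis k V i)
  left_inv f := copower_hom_ext_from fun i => by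
    rw [copowerι_desc, Module.Basis.constr_basis]
  right_inv φ := (Module.finBasis k V).ext fun i => by
    rw [Module.Basis.constr_basis, copowerι_desc]

/-- The bijection `Hom_k(Hom(X, M)^*, V) ≃ Hom(X, V • M)`, through a basis of `V`. -/
noncomputable def dualHomLinEquiv (X : C) :
    (Module.Dual k (X ⟶ M) →ₗ[k] V) ≃ (X ⟶ copowerObj k M V) :=
  have := IsFiniteAbelian.finite_hom k X M
  { toFun := fun ψ => copowerLift k M V fun i =>
      (Module.evalEquiv k (X ⟶ M)).symm ((Module.finBasis k V).coord i ∘ₗ ψ)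
    invFun := fun f => ∑ i, (Module.Dual.eval k (X ⟶ M) (f ≫ copowerπ k M V i)).smulRight
        (Module.finBasis k V i)
    left_inv := fun ψ => by
      ext φ
      refine Eq.trans ?_ ((Module.finBasis k V).sum_repr (ψ φ))
      simp only [copowerLift_π, LinearMap.sum_apply, LinearMap.smulRight_apply,
        Module.Dual.eval_apply, Module.apply_evalEquiv_symm_apply]
      rfl
    right_inv := fun f => copower_hom_ext_to fun i => by
      rw [copowerLift_π, LinearEquiv.symm_apply_eq]
      ext φ
      simp [Finsupp.single_apply] }

end Plain

/-- The bijection `Hom(V • M, Y) ≃ Hom_k(V, Hom(M, Y))`. -/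
noncomputable def copowerEquiv (M : C) (V : FGModuleCat.{v} k) (Y : C) :
    (copowerObj k M V ⟶ Y) ≃ (V ⟶ (homFunctor k M).obj Y) :=
  (copowerLinEquiv k M V Y).trans
    { toFun := fun φ => ConcreteCategory.ofHom φ
      invFun := fun φ => φ.hom.hom
      left_inv := fun _ => rfl
      right_inv := fun _ => rfl }

lemma copowerLinEquiv_naturality (M : C) (V : Type v) [AddCommGroup V] [Module k V]
    [Module.Finite k V] (Y Y' : C) (g : Y ⟶ Y') (h : copowerObj k M V ⟶ Y) :
    copowerLinEquiv k M V Y' (h ≫ g) = Linear.rightComp k M g ∘ₗ copowerLinEquiv k M V Y h :=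
  (Module.finBasis k V).ext fun i => by
    simp [copowerLinEquiv]

lemma copowerEquiv_naturality (M : C) (V : FGModuleCat.{v} k) (Y Y' : C) (g : Y ⟶ Y')
    (h : copowerObj k M V ⟶ Y) :
    copowerEquiv k M V Y' (h ≫ g) = copowerEquiv k M V Y h ≫ (homFunctor k M).map g :=
  FGModuleCat.hom_ext (copowerLinEquiv_naturality k M V Y Y' g h)

/-- The copower functor `V ↦ V • M`, determined by `Hom(V • M, Y) ≅ Hom_k(V, Hom(M, Y))`. -/
noncomputable def copower (M : C) : FGModuleCat.{v} k ⥤ C :=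
  Adjunction.leftAdjointOfEquiv (copowerEquiv k M) (copowerEquiv_naturality k M)

/-- The copower functor is left adjoint to `Hom(M, -)`. -/
noncomputable def copowerAdj (M : C) : copower k M ⊣ homFunctor k M :=
  Adjunction.adjunctionOfEquivLeft (copowerEquiv k M) (copowerEquiv_naturality k M)

/-- The bijection `Hom_k(Hom(X, M)^*, V) ≃ Hom(X, V • M)`. -/
noncomputable def dualHomEquiv (M : C) (X : C) (V : FGModuleCat.{v} k) :
    ((dualHomFunctor k M).obj X ⟶ V) ≃ (X ⟶ copowerObj k M V) :=
  Equiv.trans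
    { toFun := fun φ => φ.hom.hom
      invFun := fun φ => ConcreteCategory.ofHom φ
      left_inv := fun _ => rfl
      right_inv := fun _ => rfl } (dualHomLinEquiv k M V X)

lemma dualHomLinEquiv_naturality (M : C) (X' X : C) (V : Type v) [AddCommGroup V] [Module k V]
    [Module.Finite k V] (f : X' ⟶ X) (g : Module.Dual k (X ⟶ M) →ₗ[k] V) :
    dualHomLinEquiv k M V X' (g ∘ₗ Module.Dual.transpose (Linear.leftComp k M f)) =
      f ≫ dualHomLinEquiv k M V X g :=
  copower_hom_ext_to fun i => by
    have := IsFiniteAbelian.finite_hom k X M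
    have := IsFiniteAbelian.finite_hom k X' M
    simp only [dualHomLinEquiv, Equiv.coe_fn_mk, Category.assoc, copowerLift_π]
    rw [LinearEquiv.symm_apply_eq]
    ext φ
    exact (Module.apply_evalEquiv_symm_apply k (X ⟶ M) (Module.Dual.transpose (Linear.leftComp k M f) φ)
      ((Module.finBasis k V).coord i ∘ₗ g)).symm

lemma dualHomEquiv_naturality (M : C) (X' X : C) (V : FGModuleCat.{v} k) (f : X' ⟶ X)
    (g : (dualHomFunctor k M).obj X ⟶ V) :
    dualHomEquiv k M X' V ((dualHomFunctor k M).map f ≫ g) = f ≫ dualHomEquiv k M X V g :=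
  dualHomLinEquiv_naturality k M X' X V f g.hom.hom

/-- The functor `J = Hom(-, 𝟙)^* • 𝟙`. -/
noncomputable def trivialBimoduleFunctor [MonoidalCategory C] : C ⥤ C :=
  dualHomFunctor k (𝟙_ C) ⋙ copower k (𝟙_ C)

instance (M : C) : (homFunctor k M).Additive where
  map_add {Y Y' g h} := by
    apply FGModuleCat.hom_ext
    exact LinearMap.ext fun f : M ⟶ Y => Preadditive.comp_add _ _ _ f g h

instance (M : C) : (homFunctor k M).Linear k where
  map_smul {Y Y'} g r := by
    apply FGModuleCat.hom_ext
    exact LinearMap.ext fun f : M ⟶ Y => Linear.comp_smul _ _ _ f r g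

instance (M : C) : (dualHomFunctor k M).Additive where
  map_add {X X' g h} := by
    apply FGModuleCat.hom_ext
    refine LinearMap.ext fun φ : Module.Dual k (X ⟶ M) => LinearMap.ext fun f : X' ⟶ M => ?_
    exact (congrArg φ (Preadditive.add_comp _ _ _ g h f)).trans (φ.map_add _ _)

instance (M : C) : (dualHomFunctor k M).Linear k where
  map_smul {X X'} g r := by
    apply FGModuleCat.hom_ext
    refine LinearMap.ext fun φ : Module.Dual k (X ⟶ M) => LinearMap.ext fun f : X' ⟶ M => ?_
    exact (congrArg φ (Linear.smul_comp _ _ _ r g f)).trans (φ.map_smul _ _)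

instance (M : C) : (copower k M).Additive := (copowerAdj k M).left_adjoint_additive

instance (M : C) : (copower k M).Linear k where
  map_smul {V W} f r := by
    apply ((copowerAdj k M).homEquiv _ _).injective
    have h : (copowerAdj k M).unit.app V ≫ (homFunctor k M).map ((copower k M).map f) =
        f ≫ (copowerAdj k M).unit.app W := ((copowerAdj k M).unit.naturality f).symm
    simp only [Adjunction.homEquiv_unit, Functor.map_smul, Linear.comp_smul, h]
    exact ((copowerAdj k M).unit.naturality (r • f)).symm.trans (Linear.smul_comp _ _ _ r f _)

lemma rexProp_trivialBimoduleFunctor [MonoidalCategory C] :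
    rexProp k C (trivialBimoduleFunctor k) := by
  refine ⟨⟨?_, ?_⟩, ?_⟩
  · unfold trivialBimoduleFunctor; infer_instance
  · unfold trivialBimoduleFunctor; infer_instance
  · have := ((Adjunction.adjunctionOfEquivRight (dualHomEquiv k (𝟙_ C))
      (dualHomEquiv_naturality k (𝟙_ C))).comp (copowerAdj k (𝟙_ C))).leftAdjoint_preservesColimits
    exact ⟨fun J _ _ => inferInstanceAs
      (PreservesColimitsOfShape J (dualHomFunctor k (𝟙_ C) ⋙ copower k (𝟙_ C)))⟩

end ModularObject

section Cayley

variable (k : Type v) [Field k] (C : Type u) [Category.{v} C] [Preadditive C] [Linear k C]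
  [MonoidalCategory C] [MonoidalPreadditive C] [MonoidalLinear k C] [IsFiniteTensorCategory k C]

/-- The object `J = Hom(-, 𝟙)^* • 𝟙` of `Rex(C)`. -/
noncomputable def rexJ : Rex k C := ⟨trivialBimoduleFunctor k, rexProp_trivialBimoduleFunctor k⟩

variable {C} in
lemma rexProp_tensorRight (X : C) : rexProp k C (tensorRight X) := by
  obtain ⟨_⟩ := IsFiniteTensorCategory.rigid (k := k) (C := C)
  have := (tensorRightAdjunction X Xᘁ).leftAdjoint_preservesColimits
  exact ⟨⟨inferInstance, inferInstance⟩, ⟨fun J _ _ => inferInstance⟩⟩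

/-- The Cayley functor `C ⥤ Rex(C)`, `X ↦ (-) ⊗ X`. -/
def cayley : C ⥤ Rex k C :=
  (rexProp k C).lift (tensoringRight C) (rexProp_tensorRight k)

variable {C} in
/-- `a` is (isomorphic to) the modular object of the finite tensor category `C`: the image of
`J = Hom(-, 𝟙)^* • 𝟙` under a left adjoint of the Cayley functor. -/
def IsModularObject (a : C) : Prop :=
  ∃ L : Rex k C ⥤ C, Nonempty (L ⊣ cayley k C) ∧ Nonempty (a ≅ L.obj (rexJ k C))

end Cayley

section Integrals

open scoped MonObj ComonObj

variable {B : Type u} [Category.{v} B] [MonoidalCategory B] [BraidedCategory B]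

/-- A morphism `t : X ⟶ H` is a right integral in `H` if `m ∘ (t ⊗ H) = t ⊗ ε`. -/
def isRightIntegral (H : B) [BimonObj H] : ObjectProperty (Over H) :=
  fun t => t.hom ▷ H ≫ μ[H] = (t.hom ⊗ₘ ε[H]) ≫ (ρ_ H).hom

/-- The category of right integrals in `H`, a full subcategory of the category of objects
over `H`. -/
abbrev RightIntegral (H : B) [BimonObj H] := (isRightIntegral H).FullSubcategory

/-- The equation `Λ ∘ (χ ⊗ I) = m ∘ (H ⊗ Λ)` of morphisms `H ⊗ I ⟶ H`, which determines the
modular function when `Λ : I ⟶ H` is the universal right integral. -/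
def IsModularFunction {H : B} [BimonObj H] (Λ : RightIntegral H) (χ : H ⟶ 𝟙_ B) : Prop :=
  χ ▷ Λ.obj.left ≫ (λ_ Λ.obj.left).hom ≫ Λ.obj.hom = H ◁ Λ.obj.hom ≫ μ[H]

end Integrals

/-! A modular object of `C` is an object `a` with a universal natural transformation `J ⟶ (-) ⊗ a`
(`isModularObject_iff`). A right exact additive functor is determined by its value on a progenerator
together with the action of the endomorphisms (`IsProgenerator.existsUnique_desc`), so over `H`
everything can be tested on free modules `V ⊗ H`. There `J` is understood: maps `V ⊗ H ⟶ 𝟙_` of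
modules are maps `V ⟶ 𝟙_` in `B`, so `J (V ⊗ H)` is `J_B V` with trivial action, and a module map
between free modules acts on it only through its reduction along the counit
(`exists_trivialBimoduleFunctor_free_iso`).

A transformation `J ⟶ (-) ⊗ X` of functors on modules is therefore a natural family `J_B V ⟶ V ⊗ H ⊗
X`, which the universality of `α_B` turns into one module map `g : α_B ⟶ H ⊗ X`. Naturality for all
module maps between free modules, not only those coming from `B`, says that left multiplication by
`H` acts on `g` through the counit (`exists_isLeftInvariant`). Hence `g` factors through `I ⊗ X`
along the left integral `S ∘ Λ`, where `I = Int(H)`. From `h Λ = α_H(h) Λ` it follows that right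
multiplication acts on `S ∘ Λ` by the character `ψ = α_H ∘ S⁻¹`, so `g` is a module map `α_B ⟶ ψ ⊗ I
⊗ X`. Moving `ψ` and `I` to the other side, and noting that the convolution inverse of `ψ` is `ψ ∘ S
= α_H`, gives a map `I^* ⊗ α_H ⊗ α_B ⟶ X` (`exists_universal_isLeftInvariant`).

The argument needs `S` and `I` to be invertible. Both follow from the freeness of the dual `D` of
the regular module, `D ≅ V ⊗ H` with `V` its coinvariants (`dualRegIso`), a Yoneda consequence of
the fusion isomorphism between `N ⊗ H` with the trivial and with the given action on `N`. Comparing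
maps from trivial modules into both sides gives `V ⊗ I ≅ 𝟙_` (`integralInvIso`). Moreover `H` acts
on `D` through `S` and on a free module faithfully, so `S` is a monomorphism, hence invertible
because `End(H)` is finite-dimensional (`isIso_antipode`). Invertibility of `I` produces the modular
function; invertibility of `S` gives duals of modules on both sides. Finiteness of the category of
modules is Morita theory for the progenerator `P ⊗ H`. -/

/-! ### Progenerators and right exact functors. -/

section Progenerator

universe v' u'

attribute [local instance] Abelian.hasFiniteBiproducts

/-- A projective object such that every object is covered by finitely many copies of it. -/
structure IsProgenerator {C : Type u} [Category.{v} C] (P : C) : Prop where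
  projective : Projective P
  exists_family : ∀ M : C, ∃ (n : ℕ) (p : Fin n → (P ⟶ M)),
    ∀ ⦃Z : C⦄ (g h : M ⟶ Z), (∀ i, p i ≫ g = p i ≫ h) → g = h

namespace IsProgenerator

variable {C : Type u} [Category.{v} C] {P : C}

lemma hom_ext (hP : IsProgenerator P) {M Z : C} {g h : M ⟶ Z}
    (H : ∀ p : P ⟶ M, p ≫ g = p ≫ h) : g = h := by
  obtain ⟨n, p, hp⟩ := hP.exists_family M
  exact hp g h fun i => H (p i)

variable [Abelian C]

lemma exists_epi (hP : IsProgenerator P) (M : C) :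
    ∃ (n : ℕ) (π : (⨁ fun _ : Fin n => P) ⟶ M), Epi π := by
  obtain ⟨n, p, hp⟩ := hP.exists_family M
  refine ⟨n, biproduct.desc p, ⟨fun g h e => hp g h fun i => ?_⟩⟩
  have := biproduct.ι (fun _ : Fin n => P) i ≫= e
  simpa using this

lemma exists_presentation (hP : IsProgenerator P) (M : C) :
    ∃ (m n : ℕ) (q : (⨁ fun _ : Fin m => P) ⟶ ⨁ fun _ : Fin n => P)
      (π : (⨁ fun _ : Fin n => P) ⟶ M) (w : q ≫ π = 0),
      Nonempty (IsColimit (CokernelCofork.ofπ π w)) := by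
  obtain ⟨n, π, hπ⟩ := hP.exists_epi M
  obtain ⟨m, q, hq⟩ := hP.exists_epi (kernel π)
  have w : (q ≫ kernel.ι π) ≫ π = 0 := by simp
  refine ⟨m, n, q ≫ kernel.ι π, π, w, ⟨?_⟩⟩
  have h : (ShortComplex.mk _ _ w).Exact := by
    have h0 : (ShortComplex.mk (kernel.ι π) π (by simp)).Exact :=
      ShortComplex.exact_kernel π
    exact (ShortComplex.exact_iff_of_epi_of_isIso_of_mono
      (S₁ := ShortComplex.mk _ _ w) (S₂ := ShortComplex.mk (kernel.ι π) π (by simp))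
      { τ₁ := q, τ₂ := 𝟙 _, τ₃ := 𝟙 _ }).2 h0
  exact h.gIsCokernel

/-- Projectivity lifts `p` through `π`, and the `e i` are the coordinates of the lift. Thus an `End
P`-linear assignment on maps `P ⟶ M` is fixed by its values on finitely many of them. -/
lemma exists_lift (hP : IsProgenerator P) {n : ℕ} {M : C} (π : (⨁ fun _ : Fin n => P) ⟶ M)
    [Epi π] (p : P ⟶ M) :
    ∃ e : Fin n → (P ⟶ P), p = ∑ i, e i ≫ biproduct.ι (fun _ : Fin n => P) i ≫ π := by
  have := hP.projective
  refine ⟨fun i => Projective.factorThru p π ≫ biproduct.π _ i, ?_⟩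
  have h : Projective.factorThru p π ≫
      (∑ i, biproduct.π (fun _ : Fin n => P) i ≫
          biproduct.ι (fun _ : Fin n => P) i) ≫ π = p := by
    rw [biproduct.total]; simp
  simp only [Preadditive.sum_comp, Preadditive.comp_sum, Category.assoc] at h ⊢
  exact h.symm

variable {D : Type u'} [Category.{v'} D] [Preadditive D]

/-- A right exact functor is determined by its value on a progenerator. -/
lemma existsUnique_desc (hP : IsProgenerator P) (F : C ⥤ D) [F.Additive]
    [PreservesFiniteColimits F] (M : C) (Z : D) (φ : (P ⟶ M) →+ (F.obj P ⟶ Z))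
    (hφ : ∀ (e : P ⟶ P) (p : P ⟶ M), φ (e ≫ p) = F.map e ≫ φ p) :
    ∃! g : F.obj M ⟶ Z, ∀ p, F.map p ≫ g = φ p := by
  obtain ⟨m, n, q, π, w, ⟨hc⟩⟩ := hP.exists_presentation M
  have hFc := CokernelCofork.mapIsColimit _ hc F
  have hπ : Epi π := Cofork.IsColimit.epi hc
  have hFπ : Epi (F.map π) := Cofork.IsColimit.epi hFc
  let Q (l : ℕ) := ⨁ fun _ : Fin l => P
  -- An additive functor preserves the decomposition of the identity of a biproduct, so the images
  -- of the inclusions are jointly epimorphic.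
  have hext {l : ℕ} {W : D} {a b : F.obj (Q l) ⟶ W}
      (h : ∀ i, F.map (biproduct.ι (fun _ : Fin l => P) i) ≫ a =
        F.map (biproduct.ι (fun _ : Fin l => P) i) ≫ b) : a = b := by
    have e : F.map (∑ i, biproduct.π (fun _ : Fin l => P) i ≫
        biproduct.ι (fun _ : Fin l => P) i) = 𝟙 _ := by
      rw [biproduct.total, F.map_id]
    rw [← Category.id_comp a, ← Category.id_comp b, ← e, F.map_sum]
    simp only [Preadditive.sum_comp, F.map_comp, Category.assoc, h]
  let p (i : Fin n) : P ⟶ M := biproduct.ι (fun _ : Fin n => P) i ≫ π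
  let t : F.obj (Q n) ⟶ Z := ∑ i, F.map (biproduct.π (fun _ : Fin n => P) i) ≫ φ (p i)
  -- By linearity of `φ` over `End P`, each component of `F.map q ≫ t` is `φ` of a component of `q ≫
  -- π`, which vanishes.
  have ht : F.map q ≫ t = 0 := by
    apply hext
    intro j
    simp only [t, Preadditive.comp_sum, comp_zero, ← F.map_comp_assoc, ← hφ, ← map_sum]
    have :
        ∑ i, (biproduct.ι (fun _ : Fin m => P) j ≫ q ≫ biproduct.π (fun _ : Fin n => P) i) ≫ p i =
        biproduct.ι (fun _ : Fin m => P) j ≫ q ≫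
          (∑ i, biproduct.π (fun _ : Fin n => P) i ≫
          biproduct.ι (fun _ : Fin n => P) i) ≫ π := by
      simp only [p, Preadditive.comp_sum, Preadditive.sum_comp, Category.assoc]
    simp only [Category.assoc] at this ⊢
    rw [this, biproduct.total]
    simp [w]
  obtain ⟨g, hg⟩ : ∃ g, F.map π ≫ g = t := ⟨_, (CokernelCofork.IsColimit.desc' hFc t ht).2⟩
  have hg' (i) : F.map (p i) ≫ g = φ (p i) := by
    simp only [p, F.map_comp, Category.assoc, hg, t, Preadditive.comp_sum]
    rw [Finset.sum_eq_single i]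
    · rw [← F.map_comp_assoc, biproduct.ι_π_self, F.map_id, Category.id_comp]
    · intro j _ hj
      rw [← F.map_comp_assoc, biproduct.ι_π_ne _ hj.symm, F.map_zero, zero_comp]
    · simp
  refine ⟨g, fun x => ?_, fun g' h' => ?_⟩
  · obtain ⟨e, rfl⟩ := hP.exists_lift π x
    simp only [map_sum, F.map_sum, Preadditive.sum_comp, hφ]
    refine Finset.sum_congr rfl fun i _ => ?_
    rw [F.map_comp, Category.assoc]
    exact congrArg _ (hg' i)
  · rw [← cancel_epi (F.map π)]
    apply hext
    intro i
    rw [← F.map_comp_assoc, ← F.map_comp_assoc, h', ← hg' i]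

/-- At each `M` both components solve the extension problem for `p ↦ θ.app P ≫ G.map p`, whose
solution is unique. -/
lemma natTrans_ext (hP : IsProgenerator P) {F G : C ⥤ D} [F.Additive]
    [PreservesFiniteColimits F] [G.Additive] {θ θ' : F ⟶ G} (h : θ.app P = θ'.app P) :
    θ = θ' := by
  ext M
  let φ : (P ⟶ M) →+ (F.obj P ⟶ G.obj M) :=
    { toFun := fun p => θ.app P ≫ G.map p
      map_zero' := by simp
      map_add' := by simp }
  refine (hP.existsUnique_desc F M _ φ ?_).unique ?_ ?_
  · intro e p; simp [φ]
  · intro p; simp [φ]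
  · intro p; simp [φ, h]

/-- A natural transformation out of a right exact functor, from its component at a
progenerator. -/
lemma exists_natTrans (hP : IsProgenerator P) {F G : C ⥤ D} [F.Additive]
    [PreservesFiniteColimits F] [G.Additive] (f : F.obj P ⟶ G.obj P)
    (hf : ∀ e : P ⟶ P, F.map e ≫ f = f ≫ G.map e) : ∃ θ : F ⟶ G, θ.app P = f := by
  let φ (M : C) : (P ⟶ M) →+ (F.obj P ⟶ G.obj M) :=
    { toFun := fun p => f ≫ G.map p
      map_zero' := by simp
      map_add' := by simp }
  have hφ (M : C) (e : P ⟶ P) (p : P ⟶ M) : φ M (e ≫ p) = F.map e ≫ φ M p := by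
    simp [φ, reassoc_of% hf e]
  choose θ hθ using fun M => (hP.existsUnique_desc F M _ (φ M) (hφ M)).exists
  refine ⟨{ app := θ, naturality := fun M N h => ?_ }, ?_⟩
  · let ψ : (P ⟶ M) →+ (F.obj P ⟶ G.obj N) :=
      { toFun := fun p => f ≫ G.map p ≫ G.map h
        map_zero' := by simp
        map_add' := by simp }
    refine (hP.existsUnique_desc F M _ ψ ?_).unique ?_ ?_
    · intro e p; simp [ψ, reassoc_of% hf e]
    · intro p; rw [← F.map_comp_assoc, hθ]; simp [φ, ψ]
    · intro p; rw [reassoc_of% hθ]; simp [φ, ψ]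
  · have := hθ P (𝟙 P)
    simpa [φ] using this

end IsProgenerator

end Progenerator

/-! ### Abelian structure and progenerator of a finite abelian category. -/

namespace IsFiniteAbelian

/-- Abelianness is transported along the equivalence. The equation records that the addition of
morphisms is the given one. -/
lemma isAbelian (k : Type v) [Field k] (C : Type u) [Category.{v} C] [Preadditive C]
    [Linear k C] [IsFiniteAbelian k C] : ∃ (a : Abelian C), a.toPreadditive = ‹Preadditive C› := by
  obtain ⟨A, _, _, _, e, he, -⟩ := IsFiniteAbelian.exists_equiv (k := k) (C := C)
  have : Module.Finite k Aᵐᵒᵖ := Module.Finite.equiv (MulOpposite.opLinearEquiv k)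
  have : IsNoetherianRing Aᵐᵒᵖ := isNoetherian_of_tower k inferInstance
  have := hasFiniteBiproducts k C
  exact ⟨abelianOfEquivalence e.functor, rfl⟩

/-- A finite abelian category is abelian. -/
@[reducible]
noncomputable def abelian (k : Type v) [Field k] (C : Type u) [Category.{v} C] [Preadditive C]
    [Linear k C] [IsFiniteAbelian k C] : Abelian C :=
  -- Only propositions are extracted from the existence statement, so that the structure built from
  -- them has the given preadditive structure by definition.
  have h : HasFiniteProducts C ∧ HasKernels C ∧ HasCokernels C ∧
      IsNormalMonoCategory C ∧ IsNormalEpiCategory C := by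
    obtain ⟨a, rfl⟩ := isAbelian k C
    exact ⟨inferInstance, inferInstance, inferInstance, inferInstance, inferInstance⟩
  have := h.1
  have := h.2.1
  have := h.2.2.1
  { h.2.2.2.1, h.2.2.2.2 with }

/-- The progenerator corresponds to the regular module: maps out of it pick elements, and a finite
generating set of a module yields the jointly epimorphic family. -/
lemma exists_progenerator (k : Type v) [Field k] (C : Type u) [Category.{v} C] [Preadditive C]
    [Linear k C] [IsFiniteAbelian k C] : ∃ P : C, IsProgenerator P := by
  obtain ⟨A, _, _, _, e, he, -⟩ := IsFiniteAbelian.exists_equiv (k := k) (C := C)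
  have : Module.Finite k Aᵐᵒᵖ := Module.Finite.equiv (MulOpposite.opLinearEquiv k)
  have : IsNoetherianRing Aᵐᵒᵖ := isNoetherian_of_tower k inferInstance
  let P : FGModuleCat.{v} Aᵐᵒᵖ := FGModuleCat.of Aᵐᵒᵖ Aᵐᵒᵖ
  have hproj : Projective P := by
    refine ⟨fun {E X} f g hg => ?_⟩
    have hg' : Epi ((forget₂ (FGModuleCat.{v} Aᵐᵒᵖ) (ModuleCat.{v} Aᵐᵒᵖ)).map g) := inferInstance
    have hs : Function.Surjective g.hom.hom := (ModuleCat.epi_iff_surjective _).1 hg'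
    obtain ⟨y, hy⟩ := hs (f.hom.hom (1 : Aᵐᵒᵖ))
    refine ⟨FGModuleCat.ofHom (LinearMap.toSpanSingleton Aᵐᵒᵖ E y), ?_⟩
    apply FGModuleCat.hom_ext
    refine LinearMap.ext_ring ?_
    refine Eq.trans ?_ hy
    exact congrArg g.hom.hom (one_smul Aᵐᵒᵖ y)
  refine ⟨e.inverse.obj P, ⟨e.symm.toAdjunction.map_projective P hproj, fun M => ?_⟩⟩
  obtain ⟨n, s, hs⟩ := Module.Finite.exists_fin (R := Aᵐᵒᵖ) (M := e.functor.obj M)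
  let q (i : Fin n) : P ⟶ e.functor.obj M :=
    FGModuleCat.ofHom (LinearMap.toSpanSingleton Aᵐᵒᵖ (e.functor.obj M) (s i))
  refine ⟨n, fun i => (e.symm.toAdjunction.homEquiv P M).symm (q i), fun Z g h hgh => ?_⟩
  apply e.functor.map_injective
  apply FGModuleCat.hom_ext
  refine LinearMap.ext_on_range hs fun i => ?_
  have h1 : q i ≫ e.functor.map g = q i ≫ e.functor.map h := by
    have := congrArg (e.symm.toAdjunction.homEquiv P Z) (hgh i)
    rw [Adjunction.homEquiv_naturality_right, Adjunction.homEquiv_naturality_right,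
      Equiv.apply_symm_apply] at this
    exact this
  have h2 := congrArg (fun f : P ⟶ e.functor.obj Z => f.hom.hom (1 : Aᵐᵒᵖ)) h1
  have h3 : (q i).hom.hom (1 : Aᵐᵒᵖ) = s i := one_smul Aᵐᵒᵖ (s i)
  change (e.functor.map g).hom.hom ((q i).hom.hom (1 : Aᵐᵒᵖ)) =
    (e.functor.map h).hom.hom ((q i).hom.hom (1 : Aᵐᵒᵖ)) at h2
  rwa [h3] at h2

end IsFiniteAbelian

/-! ### Morita theory: a progenerator makes the category finite abelian. -/

namespace IsProgenerator

attribute [local instance] Abelian.hasFiniteBiproducts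

variable (k : Type v) [Field k] {C : Type u} [Category.{v} C] [Abelian C] [Linear k C] {P : C}

instance isScalarTower_end (M : C) : IsScalarTower k (End P)ᵐᵒᵖ (P ⟶ M) where
  smul_assoc r e f := Linear.smul_comp _ _ _ r e.unop f

variable [∀ X Y : C, Module.Finite k (X ⟶ Y)]

variable (P) in
/-- The functor `Hom(P, -)` with values in right modules over `End P`. -/
def homEnd : C ⥤ FGModuleCat.{v} (End P)ᵐᵒᵖ where
  obj M :=
    haveI : Module.Finite (End P)ᵐᵒᵖ (P ⟶ M) := Module.Finite.of_restrictScalars_finite k _ _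
    FGModuleCat.of (End P)ᵐᵒᵖ (P ⟶ M)
  map f := ⟨(preadditiveCoyonedaObj P).map f⟩
  map_id M := by
    apply FGModuleCat.hom_ext
    ext x
    exact Category.comp_id x
  map_comp f g := by
    apply FGModuleCat.hom_ext
    ext x
    exact (Category.assoc x f g).symm

instance : (homEnd k P).Additive where
  map_add {X Y f g} := by
    apply FGModuleCat.hom_ext
    ext x
    exact Preadditive.comp_add _ _ _ x f g

instance : (homEnd k P).Linear k where
  map_smul {X Y} f r := by
    apply FGModuleCat.hom_ext
    refine LinearMap.ext fun x : P ⟶ X => ?_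
    change x ≫ (r • f) = (r • 𝟙 P) ≫ x ≫ f
    simp

lemma homEnd_faithful (hP : IsProgenerator P) : (homEnd k P).Faithful where
  map_injective {X Y _ _} h := hP.hom_ext fun p =>
    congrArg (fun t : (homEnd k P).obj X ⟶ (homEnd k P).obj Y => t.hom.hom p) h

/-- A module map is an `End P`-linear assignment `p ↦ f p`, and `existsUnique_desc` for the identity
functor realises it by a morphism. -/
lemma homEnd_full (hP : IsProgenerator P) : (homEnd k P).Full where
  map_surjective {X Y} f := by
    let φ : (P ⟶ X) →+ ((𝟭 C).obj P ⟶ Y) :=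
      { toFun := fun p => f.hom.hom p
        map_zero' := f.hom.hom.map_zero
        map_add' := f.hom.hom.map_add }
    obtain ⟨g, hg, -⟩ := hP.existsUnique_desc (𝟭 C) X Y φ
      fun e p => f.hom.hom.map_smul (MulOpposite.op e) p
    refine ⟨g, FGModuleCat.hom_ext (LinearMap.ext fun p => hg p)⟩

/-- A finite presentation of `N` is a matrix over `End P`, which also defines a morphism `q` between
sums of copies of `P`. Since `P` is projective, `Hom(P, coker q)` has the same presentation as `N`.
-/
lemma homEnd_essSurj (hP : IsProgenerator P) : (homEnd k P).EssSurj where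
  mem_essImage N := by
    have := hP.projective
    have : Module.Finite k (End P)ᵐᵒᵖ :=
      have : Module.Finite k (End P) := inferInstanceAs (Module.Finite k (P ⟶ P))
      Module.Finite.equiv (MulOpposite.opLinearEquiv k)
    have : IsNoetherianRing (End P)ᵐᵒᵖ := isNoetherian_of_tower k inferInstance
    obtain ⟨n, s, hs⟩ := Module.Finite.exists_fin' (End P)ᵐᵒᵖ N
    obtain ⟨m, r, hr⟩ := Submodule.fg_iff_exists_fin_generating_family.1
      (IsNoetherian.noetherian (LinearMap.ker s))
    let q : (⨁ fun _ : Fin m => P) ⟶ ⨁ fun _ : Fin n => P :=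
      biproduct.desc fun j => biproduct.lift fun i => (r j i).unop
    let a : (Fin n → (End P)ᵐᵒᵖ) →ₗ[(End P)ᵐᵒᵖ] (P ⟶ cokernel q) :=
      { toFun := fun e => biproduct.lift (fun i => (e i).unop) ≫ cokernel.π q
        map_add' := fun e e' => by
          rw [← Preadditive.add_comp]
          congr 1
          apply biproduct.hom_ext
          intro j
          rw [Preadditive.add_comp]
          simp only [biproduct.lift_π]
          rfl
        map_smul' := fun c e => by
          refine Eq.trans ?_ (Category.assoc c.unop _ (cokernel.π q))
          congr 1
          apply biproduct.hom_ext
          intro j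
          rw [Category.assoc]
          simp only [biproduct.lift_π]
          rfl }
    have ha : Function.Surjective a := fun x => by
      refine ⟨fun i => MulOpposite.op (Projective.factorThru x (cokernel.π q) ≫
        biproduct.π (fun _ : Fin n => P) i), ?_⟩
      refine Eq.trans ?_ (Projective.factorThru_comp x (cokernel.π q))
      change biproduct.lift _ ≫ cokernel.π q = _
      congr 1
      apply biproduct.hom_ext
      intro j
      simp
    have hker : LinearMap.ker a = LinearMap.ker s := by
      rw [← hr]
      apply le_antisymm
      · intro e he
        have he' : biproduct.lift (fun i => (e i).unop) ≫ cokernel.π q = 0 := he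
        have hex : (ShortComplex.mk q (cokernel.π q) (by simp)).Exact :=
          ShortComplex.exact_cokernel q
        -- An `e` that dies in the cokernel lifts through `q`; the coordinates of the lift are the
        -- coefficients that express `e` by the relations `r j`.
        let l := hex.liftFromProjective (biproduct.lift (fun i => (e i).unop)) he'
        have hl : l ≫ q = biproduct.lift (fun i => (e i).unop) :=
          hex.liftFromProjective_comp _ he'
        have : e = ∑ j, MulOpposite.op (show End P from
            (l ≫ biproduct.π (fun _ : Fin m => P) j)) • r j := by
          funext i
          apply MulOpposite.unop_injective
          have h1 : (e i).unop = l ≫ q ≫ biproduct.π (fun _ : Fin n => P) i := by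
            rw [reassoc_of% hl]; simp
          rw [h1]
          have h2 : l = ∑ j, (l ≫ biproduct.π (fun _ : Fin m => P) j) ≫
              biproduct.ι (fun _ : Fin m => P) j := by
            simp only [Category.assoc, ← Preadditive.comp_sum, biproduct.total]
            simp
          conv_lhs => rw [h2]
          rw [Preadditive.sum_comp, Finset.sum_apply, Finset.unop_sum]
          refine Finset.sum_congr rfl fun j _ => ?_
          simp [q, End.mul_def]
        rw [this]
        exact Submodule.sum_mem _ fun j _ =>
          Submodule.smul_mem _ _ (Submodule.subset_span ⟨j, rfl⟩)
      · rw [Submodule.span_le]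
        rintro _ ⟨j, rfl⟩
        change biproduct.lift (fun i => (r j i).unop) ≫ cokernel.π q = 0
        have : biproduct.lift (fun i => (r j i).unop) =
            biproduct.ι (fun _ : Fin m => P) j ≫ q := by simp [q]
        rw [this, Category.assoc, cokernel.condition, comp_zero]
    have : Module.Finite (End P)ᵐᵒᵖ (P ⟶ cokernel q) :=
      Module.Finite.of_restrictScalars_finite k _ _
    let e : (P ⟶ cokernel q) ≃ₗ[(End P)ᵐᵒᵖ] N :=
      (a.quotKerEquivOfSurjective ha).symm.trans
        ((Submodule.quotEquivOfEq _ _ hker).trans (s.quotKerEquivOfSurjective hs))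
    exact ⟨cokernel q, ⟨e.toFGModuleCatIso⟩⟩

lemma isFiniteAbelian (hP : IsProgenerator P) : IsFiniteAbelian k C where
  exists_equiv := by
    have := homEnd_faithful k hP
    have := homEnd_full k hP
    have := homEnd_essSurj k hP
    have : (homEnd k P).IsEquivalence := { }
    refine ⟨End P, inferInstance, inferInstance, inferInstanceAs (Module.Finite k (P ⟶ P)),
      (homEnd k P).asEquivalence, ?_, ?_⟩
    · exact inferInstanceAs (homEnd k P).Additive
    · exact inferInstanceAs ((homEnd k P).Linear k)

end IsProgenerator

/-! ### Universal transformations and the left adjoint of the Cayley functor. -/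

section CayleyAdjoint

attribute [local instance] Abelian.hasFiniteBiproducts

/-- A natural transformation `F ⟶ (-) ⊗ a` that is universal among those of the form
`F ⟶ (-) ⊗ X`. -/
def IsUniversalTensorRight {C : Type u} [Category.{v} C] [MonoidalCategory C] {F : C ⥤ C} {a : C}
    (t : F ⟶ tensorRight a) : Prop :=
  ∀ (X : C) (θ : F ⟶ tensorRight X), ∃! f : a ⟶ X, t ≫ (tensoringRight C).map f = θ

variable (k : Type v) [Field k] {C : Type u} [Category.{v} C] [Preadditive C] [Linear k C]
  [MonoidalCategory C] [MonoidalPreadditive C] [MonoidalLinear k C] [IsFiniteTensorCategory k C]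

/-- A transformation `F ⟶ (-) ⊗ X` is a map `F P ⟶ P ⊗ X` compatible with `End P`; by duality it is
a map `Pᘁ ⊗ F P ⟶ X` that coequalizes the two actions of every endomorphism of `P`. The universal
target is the quotient of `Pᘁ ⊗ F P` by these relations. -/
lemma exists_isUniversalTensorRight (F : C ⥤ C) [F.Additive] [F.Linear k]
    [PreservesFiniteColimits F] :
    ∃ (a : C) (t : F ⟶ tensorRight a), IsUniversalTensorRight t := by
  obtain ⟨_⟩ := IsFiniteTensorCategory.rigid (k := k) (C := C)
  let _ := IsFiniteAbelian.abelian k C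
  obtain ⟨P, hP⟩ := IsFiniteAbelian.exists_progenerator k C
  have := IsFiniteAbelian.finite_hom k P P
  let T (X : C) := tensorLeftHomEquiv (F.obj P) P Pᘁ X
  have hT {X Y : C} (f : Pᘁ ⊗ F.obj P ⟶ X) (g : X ⟶ Y) : T Y (f ≫ g) = T X f ≫ P ◁ g :=
    tensorLeftHomEquiv_naturality f g
  have hT' {X : C} (f : F.obj P ⟶ F.obj P) (g : Pᘁ ⊗ F.obj P ⟶ X) :
      T X (Pᘁ ◁ f ≫ g) = f ≫ T X g := by
    rw [← Equiv.eq_symm_apply]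
    refine Eq.trans ?_ (tensorLeftHomEquiv_symm_naturality f (T X g)).symm
    exact congrArg _ ((T X).symm_apply_apply g).symm
  let Z := Pᘁ ⊗ F.obj P
  -- The difference of the two actions of `e` on `Pᘁ ⊗ F P`: through `F` on the right factor and
  -- through the dual on the left one.
  let δ : (P ⟶ P) →ₗ[k] (Z ⟶ Z) :=
    { toFun := fun e => Pᘁ ◁ F.map e - (T Z).symm (T Z (𝟙 Z) ≫ e ▷ Z)
      map_add' := fun e e' => by
        simp only [T, tensorLeftHomEquiv, F.map_add, MonoidalPreadditive.whiskerLeft_add,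
          MonoidalPreadditive.add_whiskerRight, Preadditive.comp_add, Preadditive.add_comp,
          Equiv.coe_fn_symm_mk]
        abel
      map_smul' := fun r e => by
        simp only [T, tensorLeftHomEquiv, F.map_smul, MonoidalLinear.whiskerLeft_smul,
          MonoidalLinear.smul_whiskerRight, Linear.comp_smul, Linear.smul_comp,
          Equiv.coe_fn_symm_mk, RingHom.id_apply, smul_sub] }
  have hδ {X : C} (f : Z ⟶ X) (e : P ⟶ P) :
      δ e ≫ f = 0 ↔ F.map e ≫ T X f = T X f ≫ e ▷ X := by
    have h1 : T X ((T Z).symm (T Z (𝟙 Z) ≫ e ▷ Z) ≫ f) = T X f ≫ e ▷ X := by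
      rw [hT, Equiv.apply_symm_apply, Category.assoc, ← whisker_exchange, ← Category.assoc, ← hT,
        Category.id_comp]
    rw [← h1, ← hT', (T X).injective.eq_iff]
    simp only [δ, LinearMap.coe_mk, AddHom.coe_mk, Preadditive.sub_comp, sub_eq_zero]
  -- As `δ` is `k`-linear, where linearity of `F` enters, the relations for a finite basis of `End
  -- P` imply all of them, and one cokernel suffices.
  let b := Module.finBasis k (P ⟶ P)
  let d : (⨁ fun _ : Fin (Module.finrank k (P ⟶ P)) => Z) ⟶ Z := biproduct.desc fun i => δ (b i)
  have hd {X : C} (f : Z ⟶ X) : d ≫ f = 0 ↔ ∀ e : P ⟶ P, F.map e ≫ T X f = T X f ≫ e ▷ X := by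
    simp only [← hδ]
    constructor
    · intro h e
      have h0 (i) : δ (b i) ≫ f = 0 := by
        have := biproduct.ι (fun _ : Fin (Module.finrank k (P ⟶ P)) => Z) i ≫= h
        simpa [d] using this
      have : Linear.rightComp k Z f ∘ₗ δ = 0 := b.ext fun i => h0 i
      exact LinearMap.congr_fun this e
    · intro h
      apply biproduct.hom_ext'
      intro i
      simp [d, h]
  let a := cokernel d
  obtain ⟨t, ht⟩ := hP.exists_natTrans (F := F) (G := tensorRight a) (T a (cokernel.π d))
    ((hd _).1 (cokernel.condition d))
  refine ⟨a, t, fun X θ => ?_⟩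
  have hθ : d ≫ (T X).symm (θ.app P) = 0 := by
    rw [hd]
    intro e
    rw [Equiv.apply_symm_apply]
    exact θ.naturality e
  have key (f : a ⟶ X) : t ≫ (tensoringRight C).map f = θ ↔
      cokernel.π d ≫ f = (T X).symm (θ.app P) := by
    rw [Equiv.eq_symm_apply, hT, ← ht]
    exact ⟨fun h => congrArg (fun s : F ⟶ tensorRight X => s.app P) h,
      fun h => hP.natTrans_ext (G := tensorRight X) h⟩
  refine ⟨cokernel.desc d _ hθ, (key _).2 (cokernel.π_desc _ _ _), fun f hf => ?_⟩
  rw [← cancel_epi (cokernel.π d), (key f).1 hf, cokernel.π_desc]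

/-- The Cayley functor has a left adjoint. -/
lemma exists_cayley_leftAdjoint : Nonempty (Σ L : Rex k C ⥤ C, L ⊣ cayley k C) := by
  have h (F : Rex k C) : HasInitial (StructuredArrow F (cayley k C)) := by
    obtain ⟨_, _⟩ := F.property.1
    have := F.property.2
    obtain ⟨a, t, ht⟩ := exists_isUniversalTensorRight k F.obj
    refine IsInitial.hasInitial (X := StructuredArrow.mk (Y := a) (T := cayley k C) ⟨t⟩)
      (IsInitial.ofUniqueHom
        (fun Z => StructuredArrow.homMk (ht Z.right Z.hom.hom).choose
          (InducedCategory.hom_ext (ht Z.right Z.hom.hom).choose_spec.1)) ?_)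
    intro Z m
    apply StructuredArrow.hom_ext
    exact (ht Z.right Z.hom.hom).choose_spec.2 _
      (congrArg InducedCategory.Hom.hom (StructuredArrow.w m))
  exact ⟨⟨_, adjunctionOfStructuredArrowInitials (cayley k C)⟩⟩

variable {k}

/-- The unit of the adjunction at `J` is a universal arrow. Universal arrows are unique up to
isomorphism, so the choice of the left adjoint does not matter. -/
lemma isModularObject_iff (a : C) : IsModularObject k a ↔
    ∃ t : trivialBimoduleFunctor k (C := C) ⟶ tensorRight a, IsUniversalTensorRight t := by
  constructor
  · rintro ⟨L, ⟨adj⟩, ⟨i⟩⟩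
    let s : rexJ k C ⟶ (cayley k C).obj a := adj.unit.app (rexJ k C) ≫ (cayley k C).map i.inv
    refine ⟨s.hom, fun X θ => ?_⟩
    have key (f : a ⟶ X) : s.hom ≫ (tensoringRight C).map f = θ ↔
        i.inv ≫ f = (adj.homEquiv _ _).symm (⟨θ⟩ : rexJ k C ⟶ (cayley k C).obj X) := by
      rw [Equiv.eq_symm_apply, Adjunction.homEquiv_unit, Functor.map_comp, ← Category.assoc]
      exact ⟨fun h => InducedCategory.hom_ext h, fun h => congrArg InducedCategory.Hom.hom h⟩
    refine ⟨i.hom ≫ (adj.homEquiv _ _).symm (⟨θ⟩ : rexJ k C ⟶ (cayley k C).obj X),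
      (key _).2 (by simp), fun f hf => ?_⟩
    rw [← (key f).1 hf, Iso.hom_inv_id_assoc]
  · rintro ⟨t, ht⟩
    obtain ⟨⟨L, adj⟩⟩ := exists_cayley_leftAdjoint k (C := C)
    refine ⟨L, ⟨adj⟩, ?_⟩
    let s : rexJ k C ⟶ (cayley k C).obj (L.obj (rexJ k C)) := adj.unit.app (rexJ k C)
    obtain ⟨f, hf, -⟩ := ht _ s.hom
    let t' : rexJ k C ⟶ (cayley k C).obj a := ⟨t⟩
    have hf' : t' ≫ (cayley k C).map f = s := InducedCategory.hom_ext hf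
    let g := (adj.homEquiv _ _).symm t'
    have hg : s ≫ (cayley k C).map g = t' := by
      rw [← Adjunction.homEquiv_unit, Equiv.apply_symm_apply]
    refine ⟨⟨f, g, ?_, ?_⟩⟩
    · refine (ht _ t).unique ?_ ?_
      · refine congrArg InducedCategory.Hom.hom (?_ : t' ≫ (cayley k C).map (f ≫ g) = t')
        rw [Functor.map_comp, reassoc_of% hf', hg]
      · simp
    · apply (adj.homEquiv _ _).injective
      rw [Adjunction.homEquiv_unit, Adjunction.homEquiv_unit]
      change s ≫ _ = s ≫ _
      rw [Functor.map_comp, reassoc_of% hg, hf', CategoryTheory.Functor.map_id, Category.comp_id]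

end CayleyAdjoint

/-! ### Kernels, cokernels and the abelian structure on modules. -/

namespace RightMod

open scoped MonObj ComonObj ZeroObject

section Exact

variable {B : Type u} [Category.{v} B] [MonoidalCategory B] {H : B} [MonObj H]

/-- Restrict the action along a monomorphism. -/
def ofMono (M : RightMod H) {X : B} (i : X ⟶ M.X) [Mono i] (a : X ⊗ H ⟶ X)
    (h : a ≫ i = i ▷ H ≫ M.act) : RightMod H where
  X := X
  act := a
  act_one := by
    rw [← cancel_mono i, Category.assoc, h, whisker_exchange_assoc, M.act_one,
      rightUnitor_naturality]
  act_mul := by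
    rw [← cancel_mono i]
    simp only [Category.assoc, h]
    rw [whisker_exchange_assoc, M.act_mul, associator_inv_naturality_left_assoc,
      ← comp_whiskerRight_assoc a, h, comp_whiskerRight_assoc]

/-- Transport the action along a morphism that remains an epimorphism after tensoring. -/
def ofEpi (M : RightMod H) {X : B} (p : M.X ⟶ X) [∀ Y, Epi (p ▷ Y)] (a : X ⊗ H ⟶ X)
    (h : p ▷ H ≫ a = M.act ≫ p) : RightMod H where
  X := X
  act := a
  act_one := by
    rw [← cancel_epi (p ▷ _), ← whisker_exchange_assoc, h, ← Category.assoc, M.act_one,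
      rightUnitor_naturality]
  act_mul := by
    rw [← cancel_epi (p ▷ _), ← whisker_exchange_assoc, h, ← Category.assoc, M.act_mul,
      associator_inv_naturality_left_assoc, ← comp_whiskerRight_assoc, h]
    simp [h]

/-- A factorization through a monomorphism of modules is a morphism of modules. -/
def homOfMono {M N W : RightMod H} (f : M ⟶ N) [Mono f.hom] (g : W ⟶ N) (l : W.X ⟶ M.X)
    (h : l ≫ f.hom = g.hom) : W ⟶ M where
  hom := l
  comm := by
    rw [← cancel_mono f.hom, Category.assoc, Category.assoc, f.comm, h,
      ← comp_whiskerRight_assoc, h, g.comm]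

/-- A factorization through an epimorphism of modules is a morphism of modules. -/
def homOfEpi {M N W : RightMod H} (f : M ⟶ N) [Epi (f.hom ▷ H)] (g : M ⟶ W) (l : N.X ⟶ W.X)
    (h : f.hom ≫ l = g.hom) : N ⟶ W where
  hom := l
  comm := by
    rw [← cancel_epi (f.hom ▷ H), ← comp_whiskerRight_assoc, h, ← Category.assoc, ← f.comm,
      Category.assoc, h, g.comm]

end Exact

section Abelian

variable {B : Type u} [Category.{v} B] [Abelian B] [MonoidalCategory B] [MonoidalPreadditive B]
  {H : B} [MonObj H]

attribute [local instance] Abelian.hasFiniteBiproducts Abelian.hasZeroObject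

section Kernel

variable {M N : RightMod H} (f : M ⟶ N)

/-- The kernel of a morphism of modules. -/
noncomputable def ker : RightMod H :=
  M.ofMono (kernel.ι f.hom) (kernel.lift f.hom (kernel.ι f.hom ▷ H ≫ M.act) (by
    rw [Category.assoc, f.comm, ← comp_whiskerRight_assoc, kernel.condition]
    simp)) (by simp)

/-- The inclusion of the kernel. -/
noncomputable def kerι : ker f ⟶ M := ⟨kernel.ι f.hom, by simp [ker, ofMono]⟩

lemma kerι_comp : kerι f ≫ f = 0 := hom_ext (kernel.condition f.hom)

instance : Mono (kerι f).hom := inferInstanceAs (Mono (kernel.ι f.hom))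

/-- The inclusion of the kernel is a kernel. -/
noncomputable def kerIsLimit : IsLimit (KernelFork.ofι (kerι f) (kerι_comp f)) :=
  KernelFork.IsLimit.ofι _ _
    (fun {W} g w => homOfMono (kerι f) g (kernel.lift f.hom g.hom (congrArg Hom.hom w))
      (kernel.lift_ι ..))
    (fun g w => hom_ext (kernel.lift_ι ..))
    (fun g w m hm => hom_ext (by
      rw [← cancel_mono (kerι f).hom]
      exact (congrArg Hom.hom hm).trans (kernel.lift_ι ..).symm))

instance : HasKernels (RightMod H) where
  has_limit f := ⟨⟨⟨_, kerIsLimit f⟩⟩⟩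

/-- The kernel of modules lies over the kernel in `B`, so one vanishes if the other does. `epi_hom`
is the dual argument with cokernels. -/
instance mono_hom [Mono f] : Mono f.hom := by
  have h : kerι f = 0 := zero_of_comp_mono f (kerι_comp f)
  exact Preadditive.mono_of_kernel_zero (congrArg Hom.hom h)

end Kernel

instance : HasTerminal (RightMod H) :=
  IsTerminal.hasTerminal (X := ⟨(0 : B), 0, (isZero_zero B).eq_of_tgt _ _,
    (isZero_zero B).eq_of_tgt _ _⟩)
    (IsTerminal.ofUniqueHom (fun _ => 0) fun _ _ => hom_ext ((isZero_zero B).eq_of_tgt _ _))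

instance : HasBinaryProducts (RightMod H) := by
  have (M N : RightMod H) : HasLimit (pair M N) := by
    let Q : RightMod H :=
      { X := M.X ⊞ N.X
        act := biprod.lift (biprod.fst ▷ H ≫ M.act) (biprod.snd ▷ H ≫ N.act)
        act_one := by
          apply biprod.hom_ext
          · simp [whisker_exchange_assoc, M.act_one]
          · simp [whisker_exchange_assoc, N.act_one]
        act_mul := by
          apply biprod.hom_ext
          · simp only [Category.assoc, biprod.lift_fst]
            rw [whisker_exchange_assoc, M.act_mul, associator_inv_naturality_left_assoc,
              ← comp_whiskerRight_assoc (biprod.lift _ _), biprod.lift_fst, comp_whiskerRight_assoc]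
          · simp only [Category.assoc, biprod.lift_snd]
            rw [whisker_exchange_assoc, N.act_mul, associator_inv_naturality_left_assoc,
              ← comp_whiskerRight_assoc (biprod.lift _ _), biprod.lift_snd,
              comp_whiskerRight_assoc] }
    let p : Q ⟶ M := ⟨biprod.fst, by simp [Q]⟩
    let q : Q ⟶ N := ⟨biprod.snd, by simp [Q]⟩
    refine ⟨⟨⟨BinaryFan.mk p q, BinaryFan.isLimitMk
      (fun s => ⟨biprod.lift s.fst.hom s.snd.hom, ?_⟩) ?_ ?_ ?_⟩⟩⟩
    · apply biprod.hom_ext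
      · simpa [Q, ← comp_whiskerRight_assoc] using s.fst.comm
      · simpa [Q, ← comp_whiskerRight_assoc] using s.snd.comm
    · intro s; exact hom_ext (biprod.lift_fst ..)
    · intro s; exact hom_ext (biprod.lift_snd ..)
    · intro s m h1 h2
      apply hom_ext
      apply biprod.hom_ext
      · exact (congrArg Hom.hom h1).trans (biprod.lift_fst ..).symm
      · exact (congrArg Hom.hom h2).trans (biprod.lift_snd ..).symm
  exact hasBinaryProducts_of_hasLimit_pair _

instance : HasFiniteProducts (RightMod H) := hasFiniteProducts_of_has_binary_and_terminal

section Cokernel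

variable [∀ Y : B, PreservesFiniteColimits (tensorRight Y)]

instance epi_whiskerRight {X Y : B} (p : X ⟶ Y) [Epi p] (Z : B) : Epi (p ▷ Z) :=
  inferInstanceAs (Epi ((tensorRight Z).map p))

/-- Tensoring preserves cokernels. -/
lemma exists_desc_whiskerRight {X Y : B} (f : X ⟶ Y) (Z : B) {W : B} (g : Y ⊗ Z ⟶ W)
    (w : f ▷ Z ≫ g = 0) : ∃ l : cokernel f ⊗ Z ⟶ W, cokernel.π f ▷ Z ≫ l = g := by
  obtain ⟨l, hl⟩ := CokernelCofork.IsColimit.desc'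
    (CokernelCofork.mapIsColimit _ (cokernelIsCokernel f) (tensorRight Z)) g w
  exact ⟨l, hl⟩

variable {M N : RightMod H} (f : M ⟶ N)

/-- Right exactness of `tensorRight H` makes `cokernel f.hom ⊗ H` the cokernel of `f.hom ▷ H`, so
the action of `N` descends. -/
lemma exists_cokerAct : ∃ a : cokernel f.hom ⊗ H ⟶ cokernel f.hom,
    cokernel.π f.hom ▷ H ≫ a = N.act ≫ cokernel.π f.hom :=
  exists_desc_whiskerRight f.hom H _ (by
    rw [← Category.assoc, ← f.comm, Category.assoc, cokernel.condition, comp_zero])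

/-- The cokernel of a morphism of modules. -/
noncomputable def coker : RightMod H :=
  N.ofEpi (cokernel.π f.hom) (exists_cokerAct f).choose (exists_cokerAct f).choose_spec

/-- The projection to the cokernel. -/
noncomputable def cokerπ : N ⟶ coker f := ⟨cokernel.π f.hom, (exists_cokerAct f).choose_spec.symm⟩

lemma comp_cokerπ : f ≫ cokerπ f = 0 := hom_ext (cokernel.condition f.hom)

instance : Epi (cokerπ f).hom := inferInstanceAs (Epi (cokernel.π f.hom))

/-- The projection to the cokernel is a cokernel. -/
noncomputable def cokerIsColimit : IsColimit (CokernelCofork.ofπ (cokerπ f) (comp_cokerπ f)) :=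
  CokernelCofork.IsColimit.ofπ _ _
    (fun {W} g w => homOfEpi (cokerπ f) g (cokernel.desc f.hom g.hom (congrArg Hom.hom w))
      (cokernel.π_desc ..))
    (fun g w => hom_ext (cokernel.π_desc ..))
    (fun g w m hm => hom_ext (by
      rw [← cancel_epi (cokerπ f).hom]
      exact (congrArg Hom.hom hm).trans (cokernel.π_desc ..).symm))

instance : HasCokernels (RightMod H) where
  has_colimit f := ⟨⟨⟨_, cokerIsColimit f⟩⟩⟩

instance epi_hom [Epi f] : Epi f.hom := by
  have h : cokerπ f = 0 := zero_of_epi_comp f (comp_cokerπ f)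
  exact Preadditive.epi_of_cokernel_zero (congrArg Hom.hom h)

instance : IsNormalMonoCategory (RightMod H) where
  normalMonoOfMono {M N} f _ := ⟨
    { Z := coker f
      g := cokerπ f
      w := comp_cokerπ f
      isLimit := KernelFork.IsLimit.ofι _ _
        (fun {W} g w => homOfMono f g (Abelian.monoLift f.hom g.hom (congrArg Hom.hom w))
          (Abelian.monoLift_comp ..))
        (fun g w => hom_ext (Abelian.monoLift_comp ..))
        (fun g w m hm => hom_ext (by
          rw [← cancel_mono f.hom]
          exact (congrArg Hom.hom hm).trans (Abelian.monoLift_comp ..).symm)) }⟩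

instance : IsNormalEpiCategory (RightMod H) where
  normalEpiOfEpi {M N} f _ := ⟨
    { W := ker f
      g := kerι f
      w := kerι_comp f
      isColimit := CokernelCofork.IsColimit.ofπ _ _
        (fun {W} g w => homOfEpi f g (Abelian.epiDesc f.hom g.hom (congrArg Hom.hom w))
          (Abelian.comp_epiDesc ..))
        (fun g w => hom_ext (Abelian.comp_epiDesc ..))
        (fun g w m hm => hom_ext (by
          rw [← cancel_epi f.hom]
          exact (congrArg Hom.hom hm).trans (Abelian.comp_epiDesc ..).symm)) }⟩

variable (H) in
/-- The category of modules is abelian. -/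
@[reducible]
noncomputable def abelian : Abelian (RightMod H) := { }

end Cokernel

end Abelian

end RightMod

/-! ### Free modules and finiteness of the category of modules. -/

namespace RightMod

open scoped MonObj ComonObj

section Free

variable {B : Type u} [Category.{v} B] [MonoidalCategory B]

/-- The free right `H`-module on an object. -/
@[reducible]
def free (H : B) [MonObj H] (V : B) : RightMod H where
  X := V ⊗ H
  act := (α_ V H H).hom ≫ V ◁ μ[H]
  act_one := by
    rw [associator_naturality_right_assoc, ← whiskerLeft_comp, MonObj.mul_one]
    simp
  act_mul := by
    have h := MonObj.mul_assoc H
    simp only [comp_whiskerRight, Category.assoc]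
    rw [associator_naturality_right_assoc, ← whiskerLeft_comp, associator_naturality_middle_assoc,
      ← whiskerLeft_comp, h]
    simp

variable {H : B} [MonObj H]

/-- The morphism of modules out of a free module given by a morphism in the base. -/
@[simps]
def freeDesc {V : B} {N : RightMod H} (f : V ⟶ N.X) : free H V ⟶ N where
  hom := f ▷ H ≫ N.act
  comm := by
    simp only [comp_whiskerRight, Category.assoc]
    rw [whisker_exchange_assoc, N.act_mul, associator_inv_naturality_left_assoc,
      Iso.hom_inv_id_assoc]

variable (H) in
/-- The unit of the free module adjunction. -/
def freeUnit (V : B) : V ⟶ V ⊗ H := (ρ_ V).inv ≫ V ◁ η[H]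

lemma freeUnit_comp_freeDesc {V : B} {N : RightMod H} (f : V ⟶ N.X) :
    freeUnit H V ≫ (freeDesc f).hom = f := by
  simp only [freeUnit, freeDesc_hom, Category.assoc]
  rw [whisker_exchange_assoc, N.act_one, rightUnitor_naturality, Iso.inv_hom_id_assoc]

lemma freeDesc_freeUnit_comp {V : B} {N : RightMod H} (g : free H V ⟶ N) :
    freeDesc (freeUnit H V ≫ g.hom) = g := by
  apply hom_ext
  have h1 : ((ρ_ V).inv ≫ V ◁ η[H]) ▷ H ≫ (α_ V H H).hom ≫ V ◁ μ[H] = 𝟙 (V ⊗ H) := by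
    simp only [comp_whiskerRight, Category.assoc]
    rw [associator_naturality_middle_assoc, ← whiskerLeft_comp, MonObj.one_mul]
    simp
  have h2 : (freeUnit H V ≫ g.hom) ▷ H ≫ N.act =
      (freeUnit H V) ▷ H ≫ (free H V).act ≫ g.hom := by
    rw [comp_whiskerRight, Category.assoc, g.comm]
  refine h2.trans ?_
  rw [← Category.assoc]
  exact (congrArg (· ≫ g.hom) h1).trans (Category.id_comp _)

/-- The universal property of free modules. -/
def freeEquiv (V : B) (N : RightMod H) : (free H V ⟶ N) ≃ (V ⟶ N.X) where
  toFun g := freeUnit H V ≫ g.hom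
  invFun f := freeDesc f
  left_inv := freeDesc_freeUnit_comp
  right_inv := freeUnit_comp_freeDesc

variable (H) in
/-- The free module functor. -/
def freeFunctor : B ⥤ RightMod H where
  obj := free H
  map {V W} f := ⟨f ▷ H, by
    simp only [Category.assoc]
    rw [whisker_exchange, associator_naturality_left_assoc]⟩

variable (H) in
/-- The free module functor is left adjoint to the forgetful functor. -/
def freeAdj : freeFunctor H ⊣ forget H :=
  Adjunction.mkOfHomEquiv
    { homEquiv := freeEquiv
      homEquiv_naturality_left_symm := fun _ _ => hom_ext (comp_whiskerRight_assoc ..)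
      homEquiv_naturality_right := fun _ _ => (Category.assoc ..).symm }

end Free

section Finite

variable {B : Type u} [Category.{v} B] [Abelian B] [MonoidalCategory B] [MonoidalPreadditive B]
  {H : B} [MonObj H] [∀ Y : B, PreservesFiniteColimits (tensorRight Y)]

/-- Epimorphisms of modules are epimorphisms in `B`, so the forgetful functor preserves them and its
left adjoint preserves projectives. A generating family for `M.X` induces one for `M`. -/
lemma isProgenerator_free {P : B} (hP : IsProgenerator P) : IsProgenerator (free H P) where
  projective := by
    have := hP.projective
    have : (forget H).PreservesEpimorphisms :=
      ⟨fun f _ => inferInstanceAs (Epi f.hom)⟩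
    exact (freeAdj H).map_projective P inferInstance
  exists_family M := by
    obtain ⟨n, p, hp⟩ := hP.exists_family M.X
    refine ⟨n, fun i => freeDesc (p i), fun Z g h e => hom_ext (hp _ _ fun i => ?_)⟩
    have := congrArg (fun t => freeUnit H P ≫ Hom.hom t) (e i)
    simpa only [comp_hom, ← Category.assoc, freeUnit_comp_freeDesc] using this

end Finite

lemma isFiniteAbelian {k : Type v} [Field k] {B : Type u} [Category.{v} B] [Preadditive B]
    [Linear k B] [MonoidalCategory B] [MonoidalPreadditive B] [MonoidalLinear k B]
    [IsFiniteTensorCategory k B] (H : B) [MonObj H] : IsFiniteAbelian k (RightMod H) := by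
  let _ := IsFiniteAbelian.abelian k B
  have h (Y : B) : PreservesFiniteColimits (tensorRight Y) := (rexProp_tensorRight k Y).2
  obtain ⟨P, hP⟩ := IsFiniteAbelian.exists_progenerator k B
  let _ := RightMod.abelian H
  have (M N : RightMod H) : Module.Finite k (M ⟶ N) := by
    have := IsFiniteAbelian.finite_hom k M.X N.X
    let φ : (M ⟶ N) →ₗ[k] (M.X ⟶ N.X) :=
      { toFun := Hom.hom, map_add' := fun _ _ => rfl, map_smul' := fun _ _ => rfl }
    exact Module.Finite.of_injective φ (hom_injective M N)
  exact IsProgenerator.isFiniteAbelian k (isProgenerator_free (H := H) hP)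

end RightMod

/-! ### Duals of modules. -/

section DualAction

open ExactPairing

variable {B : Type u} [Category.{v} B] [MonoidalCategory B]

section Pairing

variable (D N : B) [ExactPairing D N]

/-- The bijection between morphisms `X ⟶ D` and pairings `N ⊗ X ⟶ 𝟙_`. -/
@[simps]
def pairingEquiv (X : B) : (X ⟶ D) ≃ (N ⊗ X ⟶ 𝟙_ B) where
  toFun f := N ◁ f ≫ ε_ D N
  invFun g := 𝟙 _ ⊗≫ η_ D N ▷ X ⊗≫ D ◁ g ⊗≫ 𝟙 _
  left_inv f := by
    calc 𝟙 _ ⊗≫ η_ D N ▷ X ⊗≫ D ◁ (N ◁ f ≫ ε_ D N) ⊗≫ 𝟙 _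
      _ = 𝟙 _ ⊗≫ (η_ D N ▷ X ≫ (D ⊗ N) ◁ f) ⊗≫ D ◁ ε_ D N ⊗≫ 𝟙 _ := by monoidal
      _ = 𝟙 _ ⊗≫ 𝟙_ B ◁ f ⊗≫ (η_ D N ▷ D ⊗≫ D ◁ ε_ D N) ⊗≫ 𝟙 _ := by
        rw [← whisker_exchange]; monoidal
      _ = f := by rw [evaluation_coevaluation'']; monoidal
  right_inv g := by
    calc N ◁ (𝟙 _ ⊗≫ η_ D N ▷ X ⊗≫ D ◁ g ⊗≫ 𝟙 _) ≫ ε_ D N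
      _ = 𝟙 _ ⊗≫ N ◁ η_ D N ▷ X ⊗≫ ((N ⊗ D) ◁ g ≫ ε_ D N ▷ 𝟙_ B) ⊗≫ 𝟙 _ := by monoidal
      _ = 𝟙 _ ⊗≫ (N ◁ η_ D N ⊗≫ ε_ D N ▷ N) ▷ X ⊗≫ 𝟙_ B ◁ g ⊗≫ 𝟙 _ := by
        rw [whisker_exchange]; monoidal
      _ = g := by rw [coevaluation_evaluation'']; monoidal

/-- The bijection between morphisms `X ⟶ N` and pairings `X ⊗ D ⟶ 𝟙_`. -/
@[simps]
def pairingEquivRight (X : B) : (X ⟶ N) ≃ (X ⊗ D ⟶ 𝟙_ B) where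
  toFun f := f ▷ D ≫ ε_ D N
  invFun g := 𝟙 _ ⊗≫ X ◁ η_ D N ⊗≫ g ▷ N ⊗≫ 𝟙 _
  left_inv f := by
    calc 𝟙 _ ⊗≫ X ◁ η_ D N ⊗≫ (f ▷ D ≫ ε_ D N) ▷ N ⊗≫ 𝟙 _
      _ = 𝟙 _ ⊗≫ (X ◁ η_ D N ≫ f ▷ (D ⊗ N)) ⊗≫ ε_ D N ▷ N ⊗≫ 𝟙 _ := by monoidal
      _ = 𝟙 _ ⊗≫ f ▷ 𝟙_ B ⊗≫ (N ◁ η_ D N ⊗≫ ε_ D N ▷ N) ⊗≫ 𝟙 _ := by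
        rw [whisker_exchange]; monoidal
      _ = f := by rw [coevaluation_evaluation'']; monoidal
  right_inv g := by
    calc (𝟙 _ ⊗≫ X ◁ η_ D N ⊗≫ g ▷ N ⊗≫ 𝟙 _) ▷ D ≫ ε_ D N
      _ = 𝟙 _ ⊗≫ X ◁ η_ D N ▷ D ⊗≫ (g ▷ (N ⊗ D) ≫ 𝟙_ B ◁ ε_ D N) ⊗≫ 𝟙 _ := by monoidal
      _ = 𝟙 _ ⊗≫ X ◁ (η_ D N ▷ D ⊗≫ D ◁ ε_ D N) ⊗≫ g ▷ 𝟙_ B ⊗≫ 𝟙 _ := by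
        rw [← whisker_exchange]; monoidal
      _ = g := by rw [evaluation_coevaluation'']; monoidal

end Pairing

variable [BraidedCategory B] (D N : B) [ExactPairing D N]

/-- The transposition of right actions on an object to right actions on a left dual, by means of
the braiding. -/
def transposeAct {K : B} : (N ⊗ K ⟶ N) ≃ (D ⊗ K ⟶ D) :=
  (pairingEquivRight D N (N ⊗ K)).trans
    ((((whiskerLeftIso N (β_ D K)) ≪≫ (α_ N K D).symm).symm.homCongr (Iso.refl _)).trans
      (pairingEquiv D N _).symm)

variable {N}

lemma transposeAct_eval {K : B} (b : N ⊗ K ⟶ N) : N ◁ transposeAct D N b ≫ ε_ D N =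
    N ◁ (β_ D K).hom ≫ (α_ N K D).inv ≫ b ▷ D ≫ ε_ D N :=
  ((pairingEquiv D N _).apply_symm_apply _).trans (by simp)

lemma transposeAct_precomp {K K' : B} (f : K' ⟶ K) (b : N ⊗ K ⟶ N) :
    transposeAct D N (N ◁ f ≫ b) = D ◁ f ≫ transposeAct D N b := by
  apply (pairingEquiv D N _).injective
  simp only [pairingEquiv_apply, whiskerLeft_comp, Category.assoc]
  rw [transposeAct_eval, transposeAct_eval, ← whiskerLeft_comp_assoc N (D ◁ f),
    BraidedCategory.braiding_naturality_right]
  simp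

lemma transposeAct_rightUnitor : transposeAct D N (ρ_ N).hom = (ρ_ D).hom := by
  apply (pairingEquiv D N _).injective
  simp only [pairingEquiv_apply]
  rw [transposeAct_eval]
  simp

/-- Passing to the dual reverses the order of operators, and in a braided category the reversal
leaves a braiding of `K` with `K'`. -/
lemma transposeAct_comp {K K' : B} (b : N ⊗ K ⟶ N) (b' : N ⊗ K' ⟶ N) :
    (α_ D K K').inv ≫ transposeAct D N b ▷ K' ≫ transposeAct D N b' =
      transposeAct D N (N ◁ (β_ K K').hom ≫ (α_ N K' K).inv ≫ b' ▷ K ≫ b) := by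
  apply (pairingEquiv D N _).injective
  simp only [pairingEquiv_apply]
  rw [transposeAct_eval]
  calc N ◁ ((α_ D K K').inv ≫ transposeAct D N b ▷ K' ≫ transposeAct D N b') ≫ ε_ D N
    _ = N ◁ (α_ D K K').inv ≫ N ◁ (transposeAct D N b ▷ K') ≫
        (N ◁ transposeAct D N b' ≫ ε_ D N) := by simp
    _ = N ◁ (α_ D K K').inv ≫ N ◁ (transposeAct D N b ▷ K' ≫ (β_ D K').hom) ≫
        (α_ N K' D).inv ≫ b' ▷ D ≫ ε_ D N := by rw [transposeAct_eval]; monoidal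
    _ = N ◁ ((α_ D K K').inv ≫ (β_ (D ⊗ K) K').hom) ⊗≫
        ((N ⊗ K') ◁ transposeAct D N b ≫ b' ▷ D) ≫ ε_ D N := by
      rw [BraidedCategory.braiding_naturality_left]; monoidal
    _ = N ◁ ((α_ D K K').inv ≫ (β_ (D ⊗ K) K').hom) ⊗≫
        b' ▷ (D ⊗ K) ≫ (N ◁ transposeAct D N b ≫ ε_ D N) := by
      rw [whisker_exchange]; monoidal
    _ = N ◁ ((α_ D K K').inv ≫ (β_ (D ⊗ K) K').hom) ⊗≫
        (b' ▷ (D ⊗ K) ≫ N ◁ (β_ D K).hom) ⊗≫ b ▷ D ≫ ε_ D N := by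
      rw [transposeAct_eval]; monoidal
    _ = N ◁ (D ◁ (β_ K K').hom ≫ (β_ D (K' ⊗ K)).hom) ⊗≫ b' ▷ K ▷ D ≫ b ▷ D ≫ ε_ D N := by
      rw [← whisker_exchange, BraidedCategory.braiding_tensor_left_hom,
        BraidedCategory.braiding_tensor_right_hom]
      monoidal
    _ = _ := by
      rw [BraidedCategory.braiding_naturality_right]; monoidal

end DualAction

namespace RightMod

open ExactPairing
open scoped MonObj ComonObj HopfObj

variable {B : Type u} [Category.{v} B] [MonoidalCategory B] [BraidedCategory B] {H : B} [HopfObj H]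

section Antipode

variable (N : RightMod H)

lemma act_act_antipode :
    N.X ◁ Δ[H] ≫ (α_ N.X H H).inv ≫ N.act ▷ H ≫ N.X ◁ 𝒮[H] ≫ N.act =
      N.X ◁ ε[H] ≫ (ρ_ N.X).hom := by
  rw [← whisker_exchange_assoc, ← associator_inv_naturality_right_assoc, ← N.act_mul,
    ← whiskerLeft_comp_assoc, ← whiskerLeft_comp_assoc]
  simp only [Category.assoc]
  rw [HopfObj.antipode_right, whiskerLeft_comp_assoc, N.act_one]

lemma act_antipode_act :
    N.X ◁ Δ[H] ≫ (α_ N.X H H).inv ≫ (N.X ◁ 𝒮[H] ≫ N.act) ▷ H ≫ N.act =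
      N.X ◁ ε[H] ≫ (ρ_ N.X).hom := by
  rw [comp_whiskerRight_assoc, ← associator_inv_naturality_middle_assoc, ← N.act_mul,
    ← whiskerLeft_comp_assoc, ← whiskerLeft_comp_assoc]
  simp only [Category.assoc]
  rw [HopfObj.antipode_left, whiskerLeft_comp_assoc, N.act_one]

end Antipode

section Transpose

variable (D : B) {N : B} [ExactPairing D N] (a : N ⊗ H ⟶ N)

lemma one_transposeAct : D ◁ η[H] ≫ transposeAct D N (N ◁ 𝒮[H] ≫ a) =
    transposeAct D N (N ◁ η[H] ≫ a) := by
  rw [← transposeAct_precomp, ← whiskerLeft_comp_assoc, HopfObj.one_antipode]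

lemma mul_transposeAct : D ◁ μ[H] ≫ transposeAct D N (N ◁ 𝒮[H] ≫ a) =
    transposeAct D N (N ◁ ((𝒮[H] ⊗ₘ 𝒮[H]) ≫ (β_ H H).hom) ≫ N ◁ μ[H] ≫ a) := by
  rw [← transposeAct_precomp, ← whiskerLeft_comp_assoc, ← whiskerLeft_comp_assoc,
    HopfObj.mul_antipode, Category.assoc]

/-- The antipode reverses multiplication up to the same braiding that `transposeAct_comp` creates.
With `mul_transposeAct`, associativity of the dual action becomes associativity of `a` under one
transposition. -/
lemma transposeAct_transposeAct :
    (α_ D H H).inv ≫ transposeAct D N (N ◁ 𝒮[H] ≫ a) ▷ H ≫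
      transposeAct D N (N ◁ 𝒮[H] ≫ a) =
    transposeAct D N (N ◁ ((𝒮[H] ⊗ₘ 𝒮[H]) ≫ (β_ H H).hom) ≫ (α_ N H H).inv ≫ a ▷ H ≫ a) := by
  rw [transposeAct_comp, BraidedCategory.braiding_naturality, whiskerLeft_comp_assoc,
    MonoidalCategory.tensorHom_def']
  congr 2
  calc (α_ N H H).inv ≫ (N ◁ 𝒮[H] ≫ a) ▷ H ≫ N ◁ 𝒮[H] ≫ a
    _ = 𝟙 _ ⊗≫ N ◁ 𝒮[H] ▷ H ⊗≫ (a ▷ H ≫ N ◁ 𝒮[H]) ≫ a := by monoidal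
    _ = 𝟙 _ ⊗≫ N ◁ (𝒮[H] ▷ H ≫ H ◁ 𝒮[H]) ⊗≫ a ▷ H ≫ a := by
      rw [← whisker_exchange]; monoidal
    _ = _ := by rw [← whisker_exchange]; monoidal

end Transpose

/-- The left dual of a module, with the action given by the antipode. -/
@[reducible]
def dual (N : RightMod H) (D : B) [ExactPairing D N.X] : RightMod H where
  X := D
  act := transposeAct D N.X (N.X ◁ 𝒮[H] ≫ N.act)
  act_one := by
    rw [one_transposeAct, N.act_one, transposeAct_rightUnitor]
  act_mul := by
    rw [mul_transposeAct, N.act_mul, transposeAct_transposeAct]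

/-- If the antipode is invertible, then every module is a left dual. -/
lemma exists_dual_eq [IsIso 𝒮[H]] (M : RightMod H) (N : B) [ExactPairing M.X N] :
    ∃ (Q : RightMod H) (_ : ExactPairing M.X Q.X), M = dual Q M.X := by
  -- The only candidate: undo the transposition, then undo the antipode.
  let a : N ⊗ H ⟶ N := N ◁ inv 𝒮[H] ≫ (transposeAct M.X N).symm M.act
  have ha : transposeAct M.X N (N ◁ 𝒮[H] ≫ a) = M.act := by
    simp only [a]
    rw [← whiskerLeft_comp_assoc, IsIso.hom_inv_id, whiskerLeft_id, Category.id_comp,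
      Equiv.apply_symm_apply]
  refine ⟨⟨N, a, ?_, ?_⟩, ‹ExactPairing M.X N›, ?_⟩
  · apply (transposeAct M.X N).injective
    rw [← one_transposeAct, ha, M.act_one, transposeAct_rightUnitor]
  -- The antipode being invertible, so is this map, and associativity of `a` can be read back from
  -- that of `M`.
  · rw [← cancel_epi (N ◁ ((𝒮[H] ⊗ₘ 𝒮[H]) ≫ (β_ H H).hom))]
    apply (transposeAct M.X N).injective
    rw [← mul_transposeAct, ← transposeAct_transposeAct, ha, M.act_mul]
  · obtain ⟨X, act, h1, h2⟩ := M
    simp only [dual]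
    congr 1
    exact ha.symm

section Pairing

variable (N : RightMod H) (D : B) [ExactPairing D N.X]

/-- Moving the action on `D` across the evaluation turns the second leg of `Δ h` into its antipode;
the action on `N` by `h₁` followed by `S(h₂)` is `ε(h)`. -/
lemma dual_eval_comm :
    ((N.X ⊗ D) ◁ Δ[H] ≫ tensorμ N.X D H H ≫ (N.act ⊗ₘ (dual N D).act)) ≫ ε_ D N.X =
    ε_ D N.X ▷ H ≫ 𝟙_ B ◁ ε[H] ≫ (ρ_ (𝟙_ B)).hom := by
  have h0 := act_act_antipode N
  have h1 : (N.act ⊗ₘ (dual N D).act) ≫ ε_ D N.X =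
      N.act ▷ (D ⊗ H) ≫ N.X ◁ (β_ D H).hom ≫ (α_ N.X H D).inv ≫
        (N.X ◁ 𝒮[H] ≫ N.act) ▷ D ≫ ε_ D N.X := by
    rw [MonoidalCategory.tensorHom_def, Category.assoc, transposeAct_eval]
  simp only [Category.assoc]
  rw [h1]
  calc (N.X ⊗ D) ◁ Δ[H] ≫ tensorμ N.X D H H ≫ N.act ▷ (D ⊗ H) ≫ N.X ◁ (β_ D H).hom ≫
          (α_ N.X H D).inv ≫ (N.X ◁ 𝒮[H] ≫ N.act) ▷ D ≫ ε_ D N.X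
    _ = 𝟙 _ ⊗≫ N.X ◁ D ◁ Δ[H] ⊗≫ N.X ◁ (β_ D H).hom ▷ H ⊗≫
        (N.act ▷ (D ⊗ H) ≫ N.X ◁ (β_ D H).hom) ⊗≫ (N.X ◁ 𝒮[H] ≫ N.act) ▷ D ≫ ε_ D N.X := by
      simp only [tensorμ]; monoidal
    _ = 𝟙 _ ⊗≫ N.X ◁ (D ◁ Δ[H] ≫ (β_ D (H ⊗ H)).hom) ⊗≫
        N.act ▷ H ▷ D ≫ (N.X ◁ 𝒮[H] ≫ N.act) ▷ D ≫ ε_ D N.X := by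
      rw [← whisker_exchange, BraidedCategory.braiding_tensor_right_hom]; monoidal
    _ = 𝟙 _ ⊗≫ N.X ◁ (β_ D H).hom ⊗≫ (N.X ◁ Δ[H] ≫ (α_ N.X H H).inv ≫ N.act ▷ H ≫
        N.X ◁ 𝒮[H] ≫ N.act) ▷ D ≫ ε_ D N.X := by
      rw [BraidedCategory.braiding_naturality_right]; monoidal
    _ = 𝟙 _ ⊗≫ N.X ◁ ((β_ D H).hom ≫ ε[H] ▷ D) ⊗≫ ε_ D N.X := by
      rw [h0]; monoidal
    _ = 𝟙 _ ⊗≫ ((N.X ⊗ D) ◁ ε[H] ≫ ε_ D N.X ▷ 𝟙_ B) ⊗≫ 𝟙 _ := by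
      rw [← BraidedCategory.braiding_naturality_right, braiding_tensorUnit_right]; monoidal
    _ = ε_ D N.X ▷ H ≫ 𝟙_ B ◁ ε[H] ≫ (ρ_ (𝟙_ B)).hom := by
      rw [whisker_exchange]; monoidal

/-- Transposed to maps out of `N.X`, the coevaluation disappears by the zigzag identity, and what
remains is the action by `S(h₁)` followed by `h₂`. -/
lemma dual_coeval_comm : (𝟙_ B ◁ ε[H] ≫ (ρ_ (𝟙_ B)).hom) ≫ η_ D N.X =
    η_ D N.X ▷ H ≫ (D ⊗ N.X) ◁ Δ[H] ≫ tensorμ D N.X H H ≫ ((dual N D).act ⊗ₘ N.act) := by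
  have h0 := act_antipode_act N
  apply (tensorLeftHomEquiv _ D N.X N.X).symm.injective
  simp only [tensorLeftHomEquiv, Equiv.coe_fn_symm_mk]
  symm
  calc N.X ◁ (η_ D N.X ▷ H ≫ (D ⊗ N.X) ◁ Δ[H] ≫ tensorμ D N.X H H ≫
          (transposeAct D N.X (N.X ◁ 𝒮[H] ≫ N.act) ⊗ₘ N.act)) ≫
          (α_ N.X D N.X).inv ≫ ε_ D N.X ▷ N.X ≫ (λ_ N.X).hom
    _ = N.X ◁ (η_ D N.X ▷ H ≫ (D ⊗ N.X) ◁ Δ[H]) ⊗≫ N.X ◁ D ◁ (β_ N.X H).hom ▷ H ⊗≫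
        (N.X ◁ transposeAct D N.X (N.X ◁ 𝒮[H] ≫ N.act)) ▷ (N.X ⊗ H) ⊗≫
          ((N.X ⊗ D) ◁ N.act ≫ ε_ D N.X ▷ N.X) ⊗≫ 𝟙 _ := by
      rw [MonoidalCategory.tensorHom_def]; simp only [tensorμ]; monoidal
    _ = N.X ◁ (η_ D N.X ▷ H ≫ (D ⊗ N.X) ◁ Δ[H]) ⊗≫ N.X ◁ D ◁ (β_ N.X H).hom ▷ H ⊗≫
        (N.X ◁ transposeAct D N.X (N.X ◁ 𝒮[H] ≫ N.act) ≫ ε_ D N.X) ▷ (N.X ⊗ H) ⊗≫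
          N.act := by
      rw [whisker_exchange]; monoidal
    _ = N.X ◁ (η_ D N.X ▷ H ≫ (D ⊗ N.X) ◁ Δ[H]) ⊗≫ N.X ◁ (β_ (D ⊗ N.X) H).hom ▷ H ⊗≫
        ((N.X ◁ 𝒮[H] ≫ N.act) ▷ D ≫ ε_ D N.X) ▷ (N.X ⊗ H) ⊗≫ N.act := by
      rw [transposeAct_eval, BraidedCategory.braiding_tensor_left_hom]; monoidal
    _ = 𝟙 _ ⊗≫ N.X ◁ Δ[H] ⊗≫ N.X ◁ (η_ D N.X ▷ H ≫ (β_ (D ⊗ N.X) H).hom) ▷ H ⊗≫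
        ((N.X ◁ 𝒮[H] ≫ N.act) ▷ D ≫ ε_ D N.X) ▷ (N.X ⊗ H) ⊗≫ N.act := by
      rw [← whisker_exchange]; monoidal
    _ = 𝟙 _ ⊗≫ N.X ◁ Δ[H] ⊗≫ ((N.X ⊗ H) ◁ η_ D N.X ≫
        (N.X ◁ 𝒮[H] ≫ N.act) ▷ (D ⊗ N.X)) ▷ H ⊗≫ ε_ D N.X ▷ (N.X ⊗ H) ⊗≫ N.act := by
      rw [BraidedCategory.braiding_naturality_left, braiding_tensorUnit_left]; monoidal
    _ = 𝟙 _ ⊗≫ N.X ◁ Δ[H] ⊗≫ (N.X ◁ 𝒮[H] ≫ N.act) ▷ H ⊗≫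
        (N.X ◁ η_ D N.X ⊗≫ ε_ D N.X ▷ N.X) ▷ H ⊗≫ N.act := by
      rw [whisker_exchange]; monoidal
    _ = 𝟙 _ ⊗≫ (N.X ◁ Δ[H] ≫ (α_ N.X H H).inv ≫ (N.X ◁ 𝒮[H] ≫ N.act) ▷ H ≫ N.act) := by
      rw [coevaluation_evaluation'']; monoidal
    _ = 𝟙 _ ⊗≫ N.X ◁ ε[H] ⊗≫ 𝟙 _ := by rw [h0]; monoidal
    _ = 𝟙 _ ⊗≫ N.X ◁ ε[H] ⊗≫ (N.X ◁ η_ D N.X ⊗≫ ε_ D N.X ▷ N.X) ⊗≫ 𝟙 _ := by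
      rw [coevaluation_evaluation'']; monoidal
    _ = N.X ◁ ((𝟙_ B ◁ ε[H] ≫ (ρ_ (𝟙_ B)).hom) ≫ η_ D N.X) ≫
          (α_ N.X D N.X).inv ≫ ε_ D N.X ▷ N.X ≫ (λ_ N.X).hom := by monoidal

/-- The duality between a module and its left dual. -/
@[reducible]
def dualPairing : ExactPairing (dual N D) N where
  coevaluation' := ⟨η_ D N.X, dual_coeval_comm N D⟩
  evaluation' := ⟨ε_ D N.X, dual_eval_comm N D⟩
  coevaluation_evaluation' := hom_ext (coevaluation_evaluation D N.X)
  evaluation_coevaluation' := hom_ext (evaluation_coevaluation D N.X)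

end Pairing

end RightMod

/-! ### Products with trivial modules and with the regular module; fusion. -/

namespace RightMod

open ExactPairing
open scoped MonObj ComonObj HopfObj

variable {B : Type u} [Category.{v} B] [MonoidalCategory B]

/-- The regular module. -/
@[reducible]
def reg (H : B) [MonObj H] : RightMod H where
  X := H
  act := μ[H]
  act_one := MonObj.mul_one H
  act_mul := by rw [MonObj.mul_assoc_flip]

section Fuse

variable {H : B} [ComonObj H]

/-- The map `n ⊗ h ↦ n h₁ ⊗ h₂`. -/
def fuse {N : B} (b : N ⊗ H ⟶ N) : N ⊗ H ⟶ N ⊗ H :=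
  N ◁ Δ[H] ≫ (α_ N H H).inv ≫ b ▷ H

/-- Coassociativity makes `fuse` multiplicative for the convolution of actions. With `fuse_counit`,
convolution inverses give inverse maps, so the antipode inverts the fusion map of a module. -/
lemma fuse_comp_fuse {N : B} (b b' : N ⊗ H ⟶ N) :
    fuse b ≫ fuse b' = fuse (N ◁ Δ[H] ≫ (α_ N H H).inv ≫ b ▷ H ≫ b') := by
  calc fuse b ≫ fuse b'
    _ = N ◁ Δ[H] ⊗≫ (b ▷ H ≫ N ◁ Δ[H]) ⊗≫ b' ▷ H := by simp only [fuse]; monoidal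
    _ = N ◁ (Δ[H] ≫ H ◁ Δ[H]) ⊗≫ b ▷ H ▷ H ≫ b' ▷ H := by
      rw [← whisker_exchange]; monoidal
    _ = _ := by
      rw [ComonObj.comul_assoc]; simp only [fuse]; monoidal

lemma fuse_counit (N : B) : fuse (N ◁ ε[H] ≫ (ρ_ N).hom) = 𝟙 (N ⊗ H) := by
  calc fuse (N ◁ ε[H] ≫ (ρ_ N).hom)
    _ = N ◁ (Δ[H] ≫ ε[H] ▷ H) ⊗≫ 𝟙 _ := by simp only [fuse]; monoidal
    _ = _ := by rw [ComonObj.counit_comul]; monoidal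

end Fuse

variable [BraidedCategory B]

section Bimon

variable {H : B} [BimonObj H]

/-- The counit absorbs the first leg of `Δ`, and braiding with the unit is trivial. In
`tens_triv_act` the second leg is absorbed, and the braiding of `V` past `H` survives. -/
lemma triv_tens_act (V : B) (M : RightMod H) :
    (tens (triv H V) M).act = (α_ V M.X H).hom ≫ V ◁ M.act := by
  have e1 : (V ◁ ε[H] ≫ (ρ_ V).hom) ⊗ₘ M.act =
      (V ◁ ε[H] ⊗ₘ M.X ◁ 𝟙 H) ≫ ((ρ_ V).hom ⊗ₘ M.act) := by
    rw [tensorHom_comp_tensorHom, whiskerLeft_id, Category.id_comp]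
  change (V ⊗ M.X) ◁ Δ[H] ≫ tensorμ V M.X H H ≫ ((V ◁ ε[H] ≫ (ρ_ V).hom) ⊗ₘ M.act) = _
  rw [e1, ← tensorμ_natural_right_assoc, ← whiskerLeft_comp_assoc, tensorHom_id,
    ComonObj.counit_comul, MonoidalCategory.tensorHom_def]
  simp only [tensorμ, braiding_tensorUnit_right]
  monoidal

lemma tens_triv_act (M : RightMod H) (V : B) :
    (tens M (triv H V)).act =
      (α_ M.X V H).hom ≫ M.X ◁ (β_ V H).hom ≫ (α_ M.X H V).inv ≫ M.act ▷ V := by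
  have e1 : M.act ⊗ₘ (V ◁ ε[H] ≫ (ρ_ V).hom) =
      (M.X ◁ 𝟙 H ⊗ₘ V ◁ ε[H]) ≫ (M.act ⊗ₘ (ρ_ V).hom) := by
    rw [tensorHom_comp_tensorHom, whiskerLeft_id, Category.id_comp]
  change (M.X ⊗ V) ◁ Δ[H] ≫ tensorμ M.X V H H ≫ (M.act ⊗ₘ (V ◁ ε[H] ≫ (ρ_ V).hom)) = _
  rw [e1, ← tensorμ_natural_right_assoc, ← whiskerLeft_comp_assoc, id_tensorHom,
    ComonObj.comul_counit, MonoidalCategory.tensorHom_def']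
  simp only [tensorμ]
  monoidal

/-- The product of a trivial module and the regular module is free. -/
def trivRegIso (V : B) : triv H V ⊗ reg H ≅ free H V :=
  isoMk (Iso.refl (V ⊗ H)) (by
    have h := triv_tens_act V (reg H)
    change (tens (triv H V) (reg H)).act ≫ 𝟙 (V ⊗ H) =
      𝟙 (V ⊗ H) ▷ H ≫ (α_ V H H).hom ≫ V ◁ μ[H]
    rw [h, id_whiskerRight, Category.id_comp]
    exact Category.comp_id _)

/-- Trivial modules commute with all modules, by the inverse braiding. -/
def trivComm (M : RightMod H) (V : B) : M ⊗ triv H V ≅ triv H V ⊗ M :=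
  isoMk (β_ V M.X).symm (by
    have h : ((α_ M.X V H).hom ≫ M.X ◁ (β_ V H).hom ≫ (α_ M.X H V).inv ≫ M.act ▷ V) ≫
        (β_ V M.X).inv = (β_ V M.X).inv ▷ H ≫ (α_ V M.X H).hom ≫ V ◁ M.act := by
      simp only [Category.assoc]
      rw [BraidedCategory.braiding_inv_naturality_left, BraidedCategory.braiding_tensor_right_inv]
      simp
    exact (congrArg (· ≫ (β_ V M.X).inv) (tens_triv_act M V)).trans
      (h.trans (congrArg ((β_ V M.X).inv ▷ H ≫ ·) (triv_tens_act V M)).symm))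

/-- Morphisms of trivial modules. -/
def trivMap (H : B) [BimonObj H] {V W : B} (f : V ⟶ W) : triv H V ⟶ triv H W where
  hom := f
  comm := by
    change (V ◁ ε[H] ≫ (ρ_ V).hom) ≫ f = f ▷ H ≫ W ◁ ε[H] ≫ (ρ_ W).hom
    rw [← whisker_exchange_assoc, rightUnitor_naturality, Category.assoc]

end Bimon

section Fusion

variable {H : B}

/-- Multiplicativity of `Δ` together with associativity of the action: `n (h h')₁ ⊗ (h h')₂` is the
diagonal action of `h'` on `n h₁ ⊗ h₂`. -/
lemma fuse_act_comm [BimonObj H] (N : RightMod H) :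
    ((α_ N.X H H).hom ≫ N.X ◁ μ[H]) ≫ fuse N.act =
      fuse N.act ▷ H ≫ (N.X ⊗ H) ◁ Δ[H] ≫ tensorμ N.X H H H ≫ (N.act ⊗ₘ μ[H]) := by
  have h1 : μ[H] ≫ Δ[H] = (Δ[H] ⊗ₘ Δ[H]) ≫ tensorμ H H H H ≫ (μ[H] ⊗ₘ μ[H]) :=
    BimonObj.mul_comul H
  calc ((α_ N.X H H).hom ≫ N.X ◁ μ[H]) ≫ fuse N.act
    _ = 𝟙 _ ⊗≫ N.X ◁ (μ[H] ≫ Δ[H]) ⊗≫ N.act ▷ H := by simp only [fuse]; monoidal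
    _ = 𝟙 _ ⊗≫ N.X ◁ (Δ[H] ⊗ₘ Δ[H]) ⊗≫ N.X ◁ H ◁ (β_ H H).hom ▷ H ⊗≫
        N.X ◁ H ◁ H ◁ μ[H] ⊗≫ (N.X ◁ μ[H] ≫ N.act) ▷ H := by
      rw [h1, MonoidalCategory.tensorHom_def' μ[H] μ[H]]; simp only [tensorμ]; monoidal
    _ = 𝟙 _ ⊗≫ N.X ◁ (Δ[H] ▷ H ≫ (H ⊗ H) ◁ Δ[H]) ⊗≫ N.X ◁ H ◁ (β_ H H).hom ▷ H ⊗≫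
        ((N.X ⊗ H) ◁ H ◁ μ[H] ≫ N.act ▷ (H ⊗ H)) ⊗≫ N.act ▷ H := by
      rw [N.act_mul, MonoidalCategory.tensorHom_def]; monoidal
    _ = 𝟙 _ ⊗≫ N.X ◁ (Δ[H] ▷ H ≫ (H ⊗ H) ◁ Δ[H]) ⊗≫ ((N.X ⊗ H) ◁ (β_ H H).hom ≫
        N.act ▷ (H ⊗ H)) ▷ H ⊗≫ N.X ◁ H ◁ μ[H] ⊗≫ N.act ▷ H := by
      rw [whisker_exchange]; monoidal
    _ = 𝟙 _ ⊗≫ N.X ◁ (Δ[H] ▷ H) ⊗≫ ((N.X ⊗ H ⊗ H) ◁ Δ[H] ≫ (((α_ N.X H H).inv ≫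
        N.act ▷ H) ▷ (H ⊗ H))) ⊗≫ N.X ◁ (β_ H H).hom ▷ H ⊗≫
          ((N.X ⊗ H) ◁ μ[H] ≫ N.act ▷ H) := by
      rw [whisker_exchange]; monoidal
    _ = _ := by
      rw [whisker_exchange, MonoidalCategory.tensorHom_def]
      rw [whisker_exchange N.act μ[H]]
      simp only [tensorμ, fuse]; monoidal

/-- The fusion isomorphism between a free module and a product with the regular module. -/
def fusionIso [HopfObj H] (N : RightMod H) : free H N.X ≅ N ⊗ reg H :=
  isoMk
    { hom := fuse N.act
      inv := fuse (N.X ◁ 𝒮[H] ≫ N.act)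
      hom_inv_id := (by rw [fuse_comp_fuse, act_act_antipode, fuse_counit] :
        fuse N.act ≫ fuse (N.X ◁ 𝒮[H] ≫ N.act) = 𝟙 (N.X ⊗ H))
      inv_hom_id := (by rw [fuse_comp_fuse, act_antipode_act, fuse_counit] :
        fuse (N.X ◁ 𝒮[H] ≫ N.act) ≫ fuse N.act = 𝟙 (N.X ⊗ H)) }
    (fuse_act_comm N)

lemma fusionIso_naturality [HopfObj H] {N N' : RightMod H} (f : N ⟶ N') :
    (freeFunctor H).map f.hom ≫ (fusionIso N').hom = (fusionIso N).hom ≫ f ▷ reg H := by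
  apply hom_ext
  change f.hom ▷ H ≫ fuse N'.act = fuse N.act ≫ f.hom ▷ H
  simp only [fuse, Category.assoc]
  rw [← whisker_exchange_assoc, associator_inv_naturality_left_assoc, ← comp_whiskerRight,
    ← comp_whiskerRight, f.comm]

end Fusion

end RightMod

/-! ### Coinvariants and freeness of the dual of the regular module. -/

open ExactPairing
open scoped MonObj ComonObj HopfObj

/-- The bijection between morphisms `D ⟶ Z` and morphisms `𝟙_ ⟶ Z ⊗ N`. -/
@[simps]
def copairingEquiv {B : Type u} [Category.{v} B] [MonoidalCategory B] (D N : B)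
    [ExactPairing D N] (Z : B) : (D ⟶ Z) ≃ (𝟙_ B ⟶ Z ⊗ N) where
  toFun f := η_ D N ≫ f ▷ N
  invFun g := 𝟙 _ ⊗≫ g ▷ D ⊗≫ Z ◁ ε_ D N ⊗≫ 𝟙 _
  left_inv f := by
    calc 𝟙 _ ⊗≫ (η_ D N ≫ f ▷ N) ▷ D ⊗≫ Z ◁ ε_ D N ⊗≫ 𝟙 _
      _ = 𝟙 _ ⊗≫ η_ D N ▷ D ⊗≫ (f ▷ (N ⊗ D) ≫ Z ◁ ε_ D N) ⊗≫ 𝟙 _ := by monoidal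
      _ = 𝟙 _ ⊗≫ (η_ D N ▷ D ⊗≫ D ◁ ε_ D N) ⊗≫ f := by
        rw [← whisker_exchange]; monoidal
      _ = f := by rw [evaluation_coevaluation'']; monoidal
  right_inv g := by
    calc η_ D N ≫ (𝟙 _ ⊗≫ g ▷ D ⊗≫ Z ◁ ε_ D N ⊗≫ 𝟙 _) ▷ N
      _ = 𝟙 _ ⊗≫ (𝟙_ B ◁ η_ D N ≫ g ▷ (D ⊗ N)) ⊗≫ Z ◁ ε_ D N ▷ N ⊗≫ 𝟙 _ := by monoidal
      _ = g ⊗≫ Z ◁ (N ◁ η_ D N ⊗≫ ε_ D N ▷ N) ⊗≫ 𝟙 _ := by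
        rw [whisker_exchange]; monoidal
      _ = g := by rw [coevaluation_evaluation'']; monoidal

namespace RightMod

variable {B : Type u} [Category.{v} B] [MonoidalCategory B] [BraidedCategory B] {H : B}

section Coinvariants

variable [BimonObj H] (M : RightMod H)

lemma counit_act_naturality {V W : B} (f : V ⟶ W) :
    (V ◁ ε[H] ≫ (ρ_ V).hom) ≫ f = f ▷ H ≫ W ◁ ε[H] ≫ (ρ_ W).hom := by
  rw [← whisker_exchange_assoc, rightUnitor_naturality, Category.assoc]

variable [HasCoequalizers B]

/-- The coinvariants of a module. -/
@[reducible]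
noncomputable def coinv : B := coequalizer M.act (M.X ◁ ε[H] ≫ (ρ_ M.X).hom)

/-- The universal property of the coinvariants. -/
noncomputable def coinvEquiv (W : B) : (coinv M ⟶ W) ≃ (M ⟶ triv H W) where
  toFun g := ⟨coequalizer.π M.act (M.X ◁ ε[H] ≫ (ρ_ M.X).hom) ≫ g, by
    have h (g : coinv M ⟶ W) :
        M.act ≫ coequalizer.π M.act (M.X ◁ ε[H] ≫ (ρ_ M.X).hom) ≫ g =
        (coequalizer.π M.act (M.X ◁ ε[H] ≫ (ρ_ M.X).hom) ≫ g) ▷ H ≫ W ◁ ε[H] ≫ (ρ_ W).hom := by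
      rw [← counit_act_naturality, coequalizer.condition_assoc, Category.assoc]
    exact h g⟩
  invFun f := coequalizer.desc f.hom (by
    have h : M.act ≫ f.hom = f.hom ▷ H ≫ W ◁ ε[H] ≫ (ρ_ W).hom := f.comm
    exact h.trans (counit_act_naturality f.hom).symm)
  left_inv g := by
    apply coequalizer.hom_ext
    exact coequalizer.π_desc ..
  right_inv f := hom_ext (coequalizer.π_desc ..)

lemma coinvEquiv_comp {W W' : B} (f : coinv M ⟶ W) (g : W ⟶ W') :
    coinvEquiv M W' (f ≫ g) = coinvEquiv M W f ≫ trivMap H g :=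
  hom_ext (Category.assoc ..).symm

end Coinvariants

section DualRegular

variable [HopfObj H] (D : B) [ExactPairing D H]

instance dualRegPairing : ExactPairing (dual (reg H) D) (reg H) :=
  dualPairing (reg H) D

/-- The morphism of free modules given by a morphism. -/
@[reducible]
def freeMap (H : B) [MonObj H] {V W : B} (f : V ⟶ W) : free H V ⟶ free H W :=
  (freeFunctor H).map f

/-- The isomorphism `triv N ⊗ H ≅ N ⊗ H`. -/
def trivFusionIso (N : RightMod H) : triv H N.X ⊗ reg H ≅ N ⊗ reg H :=
  trivRegIso N.X ≪≫ fusionIso N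

lemma trivRegIso_naturality {V W : B} (f : V ⟶ W) :
    trivMap H f ▷ reg H ≫ (trivRegIso W).hom = (trivRegIso V).hom ≫ freeMap H f :=
  hom_ext ((Category.comp_id (f ▷ H)).trans (Category.id_comp (f ▷ H)).symm)

lemma freeMap_fusionIso {N N' : RightMod H} (f : N ⟶ N') :
    freeMap H f.hom ≫ (fusionIso N').hom = (fusionIso N).hom ≫ f ▷ reg H :=
  fusionIso_naturality f

lemma trivFusionIso_naturality {N N' : RightMod H} (f : N ⟶ N') :
    trivMap H f.hom ▷ reg H ≫ (trivFusionIso N').hom = (trivFusionIso N).hom ≫ f ▷ reg H := by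
  have h := trivRegIso_naturality (H := H) f.hom
  have h' := freeMap_fusionIso f
  generalize freeMap H f.hom = m at h h'
  simp only [trivFusionIso, Iso.trans_hom, Category.assoc]
  rw [reassoc_of% h, h']

variable [HasCoequalizers B]

/-- Morphisms out of the dual of the regular module. -/
noncomputable def dualRegHomEquiv (N : RightMod H) :
    (free H (coinv (dual (reg H) D)) ⟶ N) ≃ (dual (reg H) D ⟶ N) :=
  -- With `D` the dual of the regular module: maps from the free module on the coinvariants of `D`
  -- to `N` are maps `D ⟶ triv N`, hence maps `𝟙_ ⟶ triv N ⊗ H`. Fusion replaces `triv N` by `N`,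
  -- and duality leads back to maps `D ⟶ N`.
  (freeEquiv _ N).trans <| (coinvEquiv (dual (reg H) D) N.X).trans <|
    (copairingEquiv (dual (reg H) D) (reg H) (triv H N.X)).trans <|
      (trivFusionIso N).homToEquiv.trans (copairingEquiv (dual (reg H) D) (reg H) N).symm

/-- Naturality in the target, from which `dualRegIso` follows by the Yoneda argument. -/
lemma dualRegHomEquiv_comp {N N' : RightMod H} (f : free H (coinv (dual (reg H) D)) ⟶ N)
    (g : N ⟶ N') : dualRegHomEquiv D N' (f ≫ g) = dualRegHomEquiv D N f ≫ g := by
  have h1 : coinvEquiv (dual (reg H) D) N'.X (freeEquiv _ N' (f ≫ g)) =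
      coinvEquiv (dual (reg H) D) N.X (freeEquiv _ N f) ≫ trivMap H g.hom :=
    (congrArg (coinvEquiv (dual (reg H) D) N'.X) (Category.assoc _ _ _).symm).trans
      (coinvEquiv_comp _ _ _)
  have h2 {Z Z' : RightMod H} (x : dual (reg H) D ⟶ Z) (y : Z ⟶ Z') :
      copairingEquiv (dual (reg H) D) (reg H) Z' (x ≫ y) =
        copairingEquiv (dual (reg H) D) (reg H) Z x ≫ y ▷ reg H := by
    simp only [copairingEquiv_apply, comp_whiskerRight, Category.assoc]
  apply (copairingEquiv (dual (reg H) D) (reg H) N').injective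
  rw [h2]
  simp only [dualRegHomEquiv, Equiv.trans_apply, Equiv.apply_symm_apply]
  rw [h1, h2]
  simp only [Iso.homToEquiv_apply, Category.assoc, trivFusionIso_naturality]

/-- The dual of the regular module is a free module. -/
noncomputable def dualRegIso : dual (reg H) D ≅ free H (coinv (dual (reg H) D)) where
  hom := dualRegHomEquiv D _ (𝟙 _)
  inv := (dualRegHomEquiv D _).symm (𝟙 _)
  hom_inv_id := by rw [← dualRegHomEquiv_comp, Category.id_comp, Equiv.apply_symm_apply]
  inv_hom_id := by
    apply (dualRegHomEquiv D _).injective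
    rw [dualRegHomEquiv_comp, Equiv.apply_symm_apply, Category.id_comp]

end DualRegular

end RightMod

/-! ### Universal right integrals and invertibility of the object of integrals. -/

section Integral

variable {B : Type u} [Category.{v} B] [MonoidalCategory B] [BraidedCategory B] {H : B}
  [BimonObj H]

lemma isRightIntegral_iff {X : B} (t : X ⟶ H) : isRightIntegral H (Over.mk t) ↔
    t ▷ H ≫ μ[H] = t ▷ H ≫ H ◁ ε[H] ≫ (ρ_ H).hom := by
  unfold isRightIntegral
  rw [MonoidalCategory.tensorHom_def, Category.assoc]
  rfl

variable (H) in
-- Transposing the second factor `H` turns the integral condition on `t` into equality of its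
-- composites with two fixed maps out of `H`; the universal integral is their equalizer.
lemma exists_terminal_rightIntegral [HasEqualizers B] [HasRightDual H] :
    ∃ Λ : RightIntegral H, Nonempty (IsTerminal Λ) := by
  let T := tensorRightHomEquiv H H Hᘁ H
  have hT {X : B} (t : X ⟶ H) (m : H ⊗ H ⟶ H) :
      (tensorRightHomEquiv X H Hᘁ H) (t ▷ H ≫ m) = t ≫ T m := by
    rw [← Equiv.eq_symm_apply, tensorRightHomEquiv_symm_naturality]
    simp [T]
  let a := T μ[H]
  let b := T (H ◁ ε[H] ≫ (ρ_ H).hom)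
  have key {X : B} (t : X ⟶ H) : isRightIntegral H (Over.mk t) ↔ t ≫ a = t ≫ b := by
    rw [isRightIntegral_iff, ← hT, ← hT, Equiv.apply_eq_iff_eq]
  refine ⟨⟨Over.mk (equalizer.ι a b), (key _).2 (equalizer.condition a b)⟩, ⟨?_⟩⟩
  refine IsTerminal.ofUniqueHom
    (fun t => ⟨Over.homMk (equalizer.lift t.obj.hom ((key t.obj.hom).1 t.property))
      (equalizer.lift_ι ..)⟩) ?_
  intro t m
  apply InducedCategory.hom_ext
  apply Over.OverMorphism.ext
  apply equalizer.hom_ext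
  exact (Over.w m.hom).trans (equalizer.lift_ι ..).symm

/-- The property of being a universal right integral, in elementary terms. -/
structure IsUniversalRightIntegral {I : B} (Λ : I ⟶ H) : Prop where
  mul_eq : Λ ▷ H ≫ μ[H] = Λ ▷ H ≫ H ◁ ε[H] ≫ (ρ_ H).hom
  existsUnique_lift : ∀ {X : B} (t : X ⟶ H),
    t ▷ H ≫ μ[H] = t ▷ H ≫ H ◁ ε[H] ≫ (ρ_ H).hom → ∃! l : X ⟶ I, l ≫ Λ = t

lemma isUniversalRightIntegral_of_isTerminal {Λ : RightIntegral H} (hΛ : IsTerminal Λ) :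
    IsUniversalRightIntegral Λ.obj.hom where
  mul_eq := (isRightIntegral_iff Λ.obj.hom).1 Λ.property
  existsUnique_lift {X} t ht := by
    let t' : RightIntegral H := ⟨Over.mk t, (isRightIntegral_iff t).2 ht⟩
    refine ⟨(hΛ.from t').hom.left, Over.w (hΛ.from t').hom, fun l hl => ?_⟩
    let m : t' ⟶ Λ := ⟨Over.homMk l hl⟩
    exact congrArg (fun m : t' ⟶ Λ => m.hom.left) (hΛ.hom_ext m (hΛ.from t'))

namespace IsUniversalRightIntegral

variable {I : B} {Λ : I ⟶ H}

lemma comp_mul_eq (h : IsUniversalRightIntegral Λ) {X : B} (l : X ⟶ I) :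
    (l ≫ Λ) ▷ H ≫ μ[H] = (l ≫ Λ) ▷ H ≫ H ◁ ε[H] ≫ (ρ_ H).hom := by
  rw [comp_whiskerRight, Category.assoc, h.mul_eq, Category.assoc]

lemma mono (h : IsUniversalRightIntegral Λ) : Mono Λ where
  right_cancellation _ g e :=
    (h.existsUnique_lift (g ≫ Λ) (h.comp_mul_eq g)).unique e rfl

/-- The universal property of the universal right integral, tensored with a dualizable object. -/
lemma existsUnique_lift_whiskerLeft (h : IsUniversalRightIntegral Λ) (V Vd : B)
    [ExactPairing V Vd] {X : B} (f : X ⟶ V ⊗ H)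
    (hf : f ▷ H ≫ (α_ V H H).hom ≫ V ◁ μ[H] =
      f ▷ H ≫ (α_ V H H).hom ≫ V ◁ (H ◁ ε[H] ≫ (ρ_ H).hom)) :
    ∃! l : X ⟶ V ⊗ I, l ≫ V ◁ Λ = f := by
  have key (m : H ⊗ H ⟶ H) : ((tensorLeftHomEquiv X V Vd H).symm f) ▷ H ≫ m =
      (α_ Vd X H).hom ≫ Vd ◁ (f ▷ H ≫ (α_ V H H).hom ≫ V ◁ m) ≫ (α_ Vd V H).inv ≫
        ε_ V Vd ▷ H ≫ (λ_ H).hom := by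
    simp only [tensorLeftHomEquiv, Equiv.coe_fn_symm_mk]
    calc (Vd ◁ f ≫ (α_ Vd V H).inv ≫ ε_ V Vd ▷ H ≫ (λ_ H).hom) ▷ H ≫ m
      _ = 𝟙 _ ⊗≫ Vd ◁ f ▷ H ⊗≫ (ε_ V Vd ▷ (H ⊗ H) ≫ 𝟙_ B ◁ m) ⊗≫ 𝟙 _ := by monoidal
      _ = _ := by rw [← whisker_exchange]; monoidal
  obtain ⟨l, hl, hu⟩ := h.existsUnique_lift ((tensorLeftHomEquiv X V Vd H).symm f) (by
    rw [key, key, hf])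
  refine ⟨tensorLeftHomEquiv X V Vd I l, ?_, fun l' hl' => ?_⟩
  · change tensorLeftHomEquiv X V Vd I l ≫ V ◁ Λ = f
    rw [← tensorLeftHomEquiv_naturality, hl, Equiv.apply_symm_apply]
  · rw [← Equiv.symm_apply_eq]
    apply hu
    change (tensorLeftHomEquiv X V Vd I).symm l' ≫ Λ = (tensorLeftHomEquiv X V Vd H).symm f
    rw [← hl', Equiv.eq_symm_apply, tensorLeftHomEquiv_naturality, Equiv.apply_symm_apply]

end IsUniversalRightIntegral

end Integral

open ExactPairing
open scoped MonObj ComonObj HopfObj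

namespace RightMod

variable {B : Type u} [Category.{v} B] [MonoidalCategory B] [BraidedCategory B] {H : B}
  [HopfObj H]

/-- A linear map from a trivial to a free module is an integral in the factor `H`, with `V` as a
parameter. This is why such maps are maps into `V ⊗ I`. -/
lemma comm_triv_free {X V : B} (l : X ⟶ V ⊗ H) :
    (triv H X).act ≫ l = l ▷ H ≫ (free H V).act ↔
      l ▷ H ≫ (α_ V H H).hom ≫ V ◁ μ[H] =
        l ▷ H ≫ (α_ V H H).hom ≫ V ◁ (H ◁ ε[H] ≫ (ρ_ H).hom) := by
  have h1 : (X ◁ ε[H] ≫ (ρ_ X).hom) ≫ l =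
      l ▷ H ≫ (α_ V H H).hom ≫ V ◁ (H ◁ ε[H] ≫ (ρ_ H).hom) := by
    rw [counit_act_naturality]; monoidal
  change (X ◁ ε[H] ≫ (ρ_ X).hom) ≫ l = l ▷ H ≫ (α_ V H H).hom ≫ V ◁ μ[H] ↔ _
  rw [h1]
  exact eq_comm

section

variable {I : B} {Λ : I ⟶ H} (h : IsUniversalRightIntegral Λ) (V Vd : B) [ExactPairing V Vd]

/-- Morphisms from trivial modules to free modules factor through the integral. -/
noncomputable def integralEquiv (X : B) : (X ⟶ V ⊗ I) ≃ (triv H X ⟶ free H V) :=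
  Equiv.ofBijective
    (fun l => ⟨l ≫ V ◁ Λ, (comm_triv_free _).2 (by
      have h1 := h.mul_eq
      calc (l ≫ V ◁ Λ) ▷ H ≫ (α_ V H H).hom ≫ V ◁ μ[H]
        _ = l ▷ H ≫ (α_ V I H).hom ≫ V ◁ (Λ ▷ H ≫ μ[H]) := by monoidal
        _ = _ := by rw [h1]; monoidal)⟩)
    ⟨fun l l' e =>
      (h.existsUnique_lift_whiskerLeft V Vd (l' ≫ V ◁ Λ) (by
        have h1 := h.mul_eq
        calc (l' ≫ V ◁ Λ) ▷ H ≫ (α_ V H H).hom ≫ V ◁ μ[H]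
          _ = l' ▷ H ≫ (α_ V I H).hom ≫ V ◁ (Λ ▷ H ≫ μ[H]) := by monoidal
          _ = _ := by rw [h1]; monoidal)).unique (congrArg Hom.hom e) rfl,
     fun f => by
      obtain ⟨l, hl, -⟩ := h.existsUnique_lift_whiskerLeft V Vd f.hom
        ((comm_triv_free (H := H) f.hom).1 f.comm)
      exact ⟨l, hom_ext hl⟩⟩

lemma integralEquiv_naturality {X Y : B} (g : Y ⟶ X) (l : X ⟶ V ⊗ I) :
    integralEquiv h V Vd Y (g ≫ l) = trivMap H g ≫ integralEquiv h V Vd X l :=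
  hom_ext (Category.assoc g l (V ◁ Λ))

end

section

variable (D : B) [ExactPairing D H]

/-- Morphisms from trivial modules to the dual of the regular module. -/
def trivDualRegEquiv (X : B) : (triv H X ⟶ dual (reg H) D) ≃ (X ⟶ 𝟙_ B) :=
  -- Duality gives maps `H ⊗ triv X ⟶ 𝟙_`; the source is isomorphic to the free module on `X`.
  (pairingEquiv (dual (reg H) D) (reg H) (triv H X)).trans <|
    (trivComm (reg H) X ≪≫ trivRegIso X).homFromEquiv.trans (freeEquiv X (𝟙_ (RightMod H)))

lemma trivDualRegEquiv_naturality {X Y : B} (g : Y ⟶ X) (f : triv H X ⟶ dual (reg H) D) :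
    trivDualRegEquiv D Y (trivMap H g ≫ f) = g ≫ trivDualRegEquiv D X f := by
  have h1 (x : H ⊗ X ⟶ 𝟙_ B) : freeUnit H Y ≫ (𝟙 (Y ⊗ H) ≫ (β_ Y H).hom) ≫ H ◁ g ≫ x =
      g ≫ freeUnit H X ≫ (𝟙 (X ⊗ H) ≫ (β_ X H).hom) ≫ x := by
    have : freeUnit H Y ≫ g ▷ H = g ≫ freeUnit H X := by
      simp only [freeUnit, Category.assoc]
      rw [whisker_exchange, rightUnitor_inv_naturality_assoc]
    rw [← reassoc_of% this]
    simp only [Category.id_comp]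
    rw [← BraidedCategory.braiding_naturality_left_assoc]
  have h2 (f : X ⟶ D) : H ◁ (g ≫ f) ≫ ε_ D H = H ◁ g ≫ H ◁ f ≫ ε_ D H := by simp
  exact (congrArg (fun t => freeUnit H Y ≫ (𝟙 (Y ⊗ H) ≫ (β_ Y H).hom) ≫ t) (h2 f.hom)).trans
    (h1 (H ◁ f.hom ≫ ε_ D H))

end

variable {I : B} {Λ : I ⟶ H} (h : IsUniversalRightIntegral Λ) [HasCoequalizers B]
  (D : B) [ExactPairing D H] (Vd : B) [ExactPairing (coinv (dual (reg H) D)) Vd]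

/-- The object of integrals is invertible. -/
noncomputable def integralInvIso : coinv (dual (reg H) D) ⊗ I ≅ 𝟙_ B :=
  -- With `V` the coinvariants: maps `X ⟶ V ⊗ I` are maps from `triv X` to the free module on `V`,
  -- which is the dual of the regular module, and these are maps `X ⟶ 𝟙_`.
  let e (X : B) := (integralEquiv h (coinv (dual (reg H) D)) Vd X).trans
    ((dualRegIso D).symm.homToEquiv.trans (trivDualRegEquiv D X))
  Yoneda.ext _ _ (fun {X} => e X) (fun {X} => (e X).symm) (fun {X} => (e X).symm_apply_apply)
    (fun {X} => (e X).apply_symm_apply) (fun {X Y} g l => by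
      simp only [e, Equiv.trans_apply]
      rw [integralEquiv_naturality, ← trivDualRegEquiv_naturality]
      simp only [Iso.homToEquiv_apply, Category.assoc])

end RightMod

/-! ### Invertibility of the antipode and rigidity of the category of modules. -/

section Faithful

variable {B : Type u} [Category.{v} B] [MonoidalCategory B]

/-- Conjugating `A ◁ V ◁ f` by `e` recovers `f`. No triangle identity is needed. -/
lemma whiskerLeft_cancel {A V : B} (e : A ⊗ V ≅ 𝟙_ B) {X Y : B} {f g : X ⟶ Y}
    (h : V ◁ f = V ◁ g) : f = g := by
  have key (f : X ⟶ Y) : f = (λ_ X).inv ≫ e.inv ▷ X ≫ (α_ A V X).hom ≫ A ◁ V ◁ f ≫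
      (α_ A V Y).inv ≫ e.hom ▷ Y ≫ (λ_ Y).hom := by
    symm
    calc (λ_ X).inv ≫ e.inv ▷ X ≫ (α_ A V X).hom ≫ A ◁ V ◁ f ≫
          (α_ A V Y).inv ≫ e.hom ▷ Y ≫ (λ_ Y).hom
      _ = (λ_ X).inv ≫ e.inv ▷ X ≫ ((A ⊗ V) ◁ f ≫ e.hom ▷ Y) ≫ (λ_ Y).hom := by monoidal
      _ = (λ_ X).inv ≫ (e.inv ≫ e.hom) ▷ X ≫ 𝟙_ B ◁ f ≫ (λ_ Y).hom := by
        rw [whisker_exchange]; simp only [comp_whiskerRight, Category.assoc]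
      _ = f := by rw [e.inv_hom_id]; monoidal
  rw [key f, key g, h]

lemma whiskerRight_cancel {A V : B} (e : V ⊗ A ≅ 𝟙_ B) {X Y : B} {f g : X ⟶ Y}
    (h : f ▷ V = g ▷ V) : f = g := by
  have key (f : X ⟶ Y) : f = (ρ_ X).inv ≫ X ◁ e.inv ≫ (α_ X V A).inv ≫ f ▷ V ▷ A ≫
      (α_ Y V A).hom ≫ Y ◁ e.hom ≫ (ρ_ Y).hom := by
    symm
    calc (ρ_ X).inv ≫ X ◁ e.inv ≫ (α_ X V A).inv ≫ f ▷ V ▷ A ≫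
          (α_ Y V A).hom ≫ Y ◁ e.hom ≫ (ρ_ Y).hom
      _ = (ρ_ X).inv ≫ X ◁ e.inv ≫ (f ▷ (V ⊗ A) ≫ Y ◁ e.hom) ≫ (ρ_ Y).hom := by monoidal
      _ = (ρ_ X).inv ≫ X ◁ (e.inv ≫ e.hom) ≫ f ▷ 𝟙_ B ≫ (ρ_ Y).hom := by
        rw [← whisker_exchange]; simp only [whiskerLeft_comp, Category.assoc]
      _ = f := by rw [e.inv_hom_id]; monoidal
  rw [key f, key g, h]

end Faithful

namespace RightMod

section Antipode

variable {B : Type u} [Category.{v} B] [MonoidalCategory B] [BraidedCategory B] {H : B}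
  [HopfObj H]

/-- In a free module, acting on the unit of `H` recovers the acting element; so elements with equal
action agree, up to the factor `V`. -/
lemma whiskerLeft_eq_of_act_eq {V Y : B} {k₁ k₂ : Y ⟶ H} {M : RightMod H} (e : M ≅ free H V)
    (h : M.X ◁ k₁ ≫ M.act = M.X ◁ k₂ ≫ M.act) : V ◁ k₁ = V ◁ k₂ := by
  have h1 (k : Y ⟶ H) : (V ⊗ H) ◁ k ≫ (α_ V H H).hom ≫ V ◁ μ[H] =
      e.inv.hom ▷ Y ≫ (M.X ◁ k ≫ M.act) ≫ e.hom.hom := by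
    have h2 : e.inv.hom ≫ e.hom.hom = 𝟙 (V ⊗ H) := congrArg Hom.hom e.inv_hom_id
    simp only [Category.assoc]
    rw [e.hom.comm, whisker_exchange_assoc, ← comp_whiskerRight_assoc]
    exact (((congrArg (· ▷ Y) h2).trans (id_whiskerRight _ _) |> congrArg (· ≫ (V ⊗ H) ◁ k ≫
      (α_ V H H).hom ≫ V ◁ μ[H])).trans (Category.id_comp _)).symm
  have h3 (k : Y ⟶ H) : V ◁ k = 𝟙 _ ⊗≫ (V ◁ η[H]) ▷ Y ≫
      ((V ⊗ H) ◁ k ≫ (α_ V H H).hom ≫ V ◁ μ[H]) := by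
    symm
    calc 𝟙 _ ⊗≫ (V ◁ η[H]) ▷ Y ≫ ((V ⊗ H) ◁ k ≫ (α_ V H H).hom ≫ V ◁ μ[H])
      _ = 𝟙 _ ⊗≫ V ◁ (η[H] ▷ Y ≫ H ◁ k) ≫ V ◁ μ[H] := by monoidal
      _ = 𝟙 _ ⊗≫ V ◁ k ⊗≫ V ◁ (η[H] ▷ H ≫ μ[H]) := by
        rw [← whisker_exchange]; monoidal
      _ = _ := by rw [MonObj.one_mul]; monoidal
  rw [h3 k₁, h3 k₂, h1, h1, h]

/-- The action on the dual of the regular module factors through the antipode, so maps identified by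
it act equally there. That module is free on an object which is invertible and can be cancelled. -/
lemma mono_antipode [HasCoequalizers B] {I : B} {Λ : I ⟶ H} (h : IsUniversalRightIntegral Λ)
    (D : B) [ExactPairing D H] (Vd : B) [ExactPairing (coinv (dual (reg H) D)) Vd] :
    Mono 𝒮[H] where
  right_cancellation {Y} k₁ k₂ e := by
    refine whiskerLeft_cancel (β_ I _ ≪≫ integralInvIso h D Vd)
      (whiskerLeft_eq_of_act_eq (dualRegIso D) ?_)
    change D ◁ k₁ ≫ transposeAct D H (H ◁ 𝒮[H] ≫ μ[H]) =
      D ◁ k₂ ≫ transposeAct D H (H ◁ 𝒮[H] ≫ μ[H])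
    rw [← transposeAct_precomp, ← transposeAct_precomp, ← whiskerLeft_comp_assoc, e,
      ← whiskerLeft_comp_assoc]

end Antipode

section Finite

variable {B : Type u} [Category.{v} B] [Preadditive B] [MonoidalCategory B]
  [MonoidalPreadditive B] [BraidedCategory B] {H : B} [HopfObj H]

lemma exists_integralInvIso (k : Type v) [Field k] [Linear k B] [MonoidalLinear k B]
    [IsFiniteTensorCategory k B] {I : B} {Λ : I ⟶ H} (h : IsUniversalRightIntegral Λ) :
    ∃ V : B, Nonempty (V ⊗ I ≅ 𝟙_ B) := by
  obtain ⟨_⟩ := IsFiniteTensorCategory.rigid (k := k) (C := B)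
  let _ := IsFiniteAbelian.abelian k B
  exact ⟨_, ⟨integralInvIso h (ᘁH) ((coinv (dual (reg H) (ᘁH)))ᘁ)⟩⟩

lemma exists_isTerminal (k : Type v) [Field k] [Linear k B] [MonoidalLinear k B]
    [IsFiniteTensorCategory k B] : ∃ Λ : RightIntegral H, Nonempty (IsTerminal Λ) := by
  obtain ⟨_⟩ := IsFiniteTensorCategory.rigid (k := k) (C := B)
  let _ := IsFiniteAbelian.abelian k B
  exact exists_terminal_rightIntegral H

variable (H) in
-- Postcomposition with the antipode is an injective endomorphism of the finite-dimensional space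
-- `Hom(H, H)`, hence surjective; a preimage of the identity is a section, and a mono with a section
-- is invertible.
lemma isIso_antipode (k : Type v) [Field k] [Linear k B] [MonoidalLinear k B]
    [IsFiniteTensorCategory k B] : IsIso 𝒮[H] := by
  obtain ⟨_⟩ := IsFiniteTensorCategory.rigid (k := k) (C := B)
  let _ := IsFiniteAbelian.abelian k B
  obtain ⟨Λ, ⟨hΛ⟩⟩ := exists_isTerminal k (H := H)
  have : Mono 𝒮[H] :=
    mono_antipode (isUniversalRightIntegral_of_isTerminal hΛ) (ᘁH) ((coinv (dual (reg H) (ᘁH)))ᘁ)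
  have := IsFiniteAbelian.finite_hom k H H
  have hs : Function.Surjective (Linear.rightComp k H 𝒮[H]) :=
    LinearMap.injective_iff_surjective.1 fun f g e => (cancel_mono 𝒮[H]).1 e
  obtain ⟨f, hf⟩ := hs (𝟙 H)
  have hf : f ≫ 𝒮[H] = 𝟙 H := hf
  exact ⟨f, by rw [← cancel_mono 𝒮[H], Category.assoc, hf, Category.id_comp, Category.comp_id], hf⟩

variable (H) in
-- Left duals need only the antipode. A right dual of `M` is a module of which `M` is the left dual,
-- and finding it requires the inverse antipode.
lemma nonempty_rigidCategory (k : Type v) [Field k] [Linear k B] [MonoidalLinear k B]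
    [IsFiniteTensorCategory k B] : Nonempty (RigidCategory (RightMod H)) := by
  obtain ⟨_⟩ := IsFiniteTensorCategory.rigid (k := k) (C := B)
  have := isIso_antipode H k
  have hr (M : RightMod H) : Nonempty (HasRightDual M) := by
    obtain ⟨Q, hQ, e⟩ := exists_dual_eq M (M.Xᘁ)
    have p : ExactPairing (dual Q M.X) Q := dualPairing Q M.X
    rw [← e] at p
    exact ⟨⟨Q⟩⟩
  have hl (M : RightMod H) : HasLeftDual M :=
    letI := dualPairing M (ᘁM.X)
    ⟨dual M (ᘁM.X)⟩
  exact ⟨{ rightDual := fun M => (hr M).some, leftDual := hl }⟩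

variable (H) in
lemma isFiniteTensorCategory (k : Type v) [Field k] [Linear k B] [MonoidalLinear k B]
    [IsFiniteTensorCategory k B] : IsFiniteTensorCategory k (RightMod H) where
  toIsFiniteAbelian := RightMod.isFiniteAbelian H
  rigid := nonempty_rigidCategory H k

end Finite

end RightMod

/-! ### The modular function, left integrals and characters. -/

open ExactPairing
open scoped MonObj ComonObj HopfObj

/-- Tensoring with an invertible object is full: `f` is `b ▷ A` with `V ⊗ A` contracted, and
faithfulness of tensoring with `A` confirms it. The two isomorphisms need not be compatible. -/
lemma exists_whiskerRight_eq {B : Type u} [Category.{v} B] [MonoidalCategory B] {A V : B}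
    (e : V ⊗ A ≅ 𝟙_ B) (e' : A ⊗ V ≅ 𝟙_ B) {X Y : B} (b : X ⊗ V ⟶ Y ⊗ V) :
    ∃ f : X ⟶ Y, f ▷ V = b := by
  let i (Z : B) : (Z ⊗ V) ⊗ A ≅ Z := α_ Z V A ≪≫ whiskerLeftIso Z e ≪≫ ρ_ Z
  have hi {Z Z' : B} (f : Z ⟶ Z') : f ▷ V ▷ A ≫ (i Z').hom = (i Z).hom ≫ f := by
    simp only [i, Iso.trans_hom, whiskerLeftIso_hom, Category.assoc]
    rw [associator_naturality_left_assoc, ← whisker_exchange_assoc, rightUnitor_naturality]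
  refine ⟨(i X).inv ≫ b ▷ A ≫ (i Y).hom, whiskerRight_cancel e' ?_⟩
  rw [← cancel_mono (i Y).hom, hi, Iso.hom_inv_id_assoc]

section Integrals

variable {B : Type u} [Category.{v} B] [MonoidalCategory B] [BraidedCategory B] {H : B}

section ModularFunction

variable [BimonObj H] {I : B} {Λ : I ⟶ H}

/-- By associativity `h Λ` is again a right integral, so it factors through `Λ` by a map `H ⊗ I ⟶
I`. Since `I` is invertible, that map comes from a unique `χ : H ⟶ 𝟙_`. -/
lemma IsUniversalRightIntegral.existsUnique_modularFunction (h : IsUniversalRightIntegral Λ)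
    {V : B} (e : V ⊗ I ≅ 𝟙_ B) :
    ∃! χ : H ⟶ 𝟙_ B, χ ▷ I ≫ (λ_ I).hom ≫ Λ = H ◁ Λ ≫ μ[H] := by
  have := h.mono
  have hi : (H ◁ Λ ≫ μ[H]) ▷ H ≫ μ[H] = (H ◁ Λ ≫ μ[H]) ▷ H ≫ H ◁ ε[H] ≫ (ρ_ H).hom := by
    have h1 := h.mul_eq
    calc (H ◁ Λ ≫ μ[H]) ▷ H ≫ μ[H]
      _ = 𝟙 _ ⊗≫ H ◁ Λ ▷ H ⊗≫ (μ[H] ▷ H ≫ μ[H]) := by monoidal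
      _ = 𝟙 _ ⊗≫ H ◁ (Λ ▷ H ≫ μ[H]) ≫ μ[H] := by rw [MonObj.mul_assoc]; monoidal
      _ = 𝟙 _ ⊗≫ H ◁ Λ ▷ H ⊗≫ ((H ⊗ H) ◁ ε[H] ≫ μ[H] ▷ 𝟙_ B) ⊗≫ 𝟙 _ := by
        rw [h1]; monoidal
      _ = _ := by rw [whisker_exchange]; monoidal
  obtain ⟨b, hb, -⟩ := h.existsUnique_lift _ hi
  obtain ⟨χ, hχ⟩ := exists_whiskerRight_eq (β_ I V ≪≫ e) e (b ≫ (λ_ I).inv)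
  refine ⟨χ, ?_, fun χ' h' => whiskerRight_cancel (β_ I V ≪≫ e) ?_⟩
  · change χ ▷ I ≫ (λ_ I).hom ≫ Λ = _
    rw [hχ, Category.assoc, Iso.inv_hom_id_assoc, hb]
  · have h' : χ' ▷ I ≫ (λ_ I).hom ≫ Λ = H ◁ Λ ≫ μ[H] := h'
    rw [← cancel_mono ((λ_ I).hom ≫ Λ), h', hχ, Category.assoc, Iso.inv_hom_id_assoc, hb]

/-- After tensoring with `I` and composing with the mono `Λ`, the laws for `χ` become the unit law
and associativity of multiplication applied to `Λ`. -/
lemma IsUniversalRightIntegral.isMonHom (h : IsUniversalRightIntegral Λ)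
    {V : B} (e : V ⊗ I ≅ 𝟙_ B) {χ : H ⟶ 𝟙_ B}
    (hχ : χ ▷ I ≫ (λ_ I).hom ≫ Λ = H ◁ Λ ≫ μ[H]) : IsMonHom χ := by
  have := h.mono
  constructor
  · refine whiskerRight_cancel (β_ I V ≪≫ e) ?_
    rw [← cancel_mono ((λ_ I).hom ≫ Λ), comp_whiskerRight, Category.assoc, hχ,
      ← whisker_exchange_assoc, MonObj.one_mul]
    simp
  · refine whiskerRight_cancel (β_ I V ≪≫ e) ?_
    rw [← cancel_mono ((λ_ I).hom ≫ Λ), comp_whiskerRight, Category.assoc, hχ]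
    calc μ[H] ▷ I ≫ H ◁ Λ ≫ μ[H]
      _ = (H ⊗ H) ◁ Λ ≫ μ[H] ▷ H ≫ μ[H] := by rw [whisker_exchange_assoc]
      _ = 𝟙 _ ⊗≫ H ◁ (H ◁ Λ ≫ μ[H]) ≫ μ[H] := by rw [MonObj.mul_assoc]; monoidal
      _ = 𝟙 _ ⊗≫ H ◁ χ ▷ I ⊗≫ (H ◁ Λ ≫ μ[H]) := by
        rw [show H ◁ (H ◁ Λ ≫ μ[H]) = _ from congrArg (H ◁ ·) hχ.symm]; monoidal
      _ = 𝟙 _ ⊗≫ (H ◁ χ ≫ χ ▷ 𝟙_ B) ▷ I ⊗≫ Λ := by rw [← hχ]; monoidal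
      _ = ((χ ⊗ₘ χ) ≫ (λ_ (𝟙_ B)).hom) ▷ I ≫ (λ_ I).hom ≫ Λ := by
        rw [MonoidalCategory.tensorHom_def']; monoidal

end ModularFunction

section LeftIntegral

/-- The property of being a universal left integral. -/
structure IsUniversalLeftIntegral [BimonObj H] {I : B} (Γ : I ⟶ H) : Prop where
  mul_eq : H ◁ Γ ≫ μ[H] = ε[H] ▷ I ≫ (λ_ I).hom ≫ Γ
  existsUnique_lift : ∀ {X : B} (t : X ⟶ H),
    H ◁ t ≫ μ[H] = ε[H] ▷ X ≫ (λ_ X).hom ≫ t → ∃! l : X ⟶ I, l ≫ Γ = t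

section Bimon

variable [BimonObj H] {I : B} {Γ : I ⟶ H}

/-- The universal property of the universal left integral, tensored with a dualizable object. -/
lemma IsUniversalLeftIntegral.existsUnique_lift_whiskerRight (h : IsUniversalLeftIntegral Γ)
    (X' X : B) [ExactPairing X' X] {A : B} (f : A ⟶ H ⊗ X)
    (hf : H ◁ f ≫ (α_ H H X).inv ≫ μ[H] ▷ X = ε[H] ▷ A ≫ (λ_ A).hom ≫ f) :
    ∃! l : A ⟶ I ⊗ X, l ≫ Γ ▷ X = f := by
  let T (Z : B) := tensorRightHomEquiv A X' X Z
  have key : H ◁ (T H).symm f ≫ μ[H] = ε[H] ▷ (A ⊗ X') ≫ (λ_ (A ⊗ X')).hom ≫ (T H).symm f := by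
    simp only [T, tensorRightHomEquiv, Equiv.coe_fn_symm_mk]
    calc H ◁ (f ▷ X' ≫ (α_ H X X').hom ≫ H ◁ ε_ X' X ≫ (ρ_ H).hom) ≫ μ[H]
      _ = 𝟙 _ ⊗≫ H ◁ f ▷ X' ⊗≫ ((H ⊗ H) ◁ ε_ X' X ≫ μ[H] ▷ 𝟙_ B) ⊗≫ 𝟙 _ := by monoidal
      _ = 𝟙 _ ⊗≫ (H ◁ f ≫ (α_ H H X).inv ≫ μ[H] ▷ X) ▷ X' ⊗≫ H ◁ ε_ X' X ⊗≫ 𝟙 _ := by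
        rw [whisker_exchange]; monoidal
      _ = _ := by rw [hf]; monoidal
  obtain ⟨l, hl, hu⟩ := h.existsUnique_lift _ key
  refine ⟨T I l, ?_, fun l' hl' => ?_⟩
  · change T I l ≫ Γ ▷ X = f
    rw [← tensorRightHomEquiv_naturality, hl, Equiv.apply_symm_apply]
  · rw [← Equiv.symm_apply_eq]
    apply hu
    change (T I).symm l' ≫ Γ = (T H).symm f
    rw [← hl', Equiv.eq_symm_apply, tensorRightHomEquiv_naturality, Equiv.apply_symm_apply]

lemma IsUniversalLeftIntegral.whiskerRight_mul_eq (h : IsUniversalLeftIntegral Γ)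
    {X A : B} (l : A ⟶ I ⊗ X) :
    H ◁ (l ≫ Γ ▷ X) ≫ (α_ H H X).inv ≫ μ[H] ▷ X = ε[H] ▷ A ≫ (λ_ A).hom ≫ l ≫ Γ ▷ X := by
  have h1 := h.mul_eq
  calc H ◁ (l ≫ Γ ▷ X) ≫ (α_ H H X).inv ≫ μ[H] ▷ X
    _ = H ◁ l ⊗≫ (H ◁ Γ ≫ μ[H]) ▷ X := by monoidal
    _ = (H ◁ l ≫ ε[H] ▷ (I ⊗ X)) ⊗≫ Γ ▷ X := by rw [h1]; monoidal
    _ = _ := by rw [whisker_exchange]; monoidal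

lemma IsUniversalLeftIntegral.mono_whiskerRight (h : IsUniversalLeftIntegral Γ)
    (X' X : B) [ExactPairing X' X] : Mono (Γ ▷ X) where
  right_cancellation _ g e :=
    (h.existsUnique_lift_whiskerRight X' X _ (h.whiskerRight_mul_eq g)).unique e rfl

end Bimon

variable [HopfObj H] {I : B} {Λ : I ⟶ H}

lemma mul_comp_antipode {X Y : B} (f : X ⟶ H) (g : Y ⟶ H) :
    (f ⊗ₘ g) ≫ μ[H] ≫ 𝒮[H] = (β_ X Y).hom ≫ ((g ≫ 𝒮[H]) ⊗ₘ (f ≫ 𝒮[H])) ≫ μ[H] := by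
  rw [HopfObj.mul_antipode, tensorHom_comp_tensorHom_assoc,
    BraidedCategory.braiding_naturality_assoc]

/-- An invertible anti-multiplicative map exchanges right and left integrals, universality included.
-/
lemma IsUniversalRightIntegral.isUniversalLeftIntegral [IsIso 𝒮[H]]
    (h : IsUniversalRightIntegral Λ) : IsUniversalLeftIntegral (Λ ≫ 𝒮[H]) where
  mul_eq := by
    rw [← cancel_epi (𝒮[H] ▷ I), ← cancel_epi (β_ I H).hom]
    have h1 := mul_comp_antipode Λ (𝟙 H)
    rw [Category.id_comp, MonoidalCategory.tensorHom_def, MonoidalCategory.tensorHom_def,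
      whiskerLeft_id, Category.comp_id] at h1
    rw [Category.assoc] at h1
    rw [← h1, ← Category.assoc, h.mul_eq]
    rw [← comp_whiskerRight_assoc, HopfObj.antipode_counit]
    rw [← BraidedCategory.braiding_naturality_right_assoc, braiding_tensorUnit_right]
    simp only [Category.assoc]
    rw [← whisker_exchange_assoc]
    simp
  existsUnique_lift {X} t ht := by
    have hs : (t ≫ inv 𝒮[H]) ▷ H ≫ μ[H] =
        (t ≫ inv 𝒮[H]) ▷ H ≫ H ◁ ε[H] ≫ (ρ_ H).hom := by
      rw [← cancel_mono 𝒮[H]]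
      have h1 := mul_comp_antipode (t ≫ inv 𝒮[H]) (𝟙 H)
      rw [Category.id_comp, MonoidalCategory.tensorHom_def, MonoidalCategory.tensorHom_def,
        whiskerLeft_id, Category.comp_id] at h1
      simp only [Category.assoc, IsIso.inv_hom_id, Category.comp_id] at h1 ⊢
      rw [h1, ht, ← comp_whiskerRight_assoc, HopfObj.antipode_counit,
        ← BraidedCategory.braiding_naturality_right_assoc, braiding_tensorUnit_right,
        ← whisker_exchange_assoc]
      simp
    obtain ⟨l, hl, hu⟩ := h.existsUnique_lift _ hs
    refine ⟨l, ?_, fun l' hl' => hu l' ?_⟩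
    · change l ≫ Λ ≫ 𝒮[H] = t
      rw [reassoc_of% hl]; simp
    · change l' ≫ Λ = _
      rw [← hl']; simp

/-- The inverse antipode is anti-multiplicative for the inverse braiding, and the braiding is
trivial on `𝟙_`, where characters take values. -/
lemma isMonHom_inv_antipode_comp [IsIso 𝒮[H]] (χ : H ⟶ 𝟙_ B) [IsMonHom χ] :
    IsMonHom (inv 𝒮[H] ≫ χ) where
  one_hom := by
    have h1 : η[H] ≫ χ = 𝟙 (𝟙_ B) := IsMonHom.one_hom χ
    have h2 : η[H] ≫ inv 𝒮[H] = η[H] := by rw [IsIso.comp_inv_eq, HopfObj.one_antipode]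
    rw [reassoc_of% h2, h1]; rfl
  mul_hom := by
    have h1 : μ[H] ≫ χ = (χ ⊗ₘ χ) ≫ (λ_ (𝟙_ B)).hom := IsMonHom.mul_hom χ
    have h2 : μ[H] ≫ inv 𝒮[H] = (β_ H H).inv ≫ (inv 𝒮[H] ⊗ₘ inv 𝒮[H]) ≫ μ[H] := by
      rw [IsIso.comp_inv_eq, Category.assoc, Category.assoc, mul_comp_antipode]
      simp
    rw [reassoc_of% h2, h1, tensorHom_comp_tensorHom_assoc,
      ← BraidedCategory.braiding_inv_naturality_assoc]
    simp [unitors_equal]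

/-- Applying the antipode to `h Λ = χ(h) Λ` gives `S(Λ) S(h) = χ(h) S(Λ)`, up to braiding; the
inverse antipode then replaces `S(h)` by an arbitrary argument. -/
lemma IsUniversalRightIntegral.antipode_mul_eq [IsIso 𝒮[H]]
    {χ : H ⟶ 𝟙_ B} (hχ : χ ▷ I ≫ (λ_ I).hom ≫ Λ = H ◁ Λ ≫ μ[H]) :
    (Λ ≫ 𝒮[H]) ▷ H ≫ μ[H] = I ◁ (inv 𝒮[H] ≫ χ) ≫ (ρ_ I).hom ≫ Λ ≫ 𝒮[H] := by
  rw [← cancel_epi (I ◁ 𝒮[H]), ← cancel_epi (β_ H I).hom]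
  have h1 := mul_comp_antipode (𝟙 H) Λ
  rw [Category.id_comp, MonoidalCategory.tensorHom_def', MonoidalCategory.tensorHom_def',
    id_whiskerRight, Category.comp_id] at h1
  rw [Category.assoc] at h1
  rw [← h1, ← whiskerLeft_comp_assoc, IsIso.hom_inv_id_assoc,
    ← BraidedCategory.braiding_naturality_left_assoc, braiding_tensorUnit_left,
    ← reassoc_of% hχ]
  simp

end LeftIntegral

namespace RightMod

section Char

variable [HopfObj H]

/-- A multiplicative `χ` carries the antipode identity to `𝟙_`, so `χ ∘ S` is the convolution
inverse of `χ`. -/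
lemma char_convolution (χ : H ⟶ 𝟙_ B) [IsMonHom χ] :
    Δ[H] ≫ (χ ⊗ₘ (𝒮[H] ≫ χ)) ≫ (λ_ (𝟙_ B)).hom = ε[H] := by
  have h1 : μ[H] ≫ χ = (χ ⊗ₘ χ) ≫ (λ_ (𝟙_ B)).hom := IsMonHom.mul_hom χ
  have h2 : η[H] ≫ χ = 𝟙 (𝟙_ B) := IsMonHom.one_hom χ
  have h3 : (χ ⊗ₘ (𝒮[H] ≫ χ)) = H ◁ 𝒮[H] ≫ (χ ⊗ₘ χ) := by
    rw [← id_tensorHom, tensorHom_comp_tensorHom, Category.id_comp]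
  rw [h3, Category.assoc, ← h1, HopfObj.antipode_right_assoc, h2, Category.comp_id]

lemma char_convolution' (χ : H ⟶ 𝟙_ B) [IsMonHom χ] :
    Δ[H] ≫ ((𝒮[H] ≫ χ) ⊗ₘ χ) ≫ (λ_ (𝟙_ B)).hom = ε[H] := by
  have h1 : μ[H] ≫ χ = (χ ⊗ₘ χ) ≫ (λ_ (𝟙_ B)).hom := IsMonHom.mul_hom χ
  have h2 : η[H] ≫ χ = 𝟙 (𝟙_ B) := IsMonHom.one_hom χ
  have h3 : ((𝒮[H] ≫ χ) ⊗ₘ χ) = 𝒮[H] ▷ H ≫ (χ ⊗ₘ χ) := by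
    rw [← tensorHom_id, tensorHom_comp_tensorHom, Category.id_comp]
  rw [h3, Category.assoc, ← h1, HopfObj.antipode_left_assoc, h2, Category.comp_id]

lemma char_tens_comm (χ ψ : H ⟶ 𝟙_ B) (h : Δ[H] ≫ (χ ⊗ₘ ψ) ≫ (λ_ (𝟙_ B)).hom = ε[H]) :
    ((𝟙_ B ⊗ 𝟙_ B) ◁ Δ[H] ≫ tensorμ (𝟙_ B) (𝟙_ B) H H ≫
      (((λ_ H).hom ≫ χ) ⊗ₘ ((λ_ H).hom ≫ ψ))) ≫ (λ_ (𝟙_ B)).hom =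
    (λ_ (𝟙_ B)).hom ▷ H ≫ 𝟙_ B ◁ ε[H] ≫ (ρ_ (𝟙_ B)).hom := by
  rw [← h, ← tensorHom_comp_tensorHom]
  simp only [tensorμ, braiding_tensorUnit_left]
  rw [MonoidalCategory.tensorHom_def χ ψ]
  monoidal

variable (χ ψ : H ⟶ 𝟙_ B) [IsMonHom χ] [IsMonHom ψ]

/-- Mutually inverse characters tensor to the unit. -/
def ofCharTensIso (h : Δ[H] ≫ (χ ⊗ₘ ψ) ≫ (λ_ (𝟙_ B)).hom = ε[H]) :
    ofChar χ ⊗ ofChar ψ ≅ 𝟙_ (RightMod H) :=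
  isoMk (λ_ (𝟙_ B)) (char_tens_comm χ ψ h)

/-- Mutually inverse characters are dual to each other. -/
@[reducible]
def ofCharPairing (h : Δ[H] ≫ (χ ⊗ₘ ψ) ≫ (λ_ (𝟙_ B)).hom = ε[H])
    (h' : Δ[H] ≫ (ψ ⊗ₘ χ) ≫ (λ_ (𝟙_ B)).hom = ε[H]) :
    ExactPairing (ofChar χ) (ofChar ψ) where
  coevaluation' := (ofCharTensIso χ ψ h).inv
  evaluation' := (ofCharTensIso ψ χ h').hom
  coevaluation_evaluation' := hom_ext (by
    change 𝟙_ B ◁ (λ_ (𝟙_ B)).inv ≫ (α_ (𝟙_ B) (𝟙_ B) (𝟙_ B)).inv ≫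
      (λ_ (𝟙_ B)).hom ▷ 𝟙_ B = (ρ_ (𝟙_ B)).hom ≫ (λ_ (𝟙_ B)).inv
    monoidal)
  evaluation_coevaluation' := hom_ext (by
    change (λ_ (𝟙_ B)).inv ▷ 𝟙_ B ≫ (α_ (𝟙_ B) (𝟙_ B) (𝟙_ B)).hom ≫
      𝟙_ B ◁ (λ_ (𝟙_ B)).hom = (λ_ (𝟙_ B)).hom ≫ (ρ_ (𝟙_ B)).inv
    monoidal)

end Char

section Triv

variable [BimonObj H]

/-- The functor of trivial modules is monoidal. -/
def trivTensIso (V W : B) : triv H V ⊗ triv H W ≅ triv H (V ⊗ W) :=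
  isoMk (Iso.refl (V ⊗ W)) (by
    have h : ((α_ V W H).hom ≫ V ◁ (W ◁ ε[H] ≫ (ρ_ W).hom)) ≫ 𝟙 (V ⊗ W) =
        𝟙 (V ⊗ W) ▷ H ≫ (V ⊗ W) ◁ ε[H] ≫ (ρ_ (V ⊗ W)).hom := by monoidal
    exact (congrArg (· ≫ 𝟙 (V ⊗ W)) (triv_tens_act V (triv H W))).trans h)

/-- Trivial modules of dual objects are dual. -/
@[reducible]
def trivPairing (V W : B) [ExactPairing V W] : ExactPairing (triv H V) (triv H W) where
  coevaluation' := trivMap H (η_ V W) ≫ (trivTensIso V W).inv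
  evaluation' := (trivTensIso W V).hom ≫ trivMap H (ε_ V W)
  coevaluation_evaluation' := hom_ext (by
    change W ◁ (η_ V W ≫ 𝟙 (V ⊗ W)) ≫ (α_ W V W).inv ≫ (𝟙 (W ⊗ V) ≫ ε_ V W) ▷ W =
      (ρ_ W).hom ≫ (λ_ W).inv
    rw [Category.comp_id, Category.id_comp, coevaluation_evaluation])
  evaluation_coevaluation' := hom_ext (by
    change (η_ V W ≫ 𝟙 (V ⊗ W)) ▷ V ≫ (α_ V W V).hom ≫ V ◁ (𝟙 (W ⊗ V) ≫ ε_ V W) =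
      (λ_ V).hom ≫ (ρ_ V).inv
    rw [Category.comp_id, Category.id_comp, evaluation_coevaluation])

end Triv

end RightMod

end Integrals

/-! ### Left invariant morphisms into `H ⊗ X` and the object representing them. -/

open ExactPairing
open scoped MonObj ComonObj HopfObj

section LeftInvariant

variable {B : Type u} [Category.{v} B] [MonoidalCategory B] [BraidedCategory B] {H : B}

/-- Invariance of a morphism into `H ⊗ X` under left multiplication by `H`. -/
def IsLeftInvariant [BimonObj H] {A X : B} (g : A ⟶ H ⊗ X) : Prop :=
  H ◁ g ≫ (α_ H H X).inv ≫ μ[H] ▷ X = ε[H] ▷ A ≫ (λ_ A).hom ≫ g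

lemma IsUniversalLeftIntegral.isLeftInvariant [BimonObj H] {I : B} {Γ : I ⟶ H}
    (h : IsUniversalLeftIntegral Γ) {A X : B} (l : A ⟶ 𝟙_ B ⊗ I ⊗ X) :
    IsLeftInvariant (l ≫ (α_ (𝟙_ B) I X).inv ≫ ((λ_ I).hom ≫ Γ) ▷ X) := by
  have e : l ≫ (α_ (𝟙_ B) I X).inv ≫ ((λ_ I).hom ≫ Γ) ▷ X =
      (l ≫ (λ_ (I ⊗ X)).hom) ≫ Γ ▷ X := by monoidal
  rw [e]
  exact h.whiskerRight_mul_eq _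

namespace RightMod

variable [HopfObj H] {I : B} {Λ : I ⟶ H}

/-- An eigenvector of right multiplication, as a morphism of modules. -/
def eigenHom (ψ : H ⟶ 𝟙_ B) [IsMonHom ψ] (Γ : I ⟶ H) (hΓ : Γ ▷ H ≫ μ[H] = I ◁ ψ ≫ (ρ_ I).hom ≫ Γ) :
    ofChar ψ ⊗ triv H I ⟶ reg H where
  hom := (λ_ I).hom ≫ Γ
  comm := by
    have h : ((α_ (𝟙_ B) I H).hom ≫ 𝟙_ B ◁ (β_ I H).hom ≫ (α_ (𝟙_ B) H I).inv ≫
        ((λ_ H).hom ≫ ψ) ▷ I) ≫ (λ_ I).hom ≫ Γ = ((λ_ I).hom ≫ Γ) ▷ H ≫ μ[H] := by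
      calc ((α_ (𝟙_ B) I H).hom ≫ 𝟙_ B ◁ (β_ I H).hom ≫ (α_ (𝟙_ B) H I).inv ≫
          ((λ_ H).hom ≫ ψ) ▷ I) ≫ (λ_ I).hom ≫ Γ
        _ = 𝟙 _ ⊗≫ ((β_ I H).hom ≫ ψ ▷ I) ⊗≫ Γ := by monoidal
        _ = 𝟙 _ ⊗≫ (I ◁ ψ ≫ (ρ_ I).hom ≫ Γ) := by
          rw [← BraidedCategory.braiding_naturality_right, braiding_tensorUnit_right]; monoidal
        _ = _ := by rw [← hΓ]; monoidal
    exact (congrArg (· ≫ (λ_ I).hom ≫ Γ) (tens_triv_act (ofChar ψ) I)).trans h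

/-- The factorization exists in `B` by universality of `Γ`. It is automatically linear, because the
map it factors through is a module map with monic underlying morphism. -/
lemma existsUnique_hom_of_isLeftInvariant {ψ : H ⟶ 𝟙_ B} [IsMonHom ψ] {Γ : I ⟶ H}
    (h : IsUniversalLeftIntegral Γ) (hΓ : Γ ▷ H ≫ μ[H] = I ◁ ψ ≫ (ρ_ I).hom ≫ Γ)
    {W X : RightMod H} (X' : B) [ExactPairing X' X.X] (g : W ⟶ reg H ⊗ X)
    (hg : IsLeftInvariant g.hom) :
    ∃! l : W ⟶ ofChar ψ ⊗ triv H I ⊗ X, l ≫ (α_ _ _ _).inv ≫ eigenHom ψ Γ hΓ ▷ X = g := by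
  have := h.mono_whiskerRight X' X.X
  have e2 (l : W.X ⟶ I ⊗ X.X) : (l ≫ (λ_ (I ⊗ X.X)).inv) ≫ (α_ (𝟙_ B) I X.X).inv ≫
      ((λ_ I).hom ≫ Γ) ▷ X.X = l ≫ Γ ▷ X.X := by monoidal
  have hm : Mono ((α_ (𝟙_ B) I X.X).inv ≫ ((λ_ I).hom ≫ Γ) ▷ X.X) := by
    rw [comp_whiskerRight]; infer_instance
  obtain ⟨l, hl, hu⟩ := h.existsUnique_lift_whiskerRight X' X.X g.hom hg
  have hl : l ≫ Γ ▷ X.X = g.hom := hl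
  let m : ofChar ψ ⊗ triv H I ⊗ X ⟶ reg H ⊗ X := (α_ _ _ _).inv ≫ eigenHom ψ Γ hΓ ▷ X
  have : Mono m.hom := hm
  refine ⟨homOfMono m g (l ≫ (λ_ (I ⊗ X.X)).inv) ?_, hom_ext ?_, fun l' hl' => ?_⟩
  · exact (e2 l).trans hl
  · exact (e2 l).trans hl
  · apply hom_ext
    rw [← cancel_mono m.hom]
    have h1 : l'.hom ≫ m.hom = g.hom := congrArg Hom.hom hl'
    exact h1.trans ((e2 l).trans hl).symm

/-- Left invariant module maps `W ⟶ H ⊗ X` are module maps `W ⟶ ψ ⊗ I ⊗ X`; since `ψ` and `I` are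
dualizable, the latter are represented by `I' ⊗ χ ⊗ W`. -/
lemma exists_universal_isLeftInvariant [IsIso 𝒮[H]] (h : IsUniversalRightIntegral Λ)
    {χ : H ⟶ 𝟙_ B} [IsMonHom χ] (hχ : χ ▷ I ≫ (λ_ I).hom ≫ Λ = H ◁ Λ ≫ μ[H])
    (I' : B) [ExactPairing I I'] [LeftRigidCategory B] (W : RightMod H) :
    ∃ w : W ⟶ reg H ⊗ (triv H I' ⊗ ofChar χ ⊗ W), IsLeftInvariant w.hom ∧
      ∀ (X : RightMod H) (g : W ⟶ reg H ⊗ X), IsLeftInvariant g.hom →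
        ∃! f : triv H I' ⊗ ofChar χ ⊗ W ⟶ X, w ≫ reg H ◁ f = g := by
  -- The eigencharacter of the left integral. Its convolution inverse `𝒮[H] ≫ ψ` is `χ` itself, so
  -- the dual of `ofChar ψ` is `ofChar χ`.
  let ψ := inv 𝒮[H] ≫ χ
  have : IsMonHom ψ := isMonHom_inv_antipode_comp χ
  have hψ : 𝒮[H] ≫ ψ = χ := by simp [ψ]
  let _ : ExactPairing (ofChar ψ) (ofChar χ) := ofCharPairing ψ χ
    (by rw [← hψ]; exact char_convolution ψ) (by rw [← hψ]; exact char_convolution' ψ)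
  let _ : ExactPairing (triv H I) (triv H I') := trivPairing I I'
  have hL := h.isUniversalLeftIntegral
  have hΓ := IsUniversalRightIntegral.antipode_mul_eq hχ
  let m (X : RightMod H) : ofChar ψ ⊗ triv H I ⊗ X ⟶ reg H ⊗ X :=
    (α_ _ _ _).inv ≫ eigenHom ψ (Λ ≫ 𝒮[H]) hΓ ▷ X
  let T (X : RightMod H) : (triv H I' ⊗ ofChar χ ⊗ W ⟶ X) ≃ (W ⟶ ofChar ψ ⊗ triv H I ⊗ X) :=
    (tensorLeftHomEquiv _ (triv H I) (triv H I') X).trans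
      (tensorLeftHomEquiv _ (ofChar ψ) (ofChar χ) _)
  let w := T _ (𝟙 _) ≫ m _
  have hw {X : RightMod H} (f : triv H I' ⊗ ofChar χ ⊗ W ⟶ X) : w ≫ reg H ◁ f = T X f ≫ m X := by
    have h1 : T X f = T _ (𝟙 _) ≫ ofChar ψ ◁ triv H I ◁ f := by
      simp only [T, Equiv.trans_apply]
      rw [← tensorLeftHomEquiv_naturality, ← tensorLeftHomEquiv_naturality, Category.id_comp]
    have h2 : m _ ≫ reg H ◁ f = ofChar ψ ◁ triv H I ◁ f ≫ m X := by
      simp only [m, Category.assoc]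
      rw [← whisker_exchange, associator_inv_naturality_right_assoc]
    rw [h1, Category.assoc, h2, Category.assoc]
  refine ⟨w, ?_, fun X g hg => ?_⟩
  · exact hL.isLeftInvariant (T _ (𝟙 _)).hom
  · obtain ⟨l, hl, hu⟩ := existsUnique_hom_of_isLeftInvariant hL hΓ (ᘁX.X) g hg
    refine ⟨(T X).symm l, ?_, fun f hf => ?_⟩
    · exact (hw _).trans (((T X).apply_symm_apply l).symm ▸ hl)
    · rw [Equiv.eq_symm_apply]
      exact hu _ ((hw f).symm.trans hf)

end RightMod

end LeftInvariant

/-! ### The functor `J` on free modules. -/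

open scoped MonObj ComonObj

section Copower

variable (k : Type v) [Field k] {C : Type u} [Category.{v} C] [Preadditive C] [Linear k C]
  [IsFiniteAbelian k C] (M : C) (V : FGModuleCat.{v} k)

lemma copowerι_π (i j : Fin (Module.finrank k V)) :
    copowerι k M V i ≫ copowerπ k M V j = if i = j then 𝟙 M else 0 := by
  have := IsFiniteAbelian.hasFiniteBiproducts k C
  split_ifs with h
  · subst h; exact biproduct.ι_π_self _ _
  · exact biproduct.ι_π_ne _ h

lemma sum_copowerπ_ι :
    ∑ i, copowerπ k M V i ≫ copowerι k M V i = 𝟙 (copowerObj k M V) := by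
  have := IsFiniteAbelian.hasFiniteBiproducts k C
  exact biproduct.total

/-- The morphism `M ⟶ V • M` given by an element of `V`. -/
noncomputable def copowerIn : V →ₗ[k] (M ⟶ copowerObj k M V) :=
  copowerLinEquiv k M V _ (𝟙 _)

lemma copowerIn_basis (i : Fin (Module.finrank k V)) :
    copowerIn k M V (Module.finBasis k V i) = copowerι k M V i := by
  simp [copowerIn, copowerLinEquiv]

variable {k M V} in
lemma copowerIn_hom_ext {Y : C} {f g : copowerObj k M V ⟶ Y}
    (h : ∀ v, copowerIn k M V v ≫ f = copowerIn k M V v ≫ g) : f = g :=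
  copower_hom_ext_from fun i => by
    rw [← copowerIn_basis]; exact h _

lemma copowerIn_comp {Y : C} (f : copowerObj k M V ⟶ Y) (v : V) :
    copowerIn k M V v ≫ f = copowerLinEquiv k M V Y f v := by
  have := copowerLinEquiv_naturality k M V _ _ f (𝟙 _)
  rw [Category.id_comp] at this
  rw [this]
  rfl

lemma copowerIn_desc {Y : C} (φ : V →ₗ[k] (M ⟶ Y)) (v : V) :
    copowerIn k M V v ≫ (copowerLinEquiv k M V Y).symm φ = φ v := by
  rw [copowerIn_comp, Equiv.apply_symm_apply]

lemma copowerIn_map {V W : FGModuleCat.{v} k} (f : V ⟶ W) (v : V) :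
    copowerIn k M V v ≫ (copower k M).map f = copowerIn k M W (f.hom.hom v) := by
  have h : copowerEquiv k M V _ ((copower k M).map f) = f ≫ copowerEquiv k M W _ (𝟙 _) :=
    Equiv.apply_symm_apply _ _
  exact (copowerIn_comp k M V _ v).trans
    (congrArg (fun t : V ⟶ (homFunctor k M).obj _ => t.hom.hom v) h)

end Copower

namespace RightMod

variable {k : Type v} [Field k] {B : Type u} [Category.{v} B] [Preadditive B]
  [Linear k B] [MonoidalCategory B] [MonoidalPreadditive B] [MonoidalLinear k B]
  [BraidedCategory B] [IsFiniteTensorCategory k B] {H : B} [BimonObj H]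
  [IsFiniteAbelian k (RightMod H)]

variable (k H) in
/-- The functor of trivial modules commutes with copowers of the unit object. -/
lemma exists_copowerTriv (V : FGModuleCat.{v} k) :
    ∃ c : copowerObj k (𝟙_ (RightMod H)) V ≅ triv H (copowerObj k (𝟙_ B) V),
      ∀ v : V, (copowerIn k (𝟙_ (RightMod H)) V v ≫ c.hom).hom = copowerIn k (𝟙_ B) V v := by
  let φ : V →ₗ[k] (𝟙_ (RightMod H) ⟶ triv H (copowerObj k (𝟙_ B) V)) :=
    { toFun := fun v => trivMap H (copowerIn k (𝟙_ B) V v)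
      map_add' := fun v w => hom_ext (map_add _ v w)
      map_smul' := fun r v => hom_ext (map_smul _ r v) }
  let p (i) : triv H (copowerObj k (𝟙_ B) V) ⟶ 𝟙_ (RightMod H) :=
    trivMap H (copowerπ k (𝟙_ B) V i)
  let q (i) : 𝟙_ (RightMod H) ⟶ triv H (copowerObj k (𝟙_ B) V) :=
    trivMap H (copowerι k (𝟙_ B) V i)
  have hq (i) : copowerι k (𝟙_ (RightMod H)) V i ≫
      (copowerLinEquiv k (𝟙_ (RightMod H)) V _).symm φ = q i := by
    rw [← copowerIn_basis, copowerIn_desc]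
    exact hom_ext (copowerIn_basis k (𝟙_ B) V i)
  refine ⟨⟨(copowerLinEquiv k (𝟙_ (RightMod H)) V _).symm φ, copowerLift k _ V p, ?_, ?_⟩, ?_⟩
  · apply copower_hom_ext_from
    intro i
    apply copower_hom_ext_to
    intro j
    rw [reassoc_of% hq, Category.assoc, copowerLift_π, Category.comp_id, copowerι_π]
    have h := copowerι_π k (𝟙_ B) V i j
    apply hom_ext
    refine Eq.trans h ?_
    split_ifs <;> rfl
  · have h1 : ∑ i, p i ≫ q i = 𝟙 _ := by
      apply hom_ext
      have h := sum_copowerπ_ι k (𝟙_ B) V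
      refine Eq.trans ?_ h
      exact map_sum (homAddHom _ _) _ _
    refine Eq.trans ?_ h1
    refine (congrArg (· ≫ _) ((Category.comp_id _).symm.trans
      (congrArg (copowerLift k _ V p ≫ ·) (sum_copowerπ_ι k (𝟙_ (RightMod H)) V).symm))).trans ?_
    simp only [Preadditive.comp_sum, Preadditive.sum_comp, Category.assoc, hq]
    refine Finset.sum_congr rfl fun i _ => ?_
    rw [← Category.assoc, copowerLift_π]
  · intro v
    exact congrArg Hom.hom (copowerIn_desc k (𝟙_ (RightMod H)) V φ v)

end RightMod

open scoped MonObj ComonObj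

namespace RightMod

section Counit

variable {B : Type u} [Category.{v} B] [MonoidalCategory B] [BraidedCategory B] {H : B}
  [BimonObj H]

/-- The morphism induced on the generators modulo the augmentation by a morphism of free modules. -/
@[reducible]
def freeReduce {V W : B} (e : free H V ⟶ free H W) : V ⟶ W :=
  freeUnit H V ≫ e.hom ≫ W ◁ ε[H] ≫ (ρ_ W).hom

/-- A linear map from a free module to a trivial one factors through the counit on `H`, so it sees
only the reduction of `e`. -/
lemma freeUnit_comp_comp_of_triv {V W U : B} (e : free H V ⟶ free H W)
    (f : free H W ⟶ triv H U) :
    freeUnit H V ≫ (e ≫ f).hom = freeReduce e ≫ freeUnit H W ≫ f.hom := by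
  have h (f0 : W ⟶ U) : f0 ▷ H ≫ U ◁ ε[H] ≫ (ρ_ U).hom = (W ◁ ε[H] ≫ (ρ_ W).hom) ≫ f0 :=
    (counit_act_naturality f0).symm
  have h1 : f.hom = (W ◁ ε[H] ≫ (ρ_ W).hom) ≫ freeUnit H W ≫ f.hom :=
    (congrArg Hom.hom (freeDesc_freeUnit_comp f)).symm.trans (h _)
  have h2 (x : V ⊗ H ⟶ W ⊗ H) (y : W ⊗ H ⟶ U) (z : W ⟶ U)
      (hy : y = (W ◁ ε[H] ≫ (ρ_ W).hom) ≫ z) : freeUnit H V ≫ x ≫ y =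
      (freeUnit H V ≫ x ≫ W ◁ ε[H] ≫ (ρ_ W).hom) ≫ z := by
    rw [hy]; simp only [Category.assoc]
  exact h2 _ _ _ h1

end Counit

variable {k : Type v} [Field k] {B : Type u} [Category.{v} B] [Preadditive B]
  [Linear k B] [MonoidalCategory B] [MonoidalPreadditive B] [MonoidalLinear k B]
  [BraidedCategory B] {H : B} [BimonObj H]

variable (k H) in
/-- Morphisms from a free module to the unit. -/
def freeUnitLinearEquiv (V : B) : (free H V ⟶ 𝟙_ (RightMod H)) ≃ₗ[k] (V ⟶ 𝟙_ B) :=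
  { freeEquiv V (𝟙_ (RightMod H)) with
    map_add' := fun f g => Preadditive.comp_add _ _ _ (freeUnit H V) f.hom g.hom
    map_smul' := fun r f => Linear.comp_smul _ _ _ (freeUnit H V) r f.hom }

lemma freeUnitLinearEquiv_comp {V W : B} (e : free H V ⟶ free H W)
    (f : free H W ⟶ 𝟙_ (RightMod H)) :
    freeUnitLinearEquiv k H V (e ≫ f) = freeReduce e ≫ freeUnitLinearEquiv k H W f :=
  freeUnit_comp_comp_of_triv e f

variable [IsFiniteTensorCategory k B] [IsFiniteAbelian k (RightMod H)]

variable (k H) in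
/-- The comparison of copowers is natural. -/
lemma exists_copowerTriv_natural :
    ∃ c : ∀ V : FGModuleCat.{v} k,
      (copower k (𝟙_ (RightMod H))).obj V ≅ triv H ((copower k (𝟙_ B)).obj V),
      ∀ {V W : FGModuleCat.{v} k} (f : V ⟶ W),
        (copower k (𝟙_ (RightMod H))).map f ≫ (c W).hom =
          (c V).hom ≫ trivMap H ((copower k (𝟙_ B)).map f) := by
  choose c hc using exists_copowerTriv k H
  refine ⟨c, fun {V W} f => copowerIn_hom_ext (k := k) (M := 𝟙_ (RightMod H)) fun v => hom_ext ?_⟩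
  have h1 := congrArg (fun t => Hom.hom (t ≫ (c W).hom)) (copowerIn_map k (𝟙_ (RightMod H)) f v)
  have h2 := copowerIn_map k (𝟙_ B) f v
  refine (congrArg Hom.hom (Category.assoc _ _ _).symm).trans
    ((h1.trans (hc W _)).trans (h2.symm.trans ?_))
  refine (congrArg (· ≫ (copower k (𝟙_ B)).map f) (hc V v).symm).trans ?_
  exact congrArg Hom.hom (Category.assoc (copowerIn k (𝟙_ (RightMod H)) V v) (c V).hom
    (trivMap H ((copower k (𝟙_ B)).map f)))

variable (k H) in
/-- The comparison of `Hom(-, 𝟙)^*` on free modules. -/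
noncomputable def dualHomFreeIso (V : B) :
    (dualHomFunctor k (𝟙_ (RightMod H))).obj (free H V) ≅ (dualHomFunctor k (𝟙_ B)).obj V where
  hom := ConcreteCategory.ofHom (freeUnitLinearEquiv k H V).symm.dualMap.toLinearMap
  inv := ConcreteCategory.ofHom (freeUnitLinearEquiv k H V).dualMap.toLinearMap
  hom_inv_id := by
    apply FGModuleCat.hom_ext
    exact (freeUnitLinearEquiv k H V).symm.dualMap.symm_comp
  inv_hom_id := by
    apply FGModuleCat.hom_ext
    exact (freeUnitLinearEquiv k H V).dualMap.symm_comp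

/-- The unit is a trivial module, so precomposition with `e` on maps to it is precomposition with
`freeReduce e`. -/
lemma dualHomFreeIso_naturality {V W : B} (e : free H V ⟶ free H W) :
    (dualHomFunctor k (𝟙_ (RightMod H))).map e ≫ (dualHomFreeIso k H W).hom =
      (dualHomFreeIso k H V).hom ≫ (dualHomFunctor k (𝟙_ B)).map (freeReduce e) := by
  apply FGModuleCat.hom_ext
  refine LinearMap.ext fun φ : Module.Dual k (free H V ⟶ 𝟙_ (RightMod H)) =>
    LinearMap.ext fun f : W ⟶ 𝟙_ B => congrArg φ ?_
  change e ≫ (freeUnitLinearEquiv k H W).symm f =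
    (freeUnitLinearEquiv k H V).symm (freeReduce e ≫ f)
  rw [LinearEquiv.eq_symm_apply, freeUnitLinearEquiv_comp, LinearEquiv.apply_symm_apply]

variable (k H) in
/-- The functor `J` on free modules. -/
lemma exists_trivialBimoduleFunctor_free_iso :
    ∃ j : ∀ V : B, (trivialBimoduleFunctor k (C := RightMod H)).obj (free H V) ≅
        triv H ((trivialBimoduleFunctor k (C := B)).obj V),
      ∀ {V W : B} (e : free H V ⟶ free H W),
        (trivialBimoduleFunctor k).map e ≫ (j W).hom =
          (j V).hom ≫ trivMap H ((trivialBimoduleFunctor k).map (freeReduce e)) := by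
  obtain ⟨c, hc⟩ := exists_copowerTriv_natural k H
  refine ⟨fun V => (copower k (𝟙_ (RightMod H))).mapIso (dualHomFreeIso k H V) ≪≫ c _,
    fun {V W} e => ?_⟩
  have h := congrArg (copower k (𝟙_ (RightMod H))).map (dualHomFreeIso_naturality (k := k) e)
  rw [Functor.map_comp, Functor.map_comp] at h
  have h' := hc ((dualHomFunctor k (𝟙_ B)).map (freeReduce e))
  refine ((Category.assoc _ _ _).symm.trans (congrArg (· ≫ (c _).hom) h)).trans ?_
  rw [Category.assoc]
  exact (congrArg ((copower k (𝟙_ (RightMod H))).map (dualHomFreeIso k H V).hom ≫ ·) h').trans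
    (Category.assoc _ _ _).symm

end RightMod

/-! ### From the modular object of `B` to that of the category of modules. -/

open ExactPairing
open scoped MonObj ComonObj

namespace IsUniversalTensorRight

variable {B : Type u} [Category.{v} B] [MonoidalCategory B] {J : B ⥤ B} {a : B}
  {t : J ⟶ tensorRight a}

/-- The components of a universal transformation, with an explicit target. -/
@[reducible]
def comp (t : J ⟶ tensorRight a) (V : B) : J.obj V ⟶ V ⊗ a := t.app V

lemma comp_naturality (t : J ⟶ tensorRight a) {V W : B} (f : V ⟶ W) :
    J.map f ≫ comp t W = comp t V ≫ f ▷ a := t.naturality f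

lemma hom_ext (ht : IsUniversalTensorRight t) {X : B} {f g : a ⟶ X}
    (h : ∀ V, comp t V ≫ V ◁ f = comp t V ≫ V ◁ g) : f = g :=
  (ht X (t ≫ (tensoringRight B).map g)).unique (NatTrans.ext (funext h)) rfl

lemma exists_hom (ht : IsUniversalTensorRight t) {X : B} (φ : ∀ V, J.obj V ⟶ V ⊗ X)
    (hφ : ∀ {V W : B} (f : V ⟶ W), J.map f ≫ φ W = φ V ≫ f ▷ X) :
    ∃ f : a ⟶ X, ∀ V, comp t V ≫ V ◁ f = φ V := by
  obtain ⟨f, hf, -⟩ := ht X { app := φ, naturality := fun _ _ f => hφ f }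
  exact ⟨f, fun V => congrArg (fun s : J ⟶ tensorRight X => s.app V) hf⟩

/-- Moving `H` to the target by its dual reduces this to maps out of `a`. It is used to check
linearity. -/
lemma whiskerRight_hom_ext (ht : IsUniversalTensorRight t) (H H' : B) [ExactPairing H H'] {Y : B}
    {f g : a ⊗ H ⟶ Y} (h : ∀ V, comp t V ▷ H ≫ (α_ V a H).hom ≫ V ◁ f =
      comp t V ▷ H ≫ (α_ V a H).hom ≫ V ◁ g) : f = g := by
  apply (tensorRightHomEquiv a H H' Y).injective
  apply ht.hom_ext
  intro V
  have key (f : a ⊗ H ⟶ Y) : comp t V ≫ V ◁ (tensorRightHomEquiv a H H' Y f) =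
      𝟙 _ ⊗≫ J.obj V ◁ η_ H H' ⊗≫ (comp t V ▷ H ≫ (α_ V a H).hom ≫ V ◁ f) ▷ H' ⊗≫ 𝟙 _ := by
    simp only [tensorRightHomEquiv, Equiv.coe_fn_mk]
    calc comp t V ≫ V ◁ ((ρ_ a).inv ≫ a ◁ η_ H H' ≫ (α_ a H H').inv ≫ f ▷ H')
      _ = 𝟙 _ ⊗≫ (comp t V ▷ 𝟙_ B ≫ (V ⊗ a) ◁ η_ H H') ⊗≫ V ◁ f ▷ H' ⊗≫ 𝟙 _ := by monoidal
      _ = _ := by rw [← whisker_exchange]; monoidal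
  rw [key, key, h]

/-- The coevaluation of `H` is moved into the argument of `t` by naturality along `V ⟶ (V ⊗ D) ⊗ H`;
thus components at objects of the form `V ⊗ H` suffice. It is used to check left invariance. -/
lemma whiskerLeft_hom_ext (ht : IsUniversalTensorRight t) (D H : B) [ExactPairing D H] {Y : B}
    {f g : H ⊗ a ⟶ Y} (h : ∀ V, comp t (V ⊗ H) ≫ (α_ V H a).hom ≫ V ◁ f =
      comp t (V ⊗ H) ≫ (α_ V H a).hom ≫ V ◁ g) : f = g := by
  apply (tensorLeftHomEquiv a D H Y).injective
  apply ht.hom_ext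
  intro V
  have key (f : H ⊗ a ⟶ Y) : comp t V ≫ V ◁ (tensorLeftHomEquiv a D H Y f) =
      J.map ((ρ_ V).inv ≫ V ◁ η_ D H ≫ (α_ V D H).inv) ≫
        (comp t ((V ⊗ D) ⊗ H) ≫ (α_ (V ⊗ D) H a).hom ≫ (V ⊗ D) ◁ f) ≫ (α_ V D Y).hom := by
    simp only [tensorLeftHomEquiv, Equiv.coe_fn_mk, Category.assoc]
    rw [reassoc_of% comp_naturality]
    monoidal
  rw [key, key, h]

end IsUniversalTensorRight

namespace RightMod

section Act

variable {B : Type u} [Category.{v} B] [MonoidalCategory B] [BraidedCategory B] {H : B}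
  [BimonObj H]

/-- A free module is a trivial module times the regular one, so on its product with `X` the algebra
acts only on `H ⊗ X`. -/
lemma free_tens_act (V : B) (X : RightMod H) :
    (tens (free H V) X).act ≫ (α_ V H X.X).hom = (α_ V H X.X).hom ▷ H ≫
      (α_ V (H ⊗ X.X) H).hom ≫ V ◁ (tens (reg H) X).act := by
  have h1 : (tens (tens (triv H V) (reg H)) X).act ≫ 𝟙 (V ⊗ H) ▷ X.X =
      (𝟙 (V ⊗ H) ▷ X.X) ▷ H ≫ (tens (free H V) X).act := ((trivRegIso V).hom ▷ X).comm
  have h2 : (tens (tens (triv H V) (reg H)) X).act ≫ (α_ V H X.X).hom =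
      (α_ V H X.X).hom ▷ H ≫ (tens (triv H V) (tens (reg H) X)).act :=
    assoc_comm (triv H V) (reg H) X
  have h3 : (tens (triv H V) (tens (reg H) X)).act =
      (α_ V (H ⊗ X.X) H).hom ≫ V ◁ (tens (reg H) X).act := triv_tens_act V (tens (reg H) X)
  have h4 : (tens (tens (triv H V) (reg H)) X).act = (tens (free H V) X).act := by
    refine Eq.trans ?_ (h1.trans ?_)
    · rw [id_whiskerRight]; exact (Category.comp_id _).symm
    · rw [id_whiskerRight, id_whiskerRight]; exact Category.id_comp _
  rw [← h4]
  exact h2.trans (congrArg ((α_ V H X.X).hom ▷ H ≫ ·) h3)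

variable {A V a : B} (t : A ⟶ V ⊗ a)

lemma counit_act_comp {X : B} (g : a ⟶ H ⊗ X) :
    (A ◁ ε[H] ≫ (ρ_ A).hom) ≫ t ≫ V ◁ g ≫ (α_ V H X).inv =
      t ▷ H ≫ (α_ V a H).hom ≫ V ◁ ((a ◁ ε[H] ≫ (ρ_ a).hom) ≫ g) ≫ (α_ V H X).inv := by
  rw [← Category.assoc, counit_act_naturality]
  monoidal

lemma comm_iff_of_act {X : B} (g : a ⟶ H ⊗ X) (b : (H ⊗ X) ⊗ H ⟶ H ⊗ X)
    (b' : ((V ⊗ H) ⊗ X) ⊗ H ⟶ (V ⊗ H) ⊗ X)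
    (h : b' ≫ (α_ V H X).hom = (α_ V H X).hom ▷ H ≫ (α_ V (H ⊗ X) H).hom ≫ V ◁ b) :
    (A ◁ ε[H] ≫ (ρ_ A).hom) ≫ t ≫ V ◁ g ≫ (α_ V H X).inv =
      (t ≫ V ◁ g ≫ (α_ V H X).inv) ▷ H ≫ b' ↔
    t ▷ H ≫ (α_ V a H).hom ≫ V ◁ ((a ◁ ε[H] ≫ (ρ_ a).hom) ≫ g) =
      t ▷ H ≫ (α_ V a H).hom ≫ V ◁ (g ▷ H ≫ b) := by
  have h2 : ((t ≫ V ◁ g ≫ (α_ V H X).inv) ▷ H ≫ b') ≫ (α_ V H X).hom =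
      t ▷ H ≫ (α_ V a H).hom ≫ V ◁ (g ▷ H ≫ b) := by
    simp only [Category.assoc, h]
    monoidal
  rw [← cancel_mono (α_ V H X).hom, h2, counit_act_comp]
  simp only [Category.assoc, Iso.inv_hom_id, Category.comp_id]

/-- Linearity of morphisms to `free V ⊗ X` in terms of morphisms to `H ⊗ X`. -/
lemma comm_iff {X : RightMod H} (g : a ⟶ H ⊗ X.X) :
    (A ◁ ε[H] ≫ (ρ_ A).hom) ≫ t ≫ V ◁ g ≫ (α_ V H X.X).inv =
      (t ≫ V ◁ g ≫ (α_ V H X.X).inv) ▷ H ≫ (tens (free H V) X).act ↔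
    t ▷ H ≫ (α_ V a H).hom ≫ V ◁ ((a ◁ ε[H] ≫ (ρ_ a).hom) ≫ g) =
      t ▷ H ≫ (α_ V a H).hom ≫ V ◁ (g ▷ H ≫ (tens (reg H) X).act) :=
  comm_iff_of_act t g _ _ (free_tens_act V X)

/-- Together with `comp_free_hom`, this writes the two sides of naturality along `e` through the
same map `V ⟶ W ⊗ H`: one side applies the counit to `H`, the other multiplies by it. Their equality
is left invariance of `g`. -/
lemma freeReduce_comp {V W X : B} (e : free H V ⟶ free H W) (g : a ⟶ H ⊗ X) :
    freeReduce e ▷ a ≫ W ◁ g ≫ (α_ W H X).inv =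
      (freeUnit H V ≫ e.hom) ▷ a ≫ (α_ W H a).hom ≫
        W ◁ (ε[H] ▷ a ≫ (λ_ a).hom ≫ g) ≫ (α_ W H X).inv := by
  have h (x : V ⟶ W ⊗ H) : (x ≫ W ◁ ε[H] ≫ (ρ_ W).hom) ▷ a ≫ W ◁ g ≫ (α_ W H X).inv =
      x ▷ a ≫ (α_ W H a).hom ≫ W ◁ (ε[H] ▷ a ≫ (λ_ a).hom ≫ g) ≫ (α_ W H X).inv := by
    monoidal
  have h' := h (freeUnit H V ≫ e.hom)
  rw [Category.assoc] at h'
  exact h'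

lemma comp_free_hom {V W X : B} (e : free H V ⟶ free H W) (g : a ⟶ H ⊗ X) :
    V ◁ g ≫ (α_ V H X).inv ≫ e.hom ▷ X =
      (freeUnit H V ≫ e.hom) ▷ a ≫ (α_ W H a).hom ≫
        W ◁ (H ◁ g ≫ (α_ H H X).inv ≫ μ[H] ▷ X) ≫ (α_ W H X).inv := by
  have h (x : V ⟶ W ⊗ H) : V ◁ g ≫ (α_ V H X).inv ≫ (x ▷ H ≫ (α_ W H H).hom ≫ W ◁ μ[H]) ▷ X =
      x ▷ a ≫ (α_ W H a).hom ≫ W ◁ (H ◁ g ≫ (α_ H H X).inv ≫ μ[H] ▷ X) ≫ (α_ W H X).inv := by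
    calc V ◁ g ≫ (α_ V H X).inv ≫ (x ▷ H ≫ (α_ W H H).hom ≫ W ◁ μ[H]) ▷ X
      _ = (V ◁ g ≫ x ▷ (H ⊗ X)) ⊗≫ W ◁ μ[H] ▷ X ⊗≫ 𝟙 _ := by monoidal
      _ = _ := by rw [whisker_exchange]; monoidal
  have h1 : e.hom = (freeUnit H V ≫ e.hom) ▷ H ≫ (α_ W H H).hom ≫ W ◁ μ[H] :=
    (congrArg Hom.hom (freeDesc_freeUnit_comp e)).symm
  exact (congrArg (fun x => V ◁ g ≫ (α_ V H X).inv ≫ x ▷ X) h1).trans (h _)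

end Act

end RightMod

open ExactPairing
open scoped MonObj ComonObj HopfObj

namespace RightMod

open IsUniversalTensorRight

section Families

variable {B : Type u} [Category.{v} B] [MonoidalCategory B] [BraidedCategory B] {H : B}
  [BimonObj H]

lemma freeReduce_freeMap {V W : B} (f : V ⟶ W) : freeReduce (freeMap H f) = f := by
  change ((ρ_ V).inv ≫ V ◁ η[H]) ≫ f ▷ H ≫ W ◁ ε[H] ≫ (ρ_ W).hom = f
  have h : η[H] ≫ ε[H] = 𝟙 (𝟙_ B) := BimonObj.one_counit H
  calc ((ρ_ V).inv ≫ V ◁ η[H]) ≫ f ▷ H ≫ W ◁ ε[H] ≫ (ρ_ W).hom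
    _ = (ρ_ V).inv ≫ V ◁ η[H] ≫ (f ▷ H ≫ W ◁ ε[H]) ≫ (ρ_ W).hom := by
      simp only [Category.assoc]
    _ = (ρ_ V).inv ≫ V ◁ (η[H] ≫ ε[H]) ≫ f ▷ 𝟙_ B ≫ (ρ_ W).hom := by
      rw [← whisker_exchange]; simp only [Category.assoc, whiskerLeft_comp]
    _ = f := by rw [h]; monoidal

variable {J : B ⥤ B} {a : B} {t : J ⟶ tensorRight a} {X : RightMod H}

/-- A family of morphisms `J V ⟶ free V ⊗ X` is linear and natural. -/
structure IsFreeNatural (J : B ⥤ B) (X : RightMod H) (ψ : ∀ V, J.obj V ⟶ (V ⊗ H) ⊗ X.X) : Prop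
    where
  naturality : ∀ {V W : B} (e : free H V ⟶ free H W),
    J.map (freeReduce e) ≫ ψ W = ψ V ≫ e.hom ▷ X.X
  linear : ∀ V, (J.obj V ◁ ε[H] ≫ (ρ_ (J.obj V)).hom) ≫ ψ V =
    ψ V ▷ H ≫ (tens (free H V) X).act

lemma isFreeNatural_of_isLeftInvariant (t : J ⟶ tensorRight a) (g : triv H a ⟶ reg H ⊗ X)
    (hg : IsLeftInvariant g.hom) :
    IsFreeNatural J X (fun V => comp t V ≫ V ◁ g.hom ≫ (α_ V H X.X).inv) where
  naturality {V W} e := by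
    have hg : H ◁ g.hom ≫ (α_ H H X.X).inv ≫ μ[H] ▷ X.X = ε[H] ▷ a ≫ (λ_ a).hom ≫ g.hom := hg
    have key (g : a ⟶ H ⊗ X.X)
        (hg : H ◁ g ≫ (α_ H H X.X).inv ≫ μ[H] ▷ X.X = ε[H] ▷ a ≫ (λ_ a).hom ≫ g) :
        J.map (freeReduce e) ≫ comp t W ≫ W ◁ g ≫ (α_ W H X.X).inv =
          (comp t V ≫ V ◁ g ≫ (α_ V H X.X).inv) ≫ e.hom ▷ X.X := by
      rw [reassoc_of% comp_naturality t (freeReduce e), freeReduce_comp, ← hg, ← comp_free_hom]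
      simp only [Category.assoc]
    exact key g.hom hg
  linear V := by
    have hl : (a ◁ ε[H] ≫ (ρ_ a).hom) ≫ g.hom = g.hom ▷ H ≫ (tens (reg H) X).act := g.comm
    exact (comm_iff (comp t V) g.hom).2
      (congrArg (fun x => comp t V ▷ H ≫ (α_ V a H).hom ≫ V ◁ x) hl)

/-- Naturality along maps from `B` produces `g` by universality of `t`. Linearity of the family
makes `g` linear, and naturality along the remaining maps of free modules makes it left invariant.
-/
lemma exists_isLeftInvariant (ht : IsUniversalTensorRight t) (D H' : B) [ExactPairing D H]
    [ExactPairing H H'] {ψ : ∀ V, J.obj V ⟶ (V ⊗ H) ⊗ X.X} (h : IsFreeNatural J X ψ) :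
    ∃ g : triv H a ⟶ reg H ⊗ X, IsLeftInvariant g.hom ∧
      ∀ V, comp t V ≫ V ◁ g.hom ≫ (α_ V H X.X).inv = ψ V := by
  obtain ⟨g, hg⟩ := ht.exists_hom (fun V => ψ V ≫ (α_ V H X.X).hom) (fun {V W} f => by
    have h1 := h.naturality (freeMap H f)
    rw [freeReduce_freeMap] at h1
    rw [← Category.assoc, h1]
    change (ψ V ≫ f ▷ H ▷ X.X) ≫ (α_ W H X.X).hom = _
    rw [Category.assoc, Category.assoc, associator_naturality_left])
  have hψ (V : B) : comp t V ≫ V ◁ g ≫ (α_ V H X.X).inv = ψ V := by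
    rw [← Category.assoc, hg, Category.assoc, Iso.hom_inv_id, Category.comp_id]
  have hlin : (a ◁ ε[H] ≫ (ρ_ a).hom) ≫ g = g ▷ H ≫ (tens (reg H) X).act := by
    refine ht.whiskerRight_hom_ext H H' fun V => (comm_iff (comp t V) g).1 ?_
    rw [hψ]
    exact h.linear V
  have hinv : IsLeftInvariant g := by
    refine ht.whiskerLeft_hom_ext D H fun V => ?_
    -- The generic map of free modules, classified by the identity of `V ⊗ H`; naturality along it
    -- gives invariance without any further factor.
    let e : free H (V ⊗ H) ⟶ free H V := freeDesc (N := free H V) (𝟙 (V ⊗ H))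
    have he : freeUnit H (V ⊗ H) ≫ e.hom = 𝟙 (V ⊗ H) :=
      freeUnit_comp_freeDesc (N := free H V) (𝟙 (V ⊗ H))
    have h1 := h.naturality e
    rw [← hψ, ← hψ, reassoc_of% comp_naturality t (freeReduce e), freeReduce_comp] at h1
    simp only [Category.assoc] at h1
    rw [comp_free_hom] at h1
    have h2 := congrArg (· ≫ (α_ V H X.X).hom) h1
    rw [he] at h2
    simpa using h2.symm
  exact ⟨⟨g, hlin⟩, hinv, hψ⟩

end Families

section Main

variable {B : Type u} [Category.{v} B] [Abelian B] [MonoidalCategory B] [MonoidalPreadditive B]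
  [BraidedCategory B] {H : B} [BimonObj H] [∀ Y : B, PreservesFiniteColimits (tensorRight Y)]
  {J : B ⥤ B} [J.Additive] [PreservesFiniteColimits J] {a : B} {t : J ⟶ tensorRight a}

attribute [local instance] RightMod.abelian

/-- A universal left invariant morphism gives a universal transformation for modules. -/
lemma exists_isUniversalTensorRight_of_isLeftInvariant (ht : IsUniversalTensorRight t)
    {P : B} (hP : IsProgenerator P) (D H' : B) [ExactPairing D H] [ExactPairing H H']
    {F : RightMod H ⥤ RightMod H} [F.Additive] [PreservesFiniteColimits F]
    (j : ∀ V : B, F.obj (free H V) ≅ triv H (J.obj V))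
    (hj : ∀ {V W : B} (e : free H V ⟶ free H W),
      F.map e ≫ (j W).hom = (j V).hom ≫ trivMap H (J.map (freeReduce e)))
    {c : RightMod H} (w : triv H a ⟶ reg H ⊗ c) (hw : IsLeftInvariant w.hom)
    (hu : ∀ (X : RightMod H) (g : triv H a ⟶ reg H ⊗ X), IsLeftInvariant g.hom →
      ∃! f : c ⟶ X, w ≫ reg H ◁ f = g) :
    ∃ s : F ⟶ tensorRight c, IsUniversalTensorRight s := by
  have hj' {V W : B} (e : free H V ⟶ free H W) :
      (j V).inv ≫ F.map e = trivMap H (J.map (freeReduce e)) ≫ (j W).inv := by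
    rw [Iso.inv_comp_eq, ← reassoc_of% hj, Iso.hom_inv_id, Category.comp_id]
  have hPC := isProgenerator_free (H := H) hP
  have hN {X : RightMod H} (θ : F ⟶ tensorRight X) :
      IsFreeNatural J X (fun V => ((j V).inv ≫ θ.app (free H V)).hom) :=
    { naturality := fun {V W} e => by
        have h1 : trivMap H (J.map (freeReduce e)) ≫ (j W).inv ≫ θ.app (free H W) =
            ((j V).inv ≫ θ.app (free H V)) ≫ (tensorRight X).map e := by
          rw [Category.assoc, ← θ.naturality, ← Category.assoc, ← hj', Category.assoc]
        exact congrArg Hom.hom h1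
      linear := fun V => ((j V).inv ≫ θ.app (free H V)).comm }
  let f0 (V : B) : triv H (J.obj V) ⟶ free H V ⊗ c :=
    ⟨comp t V ≫ V ◁ w.hom ≫ (α_ V H c.X).inv, (isFreeNatural_of_isLeftInvariant t w hw).linear V⟩
  have hf0 {V W : B} (e : free H V ⟶ free H W) :
      trivMap H (J.map (freeReduce e)) ≫ f0 W = f0 V ≫ e ▷ c :=
    hom_ext ((isFreeNatural_of_isLeftInvariant t w hw).naturality e)
  -- The family `f0` is only defined on free modules. The free module on `P` is a progenerator, so
  -- its component there extends to all modules.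
  obtain ⟨s, hs⟩ := hPC.exists_natTrans (F := F) (G := tensorRight c) ((j P).hom ≫ f0 P)
    (fun e => by
      rw [reassoc_of% hj e, hf0, Category.assoc]; rfl)
  -- Equality of transformations out of `F` is tested at the single module `free H P`.
  have hsP {X : RightMod H} (f : c ⟶ X) (θ : F ⟶ tensorRight X) :
      s ≫ (tensoringRight _).map f = θ ↔
        comp t P ≫ P ◁ (w ≫ reg H ◁ f).hom ≫ (α_ P H X.X).inv =
          ((j P).inv ≫ θ.app (free H P)).hom := by
    have h1 : (f0 P ≫ free H P ◁ f).hom =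
        comp t P ≫ P ◁ (w ≫ reg H ◁ f).hom ≫ (α_ P H X.X).inv := by
      have h2 (x : a ⟶ H ⊗ c.X) (y : c.X ⟶ X.X) :
          (comp t P ≫ P ◁ x ≫ (α_ P H c.X).inv) ≫ (P ⊗ H) ◁ y =
            comp t P ≫ P ◁ (x ≫ H ◁ y) ≫ (α_ P H X.X).inv := by
        monoidal
      exact h2 w.hom f.hom
    rw [← h1]
    have h3 : s ≫ (tensoringRight _).map f = θ ↔
        f0 P ≫ free H P ◁ f = (j P).inv ≫ θ.app (free H P) := by
      rw [Iso.eq_inv_comp, ← Category.assoc, ← hs]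
      exact ⟨fun h => congrArg (fun r : F ⟶ tensorRight X => r.app (free H P)) h,
        fun h => hPC.natTrans_ext (G := tensorRight X) h⟩
    rw [h3]
    exact ⟨fun h => congrArg Hom.hom h, fun h => hom_ext h⟩
  refine ⟨s, fun X θ => ?_⟩
  obtain ⟨g, hg, hgψ⟩ := exists_isLeftInvariant ht D H' (hN θ)
  obtain ⟨f, hf, hfu⟩ := hu X g hg
  have hf : w ≫ reg H ◁ f = g := hf
  refine ⟨f, (hsP f θ).2 ?_, fun f' hf' => hfu f' ?_⟩
  · rw [hf]; exact hgψ P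
  · have h4 := ((hsP f' θ).1 hf').trans (hgψ P).symm
    apply hom_ext
    -- Agreement is known only at `P`; right exactness of `J` spreads it to all of `B`, after which
    -- uniqueness for `t` applies.
    refine (ht _ (t ≫ (tensoringRight B).map g.hom)).unique ?_ rfl
    refine hP.natTrans_ext (G := tensorRight (H ⊗ X.X)) ?_
    change comp t P ≫ P ◁ (w ≫ reg H ◁ f').hom = comp t P ≫ P ◁ g.hom
    have h5 (x y : a ⟶ H ⊗ X.X) (h : comp t P ≫ P ◁ x ≫ (α_ P H X.X).inv =
        comp t P ≫ P ◁ y ≫ (α_ P H X.X).inv) : comp t P ≫ P ◁ x = comp t P ≫ P ◁ y := by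
      rw [← cancel_mono (α_ P H X.X).inv]; simpa only [Category.assoc] using h
    exact h5 _ _ h4

end Main

end RightMod

open scoped MonObj ComonObj HopfObj

namespace RightMod

lemma isModularObject {k : Type v} [Field k] {B : Type u} [Category.{v} B] [Preadditive B]
    [Linear k B] [MonoidalCategory B] [MonoidalPreadditive B] [MonoidalLinear k B]
    [BraidedCategory B] [IsFiniteTensorCategory k B] {H : B} [HopfObj H]
    [IsFiniteTensorCategory k (RightMod H)] {I : B} {Λ : I ⟶ H}
    (hΛ : IsUniversalRightIntegral Λ) {χ : H ⟶ 𝟙_ B} [IsMonHom χ]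
    (hχ : χ ▷ I ≫ (λ_ I).hom ≫ Λ = H ◁ Λ ≫ μ[H]) (I' : B) [ExactPairing I I'] {a : B}
    (ha : IsModularObject k a) : IsModularObject k (triv H I' ⊗ ofChar χ ⊗ triv H a) := by
  obtain ⟨t, ht⟩ := (isModularObject_iff a).1 ha
  rw [isModularObject_iff]
  obtain ⟨_⟩ := IsFiniteTensorCategory.rigid (k := k) (C := B)
  let _ := IsFiniteAbelian.abelian k B
  have (Y : B) : PreservesFiniteColimits (tensorRight Y) := (rexProp_tensorRight k Y).2
  have := isIso_antipode H k
  obtain ⟨P, hP⟩ := IsFiniteAbelian.exists_progenerator k B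
  obtain ⟨j, hj⟩ := exists_trivialBimoduleFunctor_free_iso k H
  obtain ⟨w, hw, hu⟩ := exists_universal_isLeftInvariant hΛ hχ I' (triv H a)
  obtain ⟨_, _⟩ := (rexProp_trivialBimoduleFunctor k (C := B)).1
  obtain ⟨_, _⟩ := (rexProp_trivialBimoduleFunctor k (C := RightMod H)).1
  have := (rexProp_trivialBimoduleFunctor k (C := B)).2
  have := (rexProp_trivialBimoduleFunctor k (C := RightMod H)).2
  exact exists_isUniversalTensorRight_of_isLeftInvariant ht hP (ᘁH) (Hᘁ) j hj w hw hu

end RightMod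

theorem theorem5p2 {k : Type v} [Field k] {B : Type u} [Category.{v} B] [Preadditive B]
    [Linear k B] [MonoidalCategory B] [MonoidalPreadditive B] [MonoidalLinear k B]
    [BraidedCategory B] [IsFiniteTensorCategory k B] (H : B) [HopfObj H] :
    -- the category of right `H`-modules is a finite tensor category over `k`
    ∃ _ : IsFiniteTensorCategory k (RightMod H),
      -- `B` has a modular object, and there is a universal right integral in `H`
      (∃ aB : B, IsModularObject k aB) ∧
      (∃ Λ : RightIntegral H, Nonempty (IsTerminal Λ)) ∧
      -- for every universal right integral `Λ : Int(H) ⟶ H`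
      ∀ Λ : RightIntegral H, Nonempty (IsTerminal Λ) →
        -- there is exactly one modular function, and it is an algebra map
        ∃ (αH : H ⟶ 𝟙_ B) (_ : IsMonHom αH), IsModularFunction Λ αH ∧
          (∀ χ : H ⟶ 𝟙_ B, IsModularFunction Λ χ → χ = αH) ∧
          -- and `Int(H)^* ⊗ α_H ⊗ α_B` is the modular object of the category of right `H`-modules
          ∀ (dualInt : B) [ExactPairing Λ.obj.left dualInt] (aB : B), IsModularObject k aB →
            IsModularObject k
              (RightMod.triv H dualInt ⊗ RightMod.ofChar αH ⊗ RightMod.triv H aB) := by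
  have hC := RightMod.isFiniteTensorCategory H k
  refine ⟨hC, ?_, RightMod.exists_isTerminal k, fun Λ ⟨hΛ⟩ => ?_⟩
  · obtain ⟨⟨L, adj⟩⟩ := exists_cayley_leftAdjoint k (C := B)
    exact ⟨L.obj (rexJ k B), L, ⟨adj⟩, ⟨Iso.refl _⟩⟩
  · have h := isUniversalRightIntegral_of_isTerminal hΛ
    -- Invertibility of `Int(H)` is what makes the modular function exist, be unique and be
    -- multiplicative.
    obtain ⟨V, ⟨e⟩⟩ := RightMod.exists_integralInvIso k h
    obtain ⟨χ, hχ, hu⟩ := h.existsUnique_modularFunction e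
    have hm := h.isMonHom e hχ
    exact ⟨χ, hm, hχ, hu, fun dualInt _ aB ha => RightMod.isModularObject h hχ dualInt ha⟩
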